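/- Let $n \ge 3$ and let $F_n$ be the free group with basis $x_1,\dots,x_n$. Let $\Gamma_n(1)=F_n$, $\Gamma_n(k+1)=[\Gamma_n(k),F_n]$ be its lower central series, $\mathcal L_n(k)=\Gamma_n(k)/\Gamma_n(k+1)$, $H=H_1(F_n,\mathbb Z)$ with basis $x_1,\dots,x_n$, and $H^*=\mathrm{Hom}_{\mathbb Z}(H,\mathbb Z)$ with dual basis $x_1^*,\dots,x_n^*$. For $k\ge 1$ let $\mathcal A_n(k)$ be the kernel of $\mathrm{Aut}\,F_n\to\mathrm{Aut}(F_n/\Gamma_n(k+1))$, let $\mathrm P\Sigma_n\subset\mathrm{Aut}\,F_n$ be the group of automorphisms sending each $x_i$ to a conjugate of $x_i$, and put $\mathcal P_n(k)=\mathrm P\Sigma_n\cap\mathcal A_n(k)$ and $\mathrm{gr}^k(\mathcal P_n)=\mathcal P_n(k)/\mathcal P_n(k+1)$. Let $\mathfrak p_n(k)\subset \mathrm{Hom}_{\mathbb Z}(H,\mathcal L_n(k+1))=H^*\otimes_{\mathbb Z}\mathcal L_n(k+1)$ be the submodule generated by all $x_i^*\otimes[x_{j_1},\dots,x_{j_k},x_i]$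 (left-normed commutators, $1\le i,j_1,\dots,j_k\le n$). The Johnson homomorphism $\tau_k^P:\mathrm{gr}^k(\mathcal P_n)\to H^*\otimes\mathcal L_n(k+1)$ sends the class of $\sigma$ to $y\mapsto y^{-1}\sigma(y)$. Let $\mathcal C_n(k)$ be the quotient of $H^{\otimes k}$ by the submodule generated by all $a_1\otimes a_2\otimes\cdots\otimes a_k-a_2\otimes\cdots\otimes a_k\otimes a_1$, and let $\overline{\mathcal C}_n(k)=\mathcal C_n(k)/\langle x_1^k,\dots,x_n^k\rangle$, where $x_i^k$ is the class of $x_i\otimes\cdots\otimes x_i$. Let $\overline{\mathrm{Tr}}{}_k^P:\mathfrak p_n(k)\to\overline{\mathcal C}_n(k)$ be the restriction to $\mathfrak p_n(k)$ of the composite $$H^*\otimes\mathcal L_n(k+1)\to H^*\otimes H^{\otimes(k+1)}\to H^{\otimes k}\to\mathcal C_n(k)\to\overline{\mathcal C}_n(k),$$ where the first map is induced by the natural embedding of $\bigoplus_k\mathcal L_n(k)$, the free Lie algebra on $H$, into the tensor algebra of $H$, the second contracts $H^*$ with the first tensor factor, and the others are the projections. The symmetric group $\mathfrak S_n$ acts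 on all these modules by permuting $x_1,\dots,x_n$ (on $\mathrm{gr}^k(\mathcal P_n)$ by conjugation in $\mathrm{Aut}\,F_n$). Then: (1) For $k=2,3,4$ the map $\tau_k^P$ takes its values in $\mathfrak p_n(k)$. (2) For $k=2,3$ the sequence $$0\to\mathrm{gr}^k(\mathcal P_n)\xrightarrow{\tau_k^P}\mathfrak p_n(k)\xrightarrow{\overline{\mathrm{Tr}}{}_k^P}\overline{\mathcal C}_n(k)\to 0$$ is exact and $\mathfrak S_n$-equivariant. (3) For $k=4$ there is an $\mathfrak S_n$-equivariant exact sequence $$0\to\mathrm{gr}^4(\mathcal P_n)\xrightarrow{\tau_4^P}\mathfrak p_n(4)\xrightarrow{\overline{\mathrm{Tr}}{}_4^P}\overline{\mathcal C}_n(4)\to Q\to 0,$$ in which $Q$ is the free abelian group on the set of $2$-element subsets of $\{1,\dots,n\}$ with the permutation action of $\mathfrak S_n$. In particular $\mathrm{Im}(\tau_4^P)=\mathrm{Ker}(\overline{\mathrm{Tr}}{}_4^P)$, and the cokernel of $\overline{\mathrm{Tr}}{}_4^P$ is a free abelian group of rank $n(n-1)/2$. (4) $\mathrm{Im}(\tau_4^P)$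 is a free abelian group of rank $n^2(n-1)^2(n+1)/4$. -/

import Mathlib

namespace BasisConj

noncomputable section

open scoped TensorProduct commutatorElement

/-! ### The free group, its lower central series and the graded quotients -/

/-- The free group `F_n` with basis `x_1, …, x_n`. -/
abbrev F (n : ℕ) : Type := FreeGroup (Fin n)

/-- The lower central series `Γ_n(1) = F_n`, `Γ_n(k + 1) = [Γ_n(k), F_n]`. -/
def gamma (n k : ℕ) : Subgroup (F n) := (⊤ : Subgroup (F n)).lowerCentralSeries (k - 1)

instance (n k : ℕ) : (gamma n k).Characteristic :=
  inferInstanceAs ((⊤ : Subgroup (F n)).lowerCentralSeries (k - 1)).Characteristic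

theorem gamma_succ_le (n k : ℕ) : gamma n (k + 1) ≤ gamma n k :=
  Subgroup.lowerCentralSeries_antitone _ (by omega)

theorem commutator_mem_gamma {n k : ℕ} {g : F n} (hg : g ∈ gamma n k) (h : F n) :
    ⁅g, h⁆ ∈ gamma n (k + 1) := by
  cases k with
  | zero => exact Subgroup.mem_top _
  | succ k => exact Subgroup.commutator_mem_commutator hg (Subgroup.mem_top h)

theorem map_mem_gamma {n k : ℕ} (φ : MulAut (F n)) {g : F n} (hg : g ∈ gamma n k) :
    φ g ∈ gamma n k :=
  (Subgroup.characteristic_iff_map_le.1 inferInstance φ) (Subgroup.mem_map_of_mem _ hg)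

/-- The underlying (multiplicative) quotient group `Γ_n(k) / Γ_n(k + 1)`. -/
abbrev LQuot (n k : ℕ) : Type := gamma n k ⧸ (gamma n (k + 1)).subgroupOf (gamma n k)

theorem LQuot.mul_comm' {n k : ℕ} (a b : LQuot n k) : a * b = b * a := by
  induction a using QuotientGroup.induction_on with | _ a => ?_
  induction b using QuotientGroup.induction_on with | _ b => ?_
  rw [← QuotientGroup.mk_mul, ← QuotientGroup.mk_mul, QuotientGroup.eq]
  have := commutator_mem_gamma (inv_mem b.2) ((a : F n)⁻¹)
  simpa [Subgroup.mem_subgroupOf, commutatorElement_def, mul_assoc] using this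

/-- `𝓛_n(k) = Γ_n(k) / Γ_n(k + 1)`, written additively. -/
def L (n k : ℕ) : Type := Additive (LQuot n k)

instance (n k : ℕ) : AddCommGroup (L n k) :=
  { (inferInstance : AddGroup (Additive (LQuot n k))) with
    add_comm := fun a b => LQuot.mul_comm' (Additive.toMul a) (Additive.toMul b) }

/-- The class in `𝓛_n(k)` of an element of `Γ_n(k)`. -/
def L.mk {n k : ℕ} (g : gamma n k) : L n k := Additive.ofMul (QuotientGroup.mk g)

theorem L.mk_mul {n k : ℕ} (g h : gamma n k) : L.mk (g * h) = L.mk g + L.mk h := rfl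

theorem L.mk_eq_iff {n k : ℕ} {g h : gamma n k} :
    L.mk g = L.mk h ↔ (g : F n)⁻¹ * h ∈ gamma n (k + 1) :=
  QuotientGroup.eq.trans Subgroup.mem_subgroupOf

theorem L.mk_one {n k : ℕ} : L.mk (1 : gamma n k) = 0 := rfl

theorem L.mk_eq_zero_iff {n k : ℕ} {g : gamma n k} :
    L.mk g = 0 ↔ (g : F n) ∈ gamma n (k + 1) := by
  rw [eq_comm, ← L.mk_one, L.mk_eq_iff]; simp

theorem L.ind {n k : ℕ} {p : L n k → Prop} (h : ∀ g, p (L.mk g)) (a : L n k) : p a :=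
  QuotientGroup.induction_on (C := fun a : LQuot n k => p (Additive.ofMul a)) a h

/-- A homomorphism out of `Γ_n(k)` into an additive group that kills `Γ_n(k + 1)` descends
to `𝓛_n(k)`. -/
def L.lift {n k : ℕ} {M : Type} [AddCommGroup M] (f : gamma n k →* Multiplicative M)
    (hf : ∀ g : gamma n k, (g : F n) ∈ gamma n (k + 1) → f g = 1) : L n k →ₗ[ℤ] M :=
  AddMonoidHom.toIntLinearMap
    (MonoidHom.toAdditiveLeft (QuotientGroup.lift ((gamma n (k + 1)).subgroupOf (gamma n k)) f
      (fun g hg => hf g (Subgroup.mem_subgroupOf.1 hg))))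

@[simp]
theorem L.lift_mk {n k : ℕ} {M : Type} [AddCommGroup M] (f : gamma n k →* Multiplicative M)
    (hf : ∀ g : gamma n k, (g : F n) ∈ gamma n (k + 1) → f g = 1) (g : gamma n k) :
    L.lift f hf (L.mk g) = Multiplicative.toAdd (f g) := rfl

/-- The projection `F_n = Γ_n(1) → 𝓛_n(1)`. -/
def L.mkHom (n : ℕ) : F n →* Multiplicative (L n 1) :=
  MonoidHom.mk' (fun y => Multiplicative.ofAdd (L.mk ⟨y, Subgroup.mem_top y⟩)) (fun _ _ => rfl)

/-- The left-normed commutator `[x_{j_0}, x_{j_1}, …, x_{j_k}]` of weight `k + 1`. -/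
def leftNormed (n : ℕ) : (k : ℕ) → (Fin (k + 1) → Fin n) → gamma n (k + 1)
  | 0, j => ⟨FreeGroup.of (j 0), Subgroup.mem_top _⟩
  | k + 1, j =>
    ⟨⁅(leftNormed n k (Fin.init j) : F n), FreeGroup.of (j (Fin.last (k + 1)))⁆,
      commutator_mem_gamma (leftNormed n k (Fin.init j)).2 _⟩

/-! ### The homology `H` and the Johnson homomorphisms -/

/-- `H = H_1(F_n, ℤ)`, the abelianization of `F_n`; Mathlib's `FreeAbelianGroup α` is by
definition the abelianization of `FreeGroup α`, written additively. -/
abbrev H (n : ℕ) : Type := FreeAbelianGroup (Fin n)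

/-- The class in `H` of an element of `F_n`. -/
def H.mk {n : ℕ} (x : F n) : H n := Additive.ofMul (Abelianization.of x)

/-- The basis `x_1, …, x_n` of `H`. -/
abbrev x {n : ℕ} (i : Fin n) : H n := FreeAbelianGroup.of i

/-- The dual basis `x_1^*, …, x_n^*` of `H^*`. -/
abbrev xdual {n : ℕ} (i : Fin n) : H n →ₗ[ℤ] ℤ := (FreeAbelianGroup.basis (Fin n)).coord i

theorem basis_eq_x {n : ℕ} (i : Fin n) : FreeAbelianGroup.basis (Fin n) i = x i := by
  simp [FreeAbelianGroup.basis]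

theorem xdual_x {n : ℕ} (i j : Fin n) : xdual i (x j) = if j = i then 1 else 0 := by
  rw [← basis_eq_x, Module.Basis.coord_apply, Module.Basis.repr_self, Finsupp.single_apply]

/-- The Andreadakis–Johnson filtration: `𝓐_n(k)` is the group of automorphisms of `F_n` that act
trivially on `F_n / Γ_n(k + 1)`. -/
def A (n k : ℕ) : Subgroup (MulAut (F n)) where
  carrier := {σ | ∀ y : F n, (QuotientGroup.mk (σ y) : F n ⧸ gamma n (k + 1)) = QuotientGroup.mk y}
  one_mem' := fun _ => rfl
  mul_mem' := fun {σ τ} hσ hτ y => (hσ (τ y)).trans (hτ y)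
  inv_mem' := fun {σ} hσ y => by simpa using (hσ (σ⁻¹ y)).symm

theorem mem_A_iff {n k : ℕ} {σ : MulAut (F n)} :
    σ ∈ A n k ↔ ∀ y : F n, y⁻¹ * σ y ∈ gamma n (k + 1) :=
  forall_congr' fun _ => eq_comm.trans QuotientGroup.eq

/-- The basis-conjugating automorphism group `PΣ_n`. -/
def PSigma (n : ℕ) : Subgroup (MulAut (F n)) where
  carrier := {σ | ∀ i : Fin n, IsConj (FreeGroup.of i) (σ (FreeGroup.of i))}
  one_mem' := fun _ => IsConj.refl _
  mul_mem' := fun {σ τ} hσ hτ i => (hσ i).trans (MonoidHom.map_isConj σ.toMonoidHom (hτ i))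
  inv_mem' := fun {σ} hσ i => by
    have := MonoidHom.map_isConj (σ⁻¹).toMonoidHom (hσ i)
    simpa using this.symm

/-- `𝓟_n(k) = PΣ_n ∩ 𝓐_n(k)`. -/
def P (n k : ℕ) : Subgroup (MulAut (F n)) := PSigma n ⊓ A n k

theorem A_antitone {n k l : ℕ} (h : k ≤ l) : A n l ≤ A n k := fun σ hσ =>
  mem_A_iff.2 fun y => Subgroup.lowerCentralSeries_antitone _ (by omega) (mem_A_iff.1 hσ y)

/-- For `σ ∈ 𝓐_n(k)`, the homomorphism `F_n → 𝓛_n(k + 1)`, `y ↦ y⁻¹ σ(y)`. -/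
def johnsonPre {n k : ℕ} (σ : A n k) : F n →* Multiplicative (L n (k + 1)) :=
  MonoidHom.mk' (fun y => Multiplicative.ofAdd
    (L.mk ⟨y⁻¹ * (σ : MulAut (F n)) y, mem_A_iff.1 σ.2 y⟩)) (by
    intro y z
    rw [← ofAdd_add, ← L.mk_mul]
    refine congrArg _ (L.mk_eq_iff.2 ?_)
    have hc := commutator_mem_gamma (inv_mem (mem_A_iff.1 σ.2 y)) z⁻¹
    have hn := (inferInstance : (gamma n (k + 1 + 1)).Normal).conj_mem _ (inv_mem hc)
      ((z⁻¹ * (σ : MulAut (F n)) z)⁻¹)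
    convert hn using 1
    simp only [commutatorElement_def, map_mul, Subgroup.coe_mul]
    group)

/-- For `σ ∈ 𝓐_n(k)`, the homomorphism `H → 𝓛_n(k + 1)`, `y ↦ y⁻¹ σ(y)`. -/
def johnsonVal {n k : ℕ} (σ : A n k) : H n →ₗ[ℤ] L n (k + 1) :=
  AddMonoidHom.toIntLinearMap (MonoidHom.toAdditiveLeft (Abelianization.lift (johnsonPre σ)))

theorem johnsonVal_mk {n k : ℕ} (σ : A n k) (y : F n) :
    johnsonVal σ (H.mk y) = L.mk ⟨y⁻¹ * (σ : MulAut (F n)) y, mem_A_iff.1 σ.2 y⟩ := rfl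

theorem PSigma_le_A_one (n : ℕ) : PSigma n ≤ A n 1 := by
  intro σ hσ
  have key : (L.mkHom n).comp σ.toMonoidHom = L.mkHom n := by
    ext i
    obtain ⟨c, hc⟩ := isConj_iff.1 (hσ i)
    simp only [MonoidHom.comp_apply]
    change L.mkHom n (σ (FreeGroup.of i)) = _
    rw [← hc, map_mul, map_mul, map_inv, mul_comm, inv_mul_cancel_left]
    rfl
  refine mem_A_iff.2 fun y => ?_
  have h := DFunLike.congr_fun key y
  exact L.mk_eq_iff.1 (congrArg Multiplicative.toAdd h.symm)

theorem H.mk_eq_zero {n k : ℕ} {y : F n} (hy : y ∈ gamma n (k + 2)) : H.mk y = 0 := by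
  have h : y ∈ commutator (F n) := by
    rw [← Subgroup.top_lowerCentralSeries_one]
    exact Subgroup.lowerCentralSeries_antitone _ (by omega) hy
  rw [← Abelianization.ker_of] at h
  exact congrArg Additive.ofMul (MonoidHom.mem_ker.1 h)

/-- An automorphism in `𝓟_n(k)` acts trivially on `𝓛_n(k + 1)`. -/
theorem inv_mul_mem_gamma {n k : ℕ} (σ : P n k) {c : F n} (hc : c ∈ gamma n (k + 1)) :
    c⁻¹ * (σ : MulAut (F n)) c ∈ gamma n (k + 2) := by
  cases k with
  | zero => exact mem_A_iff.1 (PSigma_le_A_one n σ.2.1) c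
  | succ k =>
    have h := johnsonVal_mk ⟨(σ : MulAut (F n)), σ.2.2⟩ c
    rw [H.mk_eq_zero hc, map_zero] at h
    exact L.mk_eq_zero_iff.1 h.symm

theorem H.hom_ext {n : ℕ} {M : Type} [AddCommGroup M] {f g : H n →ₗ[ℤ] M}
    (h : ∀ y : F n, f (H.mk y) = g (H.mk y)) : f = g := by
  refine LinearMap.ext fun a => ?_
  exact QuotientGroup.induction_on (C := fun a : Abelianization (F n) =>
    f (Additive.ofMul a) = g (Additive.ofMul a)) a h

/-- The homomorphism `𝓟_n(k) → Hom(H, 𝓛_n(k + 1))`, `σ ↦ (y ↦ y⁻¹ σ(y))`. -/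
def tauTilde (n k : ℕ) : P n k →* Multiplicative (H n →ₗ[ℤ] L n (k + 1)) :=
  MonoidHom.mk' (fun σ => Multiplicative.ofAdd (johnsonVal ⟨(σ : MulAut (F n)), σ.2.2⟩)) (by
    intro σ τ
    rw [← ofAdd_add]
    refine congrArg _ (H.hom_ext fun y => ?_)
    rw [LinearMap.add_apply, johnsonVal_mk, johnsonVal_mk, johnsonVal_mk, ← L.mk_mul]
    refine L.mk_eq_iff.2 ?_
    have h := inv_mul_mem_gamma σ (mem_A_iff.1 τ.2.2 y)
    convert inv_mem h using 1
    simp only [Subgroup.coe_mul, MulAut.mul_apply, map_mul, map_inv]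
    group)

theorem tauTilde_eq_one_iff {n k : ℕ} (σ : P n k) :
    tauTilde n k σ = 1 ↔ σ ∈ (P n (k + 1)).subgroupOf (P n k) := by
  rw [Subgroup.mem_subgroupOf]
  constructor
  · intro h
    refine ⟨σ.2.1, mem_A_iff.2 fun y => ?_⟩
    have h1 : johnsonVal ⟨(σ : MulAut (F n)), σ.2.2⟩ = 0 := h
    have h2 := johnsonVal_mk ⟨(σ : MulAut (F n)), σ.2.2⟩ y
    rw [h1] at h2
    exact L.mk_eq_zero_iff.1 h2.symm
  · intro h
    refine congrArg Multiplicative.ofAdd (H.hom_ext fun y => ?_)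
    exact L.mk_eq_zero_iff.2 (mem_A_iff.1 h.2 y)

theorem tauTilde_ker (n k : ℕ) : (tauTilde n k).ker = (P n (k + 1)).subgroupOf (P n k) :=
  Subgroup.ext fun σ => tauTilde_eq_one_iff σ

instance (n k : ℕ) : ((P n (k + 1)).subgroupOf (P n k)).Normal :=
  tauTilde_ker n k ▸ MonoidHom.normal_ker _

/-- The underlying (multiplicative) quotient group `𝓟_n(k) / 𝓟_n(k + 1)`. -/
abbrev GrQuot (n k : ℕ) : Type := P n k ⧸ (P n (k + 1)).subgroupOf (P n k)

theorem GrQuot.mul_comm' {n k : ℕ} (a b : GrQuot n k) : a * b = b * a := by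
  induction a using QuotientGroup.induction_on with | _ a => ?_
  induction b using QuotientGroup.induction_on with | _ b => ?_
  rw [← QuotientGroup.mk_mul, ← QuotientGroup.mk_mul, QuotientGroup.eq, ← tauTilde_eq_one_iff]
  simp only [map_mul, map_inv]
  rw [mul_comm (tauTilde n k b), inv_mul_cancel]

/-- `gr^k(𝓟_n) = 𝓟_n(k) / 𝓟_n(k + 1)`, written additively. -/
def gr (n k : ℕ) : Type := Additive (GrQuot n k)

instance (n k : ℕ) : AddCommGroup (gr n k) :=
  { (inferInstance : AddGroup (Additive (GrQuot n k))) with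
    add_comm := fun a b => GrQuot.mul_comm' (Additive.toMul a) (Additive.toMul b) }

/-- The class in `gr^k(𝓟_n)` of an element of `𝓟_n(k)`. -/
def gr.mk {n k : ℕ} (σ : P n k) : gr n k := Additive.ofMul (QuotientGroup.mk σ)

theorem gr.ind {n k : ℕ} {p : gr n k → Prop} (h : ∀ g, p (gr.mk g)) (a : gr n k) : p a :=
  QuotientGroup.induction_on (C := fun a : GrQuot n k => p (Additive.ofMul a)) a h

/-- A homomorphism out of `𝓟_n(k)` into an additive group that kills `𝓟_n(k + 1)` descends
to `gr^k(𝓟_n)`. -/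
def gr.lift {n k : ℕ} {M : Type} [AddCommGroup M] (f : P n k →* Multiplicative M)
    (hf : ∀ σ ∈ (P n (k + 1)).subgroupOf (P n k), f σ = 1) : gr n k →ₗ[ℤ] M :=
  AddMonoidHom.toIntLinearMap
    (MonoidHom.toAdditiveLeft (QuotientGroup.lift ((P n (k + 1)).subgroupOf (P n k)) f hf))

@[simp]
theorem gr.lift_mk {n k : ℕ} {M : Type} [AddCommGroup M] (f : P n k →* Multiplicative M)
    (hf : ∀ σ ∈ (P n (k + 1)).subgroupOf (P n k), f σ = 1) (σ : P n k) :
    gr.lift f hf (gr.mk σ) = Multiplicative.toAdd (f σ) := rfl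

/-- The `k`-th Johnson homomorphism `gr^k(𝓟_n) → Hom(H, 𝓛_n(k + 1)) = H^* ⊗ 𝓛_n(k + 1)`. -/
def tau (n k : ℕ) : gr n k →ₗ[ℤ] (H n →ₗ[ℤ] L n (k + 1)) :=
  gr.lift (tauTilde n k) fun σ hσ => (tauTilde_eq_one_iff σ).2 hσ

theorem tau_mk_apply {n k : ℕ} (σ : P n k) (y : F n) :
    tau n k (gr.mk σ) (H.mk y) = L.mk ⟨y⁻¹ * (σ : MulAut (F n)) y, mem_A_iff.1 σ.2.2 y⟩ := rfl

/-- The element `x_i^* ⊗ ℓ` of `Hom(H, 𝓛_n(k)) = H^* ⊗ 𝓛_n(k)`. -/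
def star {n k : ℕ} (i : Fin n) (l : L n k) : H n →ₗ[ℤ] L n k := (xdual i).smulRight l

/-- `𝔭_n(k)`: the submodule of `Hom(H, 𝓛_n(k + 1))` generated by all
`x_i^* ⊗ [x_{j_1}, …, x_{j_k}, x_i]`. -/
def p (n k : ℕ) : Submodule ℤ (H n →ₗ[ℤ] L n (k + 1)) :=
  Submodule.span ℤ (Set.range fun ij : Fin n × (Fin k → Fin n) =>
    star ij.1 (L.mk (leftNormed n k (Fin.snoc (α := fun _ => Fin n) ij.2 ij.1))))

/-! ### The natural embedding of the free Lie algebra in the tensor algebra -/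

theorem constantCoeff_magnusGen {n : ℕ} (i : Fin n) :
    PowerSeries.constantCoeff (1 + PowerSeries.monomial 1 (TensorAlgebra.ι ℤ (x i))) =
      ((1 : (TensorAlgebra ℤ (H n))ˣ) : TensorAlgebra ℤ (H n)) := by
  rw [← PowerSeries.coeff_zero_eq_constantCoeff_apply]
  simp [PowerSeries.coeff_monomial, -PowerSeries.coeff_zero_eq_constantCoeff]

/-- The Magnus expansion `F_n → (T(H)⟦t⟧)ˣ`, `x_i ↦ 1 + x_i t`. The coefficient of `t ^ k` is the
component of degree `k` of the usual Magnus expansion `x_i ↦ 1 + x_i` in the completed tensor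
algebra. -/
def magnus (n : ℕ) : F n →* (PowerSeries (TensorAlgebra ℤ (H n)))ˣ :=
  FreeGroup.lift fun i =>
    { val := 1 + PowerSeries.monomial 1 (TensorAlgebra.ι ℤ (x i))
      inv := PowerSeries.invOfUnit (1 + PowerSeries.monomial 1 (TensorAlgebra.ι ℤ (x i))) 1
      val_inv := PowerSeries.mul_invOfUnit _ _ (constantCoeff_magnusGen i)
      inv_val := PowerSeries.invOfUnit_mul _ _ (constantCoeff_magnusGen i) }

/-- The Magnus expansion minus one. -/
def magnusSub {n : ℕ} (g : F n) : PowerSeries (TensorAlgebra ℤ (H n)) := (magnus n g : _) - 1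

theorem magnusSub_mul {n : ℕ} (g h : F n) :
    magnusSub (g * h) = magnusSub g + magnusSub h + magnusSub g * magnusSub h := by
  simp only [magnusSub, map_mul, Units.val_mul]
  noncomm_ring

theorem magnusSub_inv {n : ℕ} (g : F n) :
    magnusSub g⁻¹ = - (magnusSub g * ((magnus n g)⁻¹ : (PowerSeries (TensorAlgebra ℤ (H n)))ˣ)) := by
  simp [magnusSub, sub_mul]

theorem magnusSub_commutator {n : ℕ} (g h : F n) :
    magnusSub ⁅g, h⁆ = (magnusSub g * magnusSub h - magnusSub h * magnusSub g) *
      ((magnus n (h * g))⁻¹ : (PowerSeries (TensorAlgebra ℤ (H n)))ˣ) := by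
  have h1 : magnusSub g * magnusSub h - magnusSub h * magnusSub g
      = (magnus n (g * h) : PowerSeries (TensorAlgebra ℤ (H n))) - magnus n (h * g) := by
    simp only [magnusSub, map_mul, Units.val_mul]
    noncomm_ring
  rw [h1, sub_mul, Units.mul_inv, ← Units.val_mul, ← map_inv, ← map_mul, magnusSub,
    commutatorElement_def]
  have h2 : g * h * (h * g)⁻¹ = g * h * g⁻¹ * h⁻¹ := by group
  rw [h2]

theorem one_le_order_magnusSub {n : ℕ} (g : F n) : 1 ≤ (magnusSub g).order := by
  have h : (Units.map (PowerSeries.constantCoeff (R := TensorAlgebra ℤ (H n))).toMonoidHom).comp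
      (magnus n) = 1 := by
    ext i
    simpa [magnus] using constantCoeff_magnusGen i
  have h1 : PowerSeries.constantCoeff (magnus n g : PowerSeries (TensorAlgebra ℤ (H n))) = 1 :=
    congrArg Units.val (DFunLike.congr_fun h g)
  rw [PowerSeries.one_le_order_iff_constCoeff_eq_zero, magnusSub, map_sub, h1, map_one, sub_self]

theorem le_order_mul_of_le {R : Type} [Semiring R] {f g : PowerSeries R} {a b : ℕ∞}
    (hf : a ≤ f.order) (hg : b ≤ g.order) : a + b ≤ (f * g).order :=
  (add_le_add hf hg).trans (PowerSeries.le_order_mul f g)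

theorem le_order_add_of_le {R : Type} [Semiring R] {f g : PowerSeries R} {a : ℕ∞}
    (hf : a ≤ f.order) (hg : a ≤ g.order) : a ≤ (f + g).order :=
  (le_min hf hg).trans (PowerSeries.min_order_le_order_add f g)

/-- The subgroup of all `g` whose Magnus expansion is `1` up to terms of degree at least `k`. -/
def magnusSubgroup (n : ℕ) (k : ℕ∞) : Subgroup (F n) where
  carrier := {g | k ≤ (magnusSub g).order}
  one_mem' := by simp [magnusSub]
  mul_mem' := fun {g h} hg hh => by
    rw [Set.mem_ofPred_eq, magnusSub_mul]
    refine le_order_add_of_le (le_order_add_of_le hg hh) ?_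
    simpa using le_order_mul_of_le hg (b := 0) zero_le
  inv_mem' := fun {g} hg => by
    rw [Set.mem_ofPred_eq, magnusSub_inv, PowerSeries.order_neg]
    simpa using le_order_mul_of_le hg (b := 0) zero_le

theorem le_order_magnusSub {n k : ℕ} {g : F n} (hg : g ∈ gamma n (k + 1)) :
    ((k + 1 : ℕ) : ℕ∞) ≤ (magnusSub g).order := by
  suffices h : gamma n (k + 1) ≤ magnusSubgroup n ((k + 1 : ℕ) : ℕ∞) from h hg
  clear hg g
  induction k with
  | zero =>
    intro g _
    change ((0 + 1 : ℕ) : ℕ∞) ≤ (magnusSub g).order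
    simpa using one_le_order_magnusSub g
  | succ k ih =>
    refine Subgroup.commutator_le.2 fun g hg h _ => ?_
    have hg' : ((k + 1 : ℕ) : ℕ∞) ≤ (magnusSub g).order := ih hg
    have hh := one_le_order_magnusSub h
    change _ ≤ (magnusSub ⁅g, h⁆).order
    rw [magnusSub_commutator, sub_eq_add_neg]
    have h1 := le_order_mul_of_le hg' hh
    have h2 : ((k + 1 : ℕ) : ℕ∞) + 1 ≤ (-(magnusSub h * magnusSub g)).order := by
      rw [PowerSeries.order_neg, add_comm]
      exact le_order_mul_of_le hh hg'
    simpa using le_order_mul_of_le (le_order_add_of_le h1 h2) (b := 0) zero_le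

/-- The component of degree `k` of an element of the tensor algebra. -/
def component (n k : ℕ) : TensorAlgebra ℤ (H n) →ₗ[ℤ] (⨂[ℤ]^k (H n)) :=
  (DirectSum.component ℤ ℕ (fun k => ⨂[ℤ]^k (H n)) k) ∘ₗ
    (TensorAlgebra.toDirectSum (R := ℤ) (M := H n)).toLinearMap

/-- The component of degree `k` of the Magnus expansion (minus one), on `Γ_n(k)`. -/
def iotaPre (n k : ℕ) : gamma n k →* Multiplicative (⨂[ℤ]^k (H n)) :=
  MonoidHom.mk' (fun g => Multiplicative.ofAdd
    (component n k (PowerSeries.coeff k (magnusSub (g : F n))))) (by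
    intro g h
    rw [← ofAdd_add, ← map_add, ← map_add, Subgroup.coe_mul, magnusSub_mul, map_add,
      PowerSeries.coeff_of_lt_order (φ := magnusSub (g : F n) * magnusSub (h : F n)), add_zero]
    have hg : (k : ℕ∞) ≤ (magnusSub (g : F n)).order := by
      cases k with
      | zero => simp
      | succ k => exact le_order_magnusSub g.2
    refine lt_of_lt_of_le ?_ (le_order_mul_of_le hg (one_le_order_magnusSub (h : F n)))
    exact_mod_cast Nat.lt_succ_self k)

/-- The natural embedding `ι_k : 𝓛_n(k) → H^{⊗ k}`: it sends the class of `g ∈ Γ_n(k)` to the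
component of degree `k` of its Magnus expansion, hence the class of a left-normed commutator
`[x_{j_1}, …, x_{j_k}]` to the iterated bracket `[x_{j_1}, …, x_{j_k}]` of the tensor algebra,
where `[a, b] = a ⊗ b - b ⊗ a`. -/
def iota (n k : ℕ) : L n k →ₗ[ℤ] (⨂[ℤ]^k (H n)) :=
  L.lift (iotaPre n k) fun g hg => by
    refine congrArg Multiplicative.ofAdd ?_
    rw [PowerSeries.coeff_of_lt_order, map_zero]
    exact lt_of_lt_of_le (by exact_mod_cast Nat.lt_succ_self k) (le_order_magnusSub hg)

/-! ### The trace maps -/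

/-- The contraction `H^{⊗ (k + 1)} → H^{⊗ k}`, `a_0 ⊗ a_1 ⊗ ⋯ ⊗ a_k ↦ f(a_0) a_1 ⊗ ⋯ ⊗ a_k`,
against an element `f` of `H^*`. -/
def contract {n : ℕ} (k : ℕ) (f : H n →ₗ[ℤ] ℤ) : (⨂[ℤ]^(k + 1) (H n)) →ₗ[ℤ] (⨂[ℤ]^k (H n)) :=
  PiTensorProduct.lift (LinearMap.uncurryLeft (M := fun _ => H n)
    (f.smulRight (PiTensorProduct.tprod ℤ (s := fun _ : Fin k => H n))))

theorem contract_tprod {n : ℕ} (k : ℕ) (f : H n →ₗ[ℤ] ℤ) (a : Fin (k + 1) → H n) :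
    contract k f (PiTensorProduct.tprod ℤ a) =
      f (a 0) • PiTensorProduct.tprod ℤ (fun i : Fin k => a i.succ) := by
  rw [contract, PiTensorProduct.lift.tprod]; rfl

/-- The contraction map `Φ^k : H^* ⊗ 𝓛_n(k + 1) → H^* ⊗ H^{⊗ (k + 1)} → H^{⊗ k}`, where
`φ ∈ Hom(H, 𝓛_n(k + 1))` is identified with `∑ i, x_i^* ⊗ φ(x_i)`. -/
def Phi (n k : ℕ) : (H n →ₗ[ℤ] L n (k + 1)) →ₗ[ℤ] (⨂[ℤ]^k (H n)) :=
  ∑ i : Fin n, contract k (xdual i) ∘ₗ iota n (k + 1) ∘ₗ LinearMap.applyₗ (x i)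

/-- The relations `a_1 ⊗ a_2 ⊗ ⋯ ⊗ a_k - a_2 ⊗ ⋯ ⊗ a_k ⊗ a_1` in `H^{⊗ k}`. -/
def cyclicRel (n k : ℕ) : Submodule ℤ (⨂[ℤ]^k (H n)) :=
  Submodule.span ℤ (Set.range fun a : Fin k → H n =>
    PiTensorProduct.tprod ℤ a - PiTensorProduct.tprod ℤ (fun i => a (finRotate k i)))

/-- `𝓒_n(k)`: the quotient of `H^{⊗ k}` by the action of the cyclic group of order `k`. -/
abbrev C (n k : ℕ) : Type := (⨂[ℤ]^k (H n)) ⧸ cyclicRel n k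

/-- The trace map `Tr_k : Hom(H, 𝓛_n(k + 1)) → 𝓒_n(k)`. -/
def Tr (n k : ℕ) : (H n →ₗ[ℤ] L n (k + 1)) →ₗ[ℤ] C n k := (cyclicRel n k).mkQ ∘ₗ Phi n k

/-- The element `x_i^k` of `𝓒_n(k)`. -/
def xpow (n k : ℕ) (i : Fin n) : C n k :=
  (cyclicRel n k).mkQ (PiTensorProduct.tprod ℤ fun _ => x i)

/-- The submodule `⟨x_1^k, …, x_n^k⟩` of `𝓒_n(k)`. -/
def powers (n k : ℕ) : Submodule ℤ (C n k) := Submodule.span ℤ (Set.range (xpow n k))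

/-- `𝓒̄_n(k) = 𝓒_n(k) / ⟨x_1^k, …, x_n^k⟩`. -/
abbrev CBar (n k : ℕ) : Type := C n k ⧸ powers n k

/-- The reduced trace map `𝔭_n(k) → 𝓒̄_n(k)`. -/
def TrBar (n k : ℕ) : p n k →ₗ[ℤ] CBar n k := (powers n k).mkQ ∘ₗ Tr n k ∘ₗ (p n k).subtype

/-! ### The actions of the symmetric group -/

/-- The automorphism `x_i ↦ x_{s(i)}` of `F_n` given by a permutation `s`. -/
def permAut (n : ℕ) : Equiv.Perm (Fin n) →* MulAut (F n) :=
  MonoidHom.mk' (fun s => FreeGroup.freeGroupCongr s) (fun s t =>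
    (FreeGroup.freeGroupCongr_trans t s).symm)

@[simp]
theorem permAut_of {n : ℕ} (s : Equiv.Perm (Fin n)) (i : Fin n) :
    permAut n s (FreeGroup.of i) = FreeGroup.of (s i) := by
  simp [permAut]

/-- The action of `S_n` on `H` by permutation matrices. -/
def rhoH (n : ℕ) : Representation ℤ (Equiv.Perm (Fin n)) (H n) where
  toFun s := (FreeAbelianGroup.map s).toIntLinearMap
  map_one' := (FreeAbelianGroup.basis (Fin n)).ext fun i => by
    simp [FreeAbelianGroup.map_id_apply]
  map_mul' s t := (FreeAbelianGroup.basis (Fin n)).ext fun i => by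
    simp [FreeAbelianGroup.map_comp_apply]

@[simp]
theorem rhoH_x {n : ℕ} (s : Equiv.Perm (Fin n)) (i : Fin n) : rhoH n s (x i) = x (s i) := by
  simp [rhoH]

/-- The action of an automorphism of `F_n` on `𝓛_n(k)`. -/
def L.map {n : ℕ} (k : ℕ) (φ : MulAut (F n)) : L n k →ₗ[ℤ] L n k :=
  L.lift (MonoidHom.mk' (fun g => Multiplicative.ofAdd (L.mk ⟨φ g, map_mem_gamma φ g.2⟩))
    (fun g h => by
      rw [← ofAdd_add, ← L.mk_mul]
      refine congrArg _ (congrArg _ (Subtype.ext ?_))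
      simp))
    (fun g hg => congrArg Multiplicative.ofAdd (L.mk_eq_zero_iff.2 (map_mem_gamma φ hg)))

theorem L.map_mk {n k : ℕ} (φ : MulAut (F n)) (g : gamma n k) :
    L.map k φ (L.mk g) = L.mk ⟨φ g, map_mem_gamma φ g.2⟩ := rfl

/-- The action of `S_n` on `𝓛_n(k)`. -/
def rhoL (n k : ℕ) : Representation ℤ (Equiv.Perm (Fin n)) (L n k) where
  toFun s := L.map k (permAut n s)
  map_one' := LinearMap.ext (L.ind fun g => by rw [L.map_mk]; simp)
  map_mul' s t := LinearMap.ext (L.ind fun g => by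
    rw [Module.End.mul_apply, L.map_mk, L.map_mk, L.map_mk]; simp)

/-- The action of `S_n` on `Hom(H, 𝓛_n(k))`, `(s • φ)(y) = s • φ(s⁻¹ • y)`. -/
def rhoHom (n k : ℕ) : Representation ℤ (Equiv.Perm (Fin n)) (H n →ₗ[ℤ] L n k) :=
  Representation.linHom (rhoH n) (rhoL n k)

theorem permAut_leftNormed {n : ℕ} (s : Equiv.Perm (Fin n)) (k : ℕ) (j : Fin (k + 1) → Fin n) :
    permAut n s (leftNormed n k j) = leftNormed n k (fun i => s (j i)) := by
  induction k with
  | zero => exact permAut_of s _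
  | succ k ih =>
    change permAut n s ⁅(leftNormed n k (Fin.init j) : F n), _⁆ = _
    rw [map_commutatorElement, ih, permAut_of]
    rfl

theorem rhoHom_star {n k : ℕ} (s : Equiv.Perm (Fin n)) (i : Fin n) (l : L n k) :
    rhoHom n k s (star i l) = star (s i) (rhoL n k s l) := by
  refine (FreeAbelianGroup.basis (Fin n)).ext fun j => ?_
  have h : xdual i (rhoH n s⁻¹ (x j)) = xdual (s i) (x j) := by
    rw [rhoH_x, xdual_x, xdual_x]
    exact if_congr Equiv.Perm.inv_eq_iff_eq rfl rfl
  rw [basis_eq_x]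
  change rhoL n k s (xdual i (rhoH n s⁻¹ (x j)) • l) = xdual (s i) (x j) • rhoL n k s l
  rw [h, map_zsmul]

theorem p_le_comap (n k : ℕ) (s : Equiv.Perm (Fin n)) :
    p n k ≤ (p n k).comap (rhoHom n (k + 1) s) := by
  refine Submodule.span_le.2 ?_
  rintro _ ⟨⟨i, j⟩, rfl⟩
  refine Submodule.subset_span ⟨(s i, fun a => s (j a)), ?_⟩
  rw [rhoHom_star]
  refine congrArg (star (s i)) ?_
  change _ = L.map (k + 1) (permAut n s) (L.mk _)
  rw [L.map_mk]
  refine congrArg L.mk (Subtype.ext (Eq.trans ?_ (permAut_leftNormed s k _).symm))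
  refine congrArg (fun j => (leftNormed n k j : F n)) (funext fun a => ?_)
  refine Fin.lastCases ?_ (fun a => ?_) a <;> simp

/-- The action of `S_n` on `𝔭_n(k)`. -/
def rhoP (n k : ℕ) : Representation ℤ (Equiv.Perm (Fin n)) (p n k) :=
  (rhoHom n (k + 1)).subrepresentation (p n k) (p_le_comap n k)

/-- The action of `S_n` on `H^{⊗ k}`. -/
def rhoT (n k : ℕ) : Representation ℤ (Equiv.Perm (Fin n)) (⨂[ℤ]^k (H n)) where
  toFun s := PiTensorProduct.map fun _ => rhoH n s
  map_one' := by rw [map_one]; exact PiTensorProduct.map_one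
  map_mul' s t := by rw [map_mul]; exact PiTensorProduct.map_mul _ _

theorem rhoT_tprod {n k : ℕ} (s : Equiv.Perm (Fin n)) (a : Fin k → H n) :
    rhoT n k s (PiTensorProduct.tprod ℤ a) = PiTensorProduct.tprod ℤ fun i => rhoH n s (a i) :=
  PiTensorProduct.map_tprod _ _

theorem cyclicRel_le_comap (n k : ℕ) (s : Equiv.Perm (Fin n)) :
    cyclicRel n k ≤ (cyclicRel n k).comap (rhoT n k s) := by
  refine Submodule.span_le.2 ?_
  rintro _ ⟨a, rfl⟩
  refine Submodule.subset_span ⟨fun i => rhoH n s (a i), ?_⟩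
  rw [map_sub, rhoT_tprod, rhoT_tprod]

/-- The action of `S_n` on `𝓒_n(k)`. -/
def rhoC (n k : ℕ) : Representation ℤ (Equiv.Perm (Fin n)) (C n k) :=
  (rhoT n k).quotient (cyclicRel n k) (cyclicRel_le_comap n k)

theorem powers_le_comap (n k : ℕ) (s : Equiv.Perm (Fin n)) :
    powers n k ≤ (powers n k).comap (rhoC n k s) := by
  refine Submodule.span_le.2 ?_
  rintro _ ⟨i, rfl⟩
  refine Submodule.subset_span ⟨s i, ?_⟩
  change _ = (cyclicRel n k).mkQ (rhoT n k s _)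
  rw [rhoT_tprod, rhoH_x]
  rfl

/-- The action of `S_n` on `𝓒̄_n(k)`. -/
def rhoCBar (n k : ℕ) : Representation ℤ (Equiv.Perm (Fin n)) (CBar n k) :=
  (rhoC n k).quotient (powers n k) (powers_le_comap n k)

theorem conj_mem_P {n k : ℕ} (s : Equiv.Perm (Fin n)) {σ : MulAut (F n)} (hσ : σ ∈ P n k) :
    permAut n s * σ * (permAut n s)⁻¹ ∈ P n k := by
  refine ⟨fun i => ?_, mem_A_iff.2 fun y => ?_⟩
  · have h := MonoidHom.map_isConj (permAut n s).toMonoidHom (hσ.1 (s⁻¹ i))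
    rw [← map_inv]
    change IsConj _ (permAut n s (σ (permAut n s⁻¹ (FreeGroup.of i))))
    rw [permAut_of]
    simpa using h
  · have h := map_mem_gamma (permAut n s) (mem_A_iff.1 hσ.2 ((permAut n s)⁻¹ y))
    simpa using h

/-- Conjugation by the permutation `s` on `gr^k(𝓟_n)`. -/
def gr.conj {n : ℕ} (k : ℕ) (s : Equiv.Perm (Fin n)) : gr n k →ₗ[ℤ] gr n k :=
  gr.lift (MonoidHom.mk' (fun σ => Multiplicative.ofAdd (gr.mk ⟨_, conj_mem_P s σ.2⟩))
    (fun σ τ => by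
      change _ = Multiplicative.ofAdd (gr.mk (_ * _))
      refine congrArg _ (congrArg _ (Subtype.ext ?_))
      simp))
    (fun σ hσ => congrArg Multiplicative.ofAdd
      ((QuotientGroup.eq_one_iff _).2 (Subgroup.mem_subgroupOf.2
        (conj_mem_P s (Subgroup.mem_subgroupOf.1 hσ)))))

theorem gr.conj_mk {n k : ℕ} (s : Equiv.Perm (Fin n)) (σ : P n k) :
    gr.conj k s (gr.mk σ) = gr.mk ⟨_, conj_mem_P s σ.2⟩ := rfl

/-- The action of `S_n` on `gr^k(𝓟_n)`, induced by conjugation in `Aut F_n`. -/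
def rhoGr (n k : ℕ) : Representation ℤ (Equiv.Perm (Fin n)) (gr n k) where
  toFun s := gr.conj k s
  map_one' := LinearMap.ext (gr.ind fun σ => by rw [gr.conj_mk]; simp)
  map_mul' s t := LinearMap.ext (gr.ind fun σ => by
    rw [Module.End.mul_apply, gr.conj_mk, gr.conj_mk, gr.conj_mk]; simp [mul_assoc])

/-- The permutation representation of `S_n` on the free abelian group with basis the set of all
two-element subsets of `{1, …, n}`. -/
abbrev rhoPairs (n : ℕ) : Representation ℤ (Equiv.Perm (Fin n))
    (MonoidAlgebra ℤ (Set.powersetCard (Fin n) 2)) :=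
  Representation.ofMulAction ℤ (Equiv.Perm (Fin n)) (Set.powersetCard (Fin n) 2)

end

end BasisConj

namespace BasisConj

noncomputable section

open scoped TensorProduct commutatorElement

/-! ### Commutator calculus in the graded quotients of the lower central series -/

/-! Write `D i w` for the derivation x_i ↦ [w, x_i] that kills the other generators. For k ≤ 4 an
element of 𝓟_n(k) sends x_i to w_i x_i w_i⁻¹ with w_i chosen in Γ_n(k) (`exists_conj_of_mem_P`). Its
Johnson image is then ∑ D_i(w_i), which lies in 𝔭_n(k). The choice of w_i rests on two facts: 𝓛_n(k)
embeds in H^{⊗k} for k ≤ 4 (`iota_injective`, by explicit retractions on basic commutators), and the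
centralizer of x_i in the tensor algebra consists of polynomials in x_i
(`eq_replicate_of_co_ne_zero`).

The trace vanishes on the image (`qC_Phi_tau`) because a Fox Jacobian is invertible. Represent F_n
by x_i ↦ 1 + a_i t with nilpotent integer matrices a_i. The Jacobian of σ is 1 + t^k B up to higher
order, and its determinant is a unit of ℤ[t], hence a constant, so tr B = 0 (`trace_coeff_eq_zero`).
Taking for a_i the letters of a directed cycle labelled by a nonconstant word w, tr B becomes the
sum of the coefficients of the rotations of w (`trace_ev_cycMat`). Constant words give matrices that
are not nilpotent, which is why the powers x_i^k are divided out.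

Conversely, a partial inverse S of the trace is built with values modulo Im τ. A cyclic word p·r in
which p occurs once goes to D_p[x_p, x_r]. Another once-occurring letter gives the same class, by
the commutator of two partial conjugations (`rotate_mem_range`). In degree 4 the words left over are
iijj and ijij, and they go to −D_i[x_i, x_j, x_i, x_j] and 0. Inner automorphisms and partial
conjugations reduce 𝔭_n(k) modulo Im τ to the elements D_i[x_i, x_r] with i ∉ r and D_i[x_i, x_j,
x_i, x_j] (`p_le_of_generators`). On these S ∘ trace is the projection, so trace zero forces
membership in Im τ (`mem_range_tau_iff`).

A nonconstant cyclic word of length 2 or 3 has a once-occurring letter, so the trace is onto for k =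
2, 3. For k = 4 the cokernel is generated by the classes ijij and iijj subject to iijj = 2·ijij, the
trace of D_i[x_i, x_j, x_i, x_j] being 2·ijij − iijj. It is therefore free on the pairs {i, j}
(`exact_TrBar_four`).

For the rank, 𝔭_n(4) is a sum of n copies of 𝓛_n(4). The ranks (n⁴ − n²)/4 of 𝓛_n(4) and (n⁴ + n² −
2n)/4 of 𝓒̄_n(4) are traces, divided by 4, of the Dynkin operator and of the operator summing
rotations, each of which acts on its own image as multiplication by 4. -/

theorem gamma_le {n i j : ℕ} (h : i ≤ j) : gamma n j ≤ gamma n i :=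
  Subgroup.lowerCentralSeries_antitone _ (by omega)

theorem mem_gamma_one {n : ℕ} (g : F n) : g ∈ gamma n 1 := Subgroup.mem_top _

theorem conj_mem_gamma {n k : ℕ} {g : F n} (hg : g ∈ gamma n k) (h : F n) :
    h * g * h⁻¹ ∈ gamma n k :=
  (inferInstance : (gamma n k).Normal).conj_mem _ hg h

/-- Induction on `j` by the three subgroups argument: Γ(j + 1) is generated by commutators ⁅p, q⁆
with p ∈ Γ(j), and the Hall–Witt identity trades ⁅⁅p, q⁆, a⁆ for two commutators in which p is
bracketed with something deeper or a is bracketed with p first. -/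
theorem commutator_mem {n i j m : ℕ} (hi : 1 ≤ i) (hj : 1 ≤ j) (hm : m = i + j) {a b : F n}
    (ha : a ∈ gamma n i) (hb : b ∈ gamma n j) : ⁅a, b⁆ ∈ gamma n m := by
  subst hm
  induction j, hj using Nat.le_induction generalizing i a b with
  | base => exact commutator_mem_gamma ha b
  | succ j hj ih =>
    have hb' : b ∈ Subgroup.lowerCentralSeries (⊤ : Subgroup (F n)) (j - 1 + 1) := by
      have : j - 1 + 1 = j + 1 - 1 := by omega
      rw [this]; exact hb
    rw [Subgroup.mem_lowerCentralSeries_succ_iff] at hb'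
    have hN : (gamma n (i + (j + 1))).Normal := inferInstance
    induction hb' using Subgroup.closure_induction with
    | mem y hy =>
      obtain ⟨p, hp, q, -, rfl⟩ := hy
      -- The third element is q⁻¹aq rather than a, so that the conjugate q(q⁻¹aq)q⁻¹ appearing in
      -- the Hall–Witt identity is a itself.
      have key := commutatorElement_commutatorElement_conj_mul p q (q⁻¹ * a * q)
      have h1 : ⁅⁅q, q⁻¹ * a * q⁆, q⁻¹ * a * q * p * (q⁻¹ * a * q)⁻¹⁆ ∈
          gamma n (i + (j + 1)) := by
        have e1 : q⁻¹ * a * q ∈ gamma n i := by simpa using conj_mem_gamma ha q⁻¹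
        have e2 : ⁅q, q⁻¹ * a * q⁆ ∈ gamma n (i + 1) := by
          rw [← commutatorElement_inv]
          exact inv_mem (commutator_mem_gamma e1 q)
        have := ih (i := i + 1) (by omega) e2 (conj_mem_gamma hp (q⁻¹ * a * q))
        rwa [show i + 1 + j = i + (j + 1) by ring] at this
      have h2 : ⁅⁅q⁻¹ * a * q, p⁆, p * q * p⁻¹⁆ ∈ gamma n (i + (j + 1)) := by
        have e1 : q⁻¹ * a * q ∈ gamma n i := by simpa using conj_mem_gamma ha q⁻¹
        exact commutator_mem_gamma (ih hi e1 hp) _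
      rw [mul_assoc, mul_eq_one_iff_eq_inv] at key
      have h3 : q * (q⁻¹ * a * q) * q⁻¹ = a := by group
      rw [h3] at key
      rw [← commutatorElement_inv, key, inv_inv]
      exact mul_mem h1 h2
    | one => simp
    | mul x y _ _ hx hy =>
      have hx' := hx
      rw [commutatorElement_mul_right_eq_mul_conj]
      have := mul_mem (hx ?_) (conj_mem_gamma (hy ?_) x)
      · convert this using 1; group
      all_goals
        change _ ∈ Subgroup.lowerCentralSeries (⊤ : Subgroup (F n)) (j + 1 - 1)
        have : j + 1 - 1 = j - 1 + 1 := by omega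
        rw [this, Subgroup.mem_lowerCentralSeries_succ_iff]
        assumption
    | inv x _ hx =>
      have := hx ?_
      · rw [commutatorElement_inv_right, ← commutatorElement_inv]
        simpa using conj_mem_gamma (inv_mem this) x⁻¹
      · change _ ∈ Subgroup.lowerCentralSeries (⊤ : Subgroup (F n)) (j + 1 - 1)
        have : j + 1 - 1 = j - 1 + 1 := by omega
        rw [this, Subgroup.mem_lowerCentralSeries_succ_iff]
        assumption

open Classical in
/-- The class in `𝓛_n(k)` of an element of `F_n`, with value `0` outside `Γ_n(k)`. -/
def cls {n : ℕ} (k : ℕ) (g : F n) : L n k := if h : g ∈ gamma n k then L.mk ⟨g, h⟩ else 0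

theorem cls_of_mem {n k : ℕ} {g : F n} (h : g ∈ gamma n k) : cls k g = L.mk ⟨g, h⟩ := dif_pos h

theorem mk_eq_cls {n k : ℕ} (g : gamma n k) : L.mk g = cls k (g : F n) := (cls_of_mem g.2).symm

theorem cls_mul {n k : ℕ} {g h : F n} (hg : g ∈ gamma n k) (hh : h ∈ gamma n k) :
    cls k (g * h) = cls k g + cls k h := by
  rw [cls_of_mem hg, cls_of_mem hh, cls_of_mem (mul_mem hg hh), ← L.mk_mul]; rfl

@[simp]
theorem cls_one {n k : ℕ} : cls k (1 : F n) = 0 := by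
  rw [cls_of_mem (one_mem _)]; exact L.mk_one

theorem cls_inv {n k : ℕ} {g : F n} (hg : g ∈ gamma n k) : cls k g⁻¹ = - cls k g := by
  rw [eq_neg_iff_add_eq_zero, ← cls_mul (inv_mem hg) hg, inv_mul_cancel, cls_one]

theorem cls_eq_zero_iff {n k : ℕ} {g : F n} (hg : g ∈ gamma n k) :
    cls k g = 0 ↔ g ∈ gamma n (k + 1) := by
  rw [cls_of_mem hg, L.mk_eq_zero_iff]

theorem cls_eq_zero {n k : ℕ} {g : F n} (hg : g ∈ gamma n (k + 1)) : cls k g = 0 :=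
  (cls_eq_zero_iff (gamma_succ_le n k hg)).2 hg

theorem cls_eq_iff {n k : ℕ} {g h : F n} (hg : g ∈ gamma n k) (hh : h ∈ gamma n k) :
    cls k g = cls k h ↔ g⁻¹ * h ∈ gamma n (k + 1) := by
  rw [cls_of_mem hg, cls_of_mem hh, L.mk_eq_iff]

theorem cls_conj {n k : ℕ} {g : F n} (hg : g ∈ gamma n k) (h : F n) :
    cls k (h * g * h⁻¹) = cls k g := by
  rw [eq_comm, cls_eq_iff hg (conj_mem_gamma hg h)]
  have := commutator_mem_gamma (inv_mem hg) h
  rwa [commutatorElement_def, inv_inv, mul_assoc, mul_assoc, ← mul_assoc h] at this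

theorem L.ind_cls {n k : ℕ} {p : L n k → Prop} (h : ∀ g ∈ gamma n k, p (cls k g)) (a : L n k) :
    p a :=
  L.ind (fun g => by rw [mk_eq_cls]; exact h _ g.2) a

section commutator

variable {n i j m : ℕ} (hi : 1 ≤ i) (hj : 1 ≤ j) (hm : m = i + j)

include hi hj hm

theorem cls_commutator_mul_left {a a' b : F n} (ha : a ∈ gamma n i) (ha' : a' ∈ gamma n i)
    (hb : b ∈ gamma n j) : cls m ⁅a * a', b⁆ = cls m ⁅a, b⁆ + cls m ⁅a', b⁆ := by
  have h1 := commutator_mem hi hj hm ha hb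
  have h2 := commutator_mem hi hj hm ha' hb
  rw [commutatorElement_mul_left_eq_conj_mul, cls_mul (conj_mem_gamma h2 _) h1, cls_conj h2,
    add_comm]

theorem cls_commutator_mul_right {a b b' : F n} (ha : a ∈ gamma n i) (hb : b ∈ gamma n j)
    (hb' : b' ∈ gamma n j) : cls m ⁅a, b * b'⁆ = cls m ⁅a, b⁆ + cls m ⁅a, b'⁆ := by
  have h1 := commutator_mem hi hj hm ha hb
  have h2 := commutator_mem hi hj hm ha hb'
  have h : ⁅a, b * b'⁆ = ⁅a, b⁆ * (b * ⁅a, b'⁆ * b⁻¹) := by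
    rw [commutatorElement_mul_right_eq_mul_conj]; group
  rw [h, cls_mul h1 (conj_mem_gamma h2 _), cls_conj h2]

theorem cls_commutator_congr {a a' b b' : F n} (ha : a ∈ gamma n i) (ha' : a' ∈ gamma n i)
    (hb : b ∈ gamma n j) (hb' : b' ∈ gamma n j) (h1 : cls i a = cls i a')
    (h2 : cls j b = cls j b') : cls m ⁅a, b⁆ = cls m ⁅a', b'⁆ := by
  have e1 := (cls_eq_iff ha ha').1 h1
  have e2 := (cls_eq_iff hb hb').1 h2
  have l1 : cls m ⁅a', b⁆ = cls m ⁅a, b⁆ := by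
    have h3 := cls_commutator_mul_left hi hj hm ha (gamma_succ_le n i e1) hb
    rw [mul_inv_cancel_left, cls_eq_zero (g := ⁅a⁻¹ * a', b⁆), add_zero] at h3
    · exact h3
    · exact commutator_mem (by omega) hj (by omega) e1 hb
  have l2 : cls m ⁅a', b'⁆ = cls m ⁅a', b⁆ := by
    have h3 := cls_commutator_mul_right hi hj hm ha' hb (gamma_succ_le n j e2)
    rw [mul_inv_cancel_left, cls_eq_zero (g := ⁅a', b⁻¹ * b'⁆), add_zero] at h3
    · exact h3
    · exact commutator_mem hi (by omega) (by omega) ha' e2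
  rw [l2, l1]

theorem cls_commutator_swap {a b : F n} (ha : a ∈ gamma n i) (hb : b ∈ gamma n j) :
    cls m ⁅b, a⁆ = - cls m ⁅a, b⁆ := by
  rw [← commutatorElement_inv, cls_inv (commutator_mem hi hj hm ha hb)]

theorem cls_commutator_inv_left {a b : F n} (ha : a ∈ gamma n i) (hb : b ∈ gamma n j) :
    cls m ⁅a⁻¹, b⁆ = - cls m ⁅a, b⁆ := by
  rw [eq_neg_iff_add_eq_zero, ← cls_commutator_mul_left hi hj hm (inv_mem ha) ha hb]
  simp

/-- The Hall–Witt identity; the conjugations in it do not change classes in the graded quotients. -/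
theorem cls_jacobi {k l : ℕ} (hk : 1 ≤ k) (hl : l = m + k) {a b c : F n} (ha : a ∈ gamma n i)
    (hb : b ∈ gamma n j) (hc : c ∈ gamma n k) :
    cls l ⁅⁅a, b⁆, c⁆ + cls l ⁅⁅b, c⁆, a⁆ + cls l ⁅⁅c, a⁆, b⁆ = 0 := by
  have hab := commutator_mem hi hj hm ha hb
  have hbc := commutator_mem hj hk rfl hb hc
  have hca := commutator_mem hk hi rfl hc ha
  have key := congrArg (cls l) (commutatorElement_commutatorElement_conj_mul a b c)
  have m1 := commutator_mem (by omega) hk hl hab (conj_mem_gamma hc b)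
  have m2 := commutator_mem (m := l) (by omega) hi (by omega) hbc (conj_mem_gamma ha c)
  have m3 := commutator_mem (m := l) (by omega) hj (by omega) hca (conj_mem_gamma hb a)
  rw [cls_mul (mul_mem m1 m2) m3, cls_mul m1 m2, cls_one,
    cls_commutator_congr (by omega) hk hl hab hab (conj_mem_gamma hc b) hc rfl (cls_conj hc b),
    cls_commutator_congr (by omega) hi (by omega) hbc hbc (conj_mem_gamma ha c) ha rfl
      (cls_conj ha c),
    cls_commutator_congr (by omega) hj (by omega) hca hca (conj_mem_gamma hb a) hb rfl
      (cls_conj hb a)] at key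
  exact key

/-- `[c, [a, b]] = [[c, a], b] - [[c, b], a]`. -/
theorem cls_jacobi' {k l : ℕ} (hk : 1 ≤ k) (hl : l = m + k) {a b c : F n} (ha : a ∈ gamma n i)
    (hb : b ∈ gamma n j) (hc : c ∈ gamma n k) :
    cls l ⁅c, ⁅a, b⁆⁆ = cls l ⁅⁅c, a⁆, b⁆ - cls l ⁅⁅c, b⁆, a⁆ := by
  have h := cls_jacobi hi hj hm hk hl ha hb hc
  have hab := commutator_mem hi hj hm ha hb
  rw [cls_commutator_swap (by omega) hk hl hab hc]
  have hbc := commutator_mem hk hj rfl hc hb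
  have h2 : cls l ⁅⁅b, c⁆, a⁆ = - cls l ⁅⁅c, b⁆, a⁆ := by
    rw [← commutatorElement_inv c b]
    exact cls_commutator_inv_left (by omega) hi (by omega) hbc ha
  rw [h2] at h
  rw [neg_eq_iff_add_eq_zero, ← h]
  abel

end commutator

/-- Bracketing on the right with an element of `F_n`. -/
def L.ad {n : ℕ} (k : ℕ) (b : F n) : L n k →ₗ[ℤ] L n (k + 1) :=
  L.lift (MonoidHom.mk' (fun g => Multiplicative.ofAdd (cls (k + 1) ⁅(g : F n), b⁆)) (by
    intro g h
    rw [← ofAdd_add]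
    refine congrArg _ ?_
    -- Since Γ(0) = Γ(1) = F_n by truncated subtraction, weight 0 breaks the additivity of weights;
    -- there every commutator lies in Γ(2) and is zero in 𝓛(1).
    rcases Nat.eq_zero_or_pos k with rfl | hk
    · have (g : F n) : cls (0 + 1) ⁅g, b⁆ = 0 :=
        cls_eq_zero (commutator_mem_gamma (mem_gamma_one g) b)
      simp only [this, add_zero]
    · exact cls_commutator_mul_left hk le_rfl rfl g.2 h.2 (mem_gamma_one b)))
    (fun _ hg => congrArg Multiplicative.ofAdd (cls_eq_zero (commutator_mem_gamma hg b)))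

theorem L.ad_cls {n k : ℕ} (b : F n) {g : F n} (hg : g ∈ gamma n k) :
    L.ad k b (cls k g) = cls (k + 1) ⁅g, b⁆ := by
  rw [cls_of_mem hg]; rfl

/-! ### Left-normed commutators -/

/-- The left-normed commutator `[g, x_{l_0}, x_{l_1}, …]`. -/
def lnc {n : ℕ} (g : F n) (l : List (Fin n)) : F n :=
  l.foldl (fun h b => ⁅h, FreeGroup.of b⁆) g

@[simp] theorem lnc_nil {n : ℕ} (g : F n) : lnc g [] = g := rfl

@[simp] theorem lnc_cons {n : ℕ} (g : F n) (b : Fin n) (l : List (Fin n)) :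
    lnc g (b :: l) = lnc ⁅g, FreeGroup.of b⁆ l := rfl

theorem lnc_append {n : ℕ} (g : F n) (l l' : List (Fin n)) :
    lnc g (l ++ l') = lnc (lnc g l) l' := List.foldl_append

theorem lnc_concat {n : ℕ} (g : F n) (l : List (Fin n)) (b : Fin n) :
    lnc g (l ++ [b]) = ⁅lnc g l, FreeGroup.of b⁆ := lnc_append g l [b]

theorem lnc_mem {n k m : ℕ} {g : F n} (hg : g ∈ gamma n k) {l : List (Fin n)}
    (hm : m = k + l.length) : lnc g l ∈ gamma n m := by
  subst hm
  induction l generalizing g k with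
  | nil => exact hg
  | cons b l ih =>
    have := ih (commutator_mem_gamma hg (FreeGroup.of b))
    rwa [show k + 1 + l.length = k + (b :: l).length by simp; ring] at this

theorem map_lnc {n : ℕ} (φ : F n →* F n) (g : F n) (l : List (Fin n))
    (h : ∀ b ∈ l, φ (FreeGroup.of b) = FreeGroup.of b) : φ (lnc g l) = lnc (φ g) l := by
  induction l generalizing g with
  | nil => rfl
  | cons b l ih =>
    rw [lnc_cons, ih _ (fun c hc => h c (List.mem_cons_of_mem _ hc)), map_commutatorElement,
      h b List.mem_cons_self, lnc_cons]

/-- The class of `[g, x_{l_0}, x_{l_1}, …]` depends only, and linearly, on the class of `g`. -/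
theorem exists_lnc_linear {n : ℕ} (k m : ℕ) (l : List (Fin n)) (hm : m = k + l.length) :
    ∃ f : L n k →ₗ[ℤ] L n m, ∀ g ∈ gamma n k, f (cls k g) = cls m (lnc g l) := by
  induction l generalizing k with
  | nil => obtain rfl : m = k := by simpa using hm
           exact ⟨LinearMap.id, fun _ _ => rfl⟩
  | cons b l ih =>
    obtain ⟨f, hf⟩ := ih (k + 1) (by rw [hm, List.length_cons]; ring)
    refine ⟨f ∘ₗ L.ad k (FreeGroup.of b), fun g hg => ?_⟩
    rw [LinearMap.comp_apply, L.ad_cls _ hg, hf _ (commutator_mem_gamma hg _), lnc_cons]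

/-- The linear map `[g] ↦ [g, x_{l_0}, x_{l_1}, …]`. -/
def L.lncMap {n : ℕ} (k m : ℕ) (l : List (Fin n)) (hm : m = k + l.length) : L n k →ₗ[ℤ] L n m :=
  (exists_lnc_linear k m l hm).choose

theorem L.lncMap_cls {n k m : ℕ} (l : List (Fin n)) (hm : m = k + l.length) {g : F n}
    (hg : g ∈ gamma n k) : L.lncMap k m l hm (cls k g) = cls m (lnc g l) :=
  (exists_lnc_linear k m l hm).choose_spec g hg

theorem leftNormed_eq_lnc {n : ℕ} (k : ℕ) (j : Fin (k + 1) → Fin n) :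
    (leftNormed n k j : F n) = lnc (FreeGroup.of (j 0)) (List.ofFn fun a : Fin k => j a.succ) := by
  induction k with
  | zero => rfl
  | succ k ih =>
    change ⁅(leftNormed n k (Fin.init j) : F n), FreeGroup.of (j (Fin.last (k + 1)))⁆ = _
    rw [ih, List.ofFn_succ', List.concat_eq_append, lnc_concat]
    rfl

/-- Γ(k + 2) is generated by the commutators ⁅p, q⁆ with p ∈ Γ(k + 1). The bracket is biadditive on
classes, so q may be taken to be a generator and p, by induction, a left-normed commutator. -/
theorem span_lnc {n : ℕ} (k : ℕ) : Submodule.span ℤ (Set.range fun al : {al : Fin n × List (Fin n) //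
    al.2.length = k} => cls (k + 1) (lnc (FreeGroup.of al.1.1) al.1.2)) = (⊤ : Submodule ℤ (L n (k + 1))) := by
  have base {m : ℕ} (f : F n →* Multiplicative (L n m)) (g : F n) :
      Multiplicative.toAdd (f g) ∈ Submodule.span ℤ (Set.range fun a : Fin n =>
        Multiplicative.toAdd (f (FreeGroup.of a))) := by
    induction g using FreeGroup.induction_on with
    | C1 => simp
    | of x => exact Submodule.subset_span ⟨x, rfl⟩
    | inv_of x hx => rw [map_inv]; exact neg_mem hx
    | mul x y hx hy => rw [map_mul]; exact add_mem hx hy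
  induction k with
  | zero =>
    refine Submodule.eq_top_iff'.2 fun z => ?_
    induction z using L.ind_cls with | _ g hg
    have h := base (L.mkHom n) g
    rw [cls_of_mem hg]
    refine Submodule.span_mono ?_ h
    rintro _ ⟨a, rfl⟩
    refine ⟨⟨(a, []), rfl⟩, ?_⟩
    exact cls_of_mem (mem_gamma_one _)
  | succ k ih =>
    refine Submodule.eq_top_iff'.2 fun z => ?_
    induction z using L.ind_cls with | _ g hg
    set S := Submodule.span ℤ (Set.range fun al : {al : Fin n × List (Fin n) //
      al.2.length = k + 1} => cls (k + 1 + 1) (lnc (FreeGroup.of al.1.1) al.1.2))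
    have step (b : Fin n) (w : L n (k + 1)) : L.ad (k + 1) (FreeGroup.of b) w ∈ S := by
      have hw : w ∈ (⊤ : Submodule ℤ (L n (k + 1))) := trivial
      rw [← ih] at hw
      induction hw using Submodule.span_induction with
      | mem w hw =>
        obtain ⟨⟨⟨a, l⟩, hl⟩, rfl⟩ := hw
        rw [L.ad_cls _ (lnc_mem (mem_gamma_one _) (by simp only at hl ⊢; omega)), ← lnc_concat]
        exact Submodule.subset_span ⟨⟨(a, l ++ [b]), by simpa using hl⟩, rfl⟩
      | zero => simp
      | add x y _ _ hx hy => rw [map_add]; exact add_mem hx hy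
      | smul c x _ hx => rw [map_smul]; exact Submodule.smul_mem _ c hx
    have step' (a : F n) (ha : a ∈ gamma n (k + 1)) (b : F n) : cls (k + 1 + 1) ⁅a, b⁆ ∈ S := by
      have h := base (MonoidHom.mk' (fun b : F n => Multiplicative.ofAdd (cls (k + 1 + 1) ⁅a, b⁆))
        (fun b b' => congrArg _ (cls_commutator_mul_right (by omega) le_rfl rfl ha
          (mem_gamma_one _) (mem_gamma_one _)))) b
      refine Submodule.span_le.2 ?_ h
      rintro _ ⟨c, rfl⟩
      have := step c (cls (k + 1) a)
      rwa [L.ad_cls _ ha] at this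
    have hg' : g ∈ Subgroup.closure {x | ∃ p ∈ gamma n (k + 1), ∃ q ∈ (⊤ : Subgroup (F n)),
      ⁅p, q⁆ = x} := hg
    -- The induction on the closure carries membership in Γ along, because `cls` is known to be
    -- additive only there.
    suffices h : g ∈ gamma n (k + 1 + 1) ∧ cls (k + 1 + 1) g ∈ S from h.2
    clear hg
    induction hg' using Subgroup.closure_induction with
    | mem y hy =>
      obtain ⟨p, hp, q, -, rfl⟩ := hy
      exact ⟨commutator_mem_gamma hp q, step' p hp q⟩
    | one => exact ⟨one_mem _, by simp⟩
    | mul x y _ _ hx hy => exact ⟨mul_mem hx.1 hy.1, by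
        rw [cls_mul hx.1 hy.1]; exact add_mem hx.2 hy.2⟩
    | inv x _ hx => exact ⟨inv_mem hx.1, by rw [cls_inv hx.1]; exact neg_mem hx.2⟩

/-- A submodule of `𝓛_n(k + 1)` containing all left-normed commutators is everything. -/
theorem L.induction_lnc {n k : ℕ} (S : Submodule ℤ (L n (k + 1)))
    (h : ∀ (a : Fin n) (l : List (Fin n)), l.length = k → cls (k + 1) (lnc (FreeGroup.of a) l) ∈ S)
    (z : L n (k + 1)) : z ∈ S := by
  have hz : z ∈ (⊤ : Submodule ℤ (L n (k + 1))) := trivial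
  rw [← span_lnc] at hz
  refine Submodule.span_le.2 ?_ hz
  rintro _ ⟨⟨⟨a, l⟩, hl⟩, rfl⟩
  exact h a l hl

/-! ### Words in the tensor algebra -/

/-- The generator `x_i` of the tensor algebra. -/
abbrev X {n : ℕ} (i : Fin n) : TensorAlgebra ℤ (H n) := TensorAlgebra.ι ℤ (x i)

/-- The monomial of the tensor algebra given by a word. -/
def Wd {n : ℕ} (l : List (Fin n)) : TensorAlgebra ℤ (H n) := (l.map X).prod

@[simp] theorem Wd_nil {n : ℕ} : Wd ([] : List (Fin n)) = 1 := rfl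

theorem Wd_cons {n : ℕ} (i : Fin n) (l : List (Fin n)) : Wd (i :: l) = X i * Wd l := by
  simp [Wd]

theorem Wd_append {n : ℕ} (l l' : List (Fin n)) : Wd (l ++ l') = Wd l * Wd l' := by
  simp [Wd]

theorem Wd_concat {n : ℕ} (l : List (Fin n)) (i : Fin n) : Wd (l ++ [i]) = Wd l * X i := by
  simp [Wd]

theorem span_Wd (n : ℕ) : Submodule.span ℤ (Set.range (Wd (n := n))) = ⊤ := by
  refine Submodule.eq_top_iff'.2 fun z => ?_
  have hι (m : H n) : TensorAlgebra.ι ℤ m ∈ Submodule.span ℤ (Set.range (X (n := n))) := by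
    have hm : m ∈ Submodule.span ℤ (Set.range (FreeAbelianGroup.basis (Fin n))) := by
      rw [Module.Basis.span_eq]; trivial
    induction hm using Submodule.span_induction with
    | mem w hw => obtain ⟨i, rfl⟩ := hw; rw [basis_eq_x]; exact Submodule.subset_span ⟨i, rfl⟩
    | zero => simp
    | add x y _ _ hx hy => rw [map_add]; exact add_mem hx hy
    | smul c x _ hx => rw [map_smul]; exact Submodule.smul_mem _ c hx
  induction z using TensorAlgebra.induction with
  | algebraMap r =>
    rw [Algebra.algebraMap_eq_smul_one]
    exact Submodule.smul_mem _ _ (Submodule.subset_span ⟨[], rfl⟩)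
  | ι m =>
    refine Submodule.span_mono ?_ (hι m)
    rintro _ ⟨i, rfl⟩
    exact ⟨[i], by simp [Wd]⟩
  | mul a b ha hb =>
    have h := Submodule.mul_mem_mul ha hb
    rw [Submodule.span_mul_span] at h
    refine Submodule.span_mono ?_ h
    rintro _ ⟨_, ⟨l, rfl⟩, _, ⟨l', rfl⟩, rfl⟩
    exact ⟨l ++ l', Wd_append l l'⟩
  | add a b ha hb => exact add_mem ha hb

theorem hom_ext_Wd {n : ℕ} {M : Type*} [AddCommGroup M] {f g : TensorAlgebra ℤ (H n) →ₗ[ℤ] M}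
    (h : ∀ l, f (Wd l) = g (Wd l)) : f = g :=
  LinearMap.ext_on_range (span_Wd n) h

/-- The basis vector of `H^{⊗ k}` given by a word. -/
def tw {n k : ℕ} (a : Fin k → Fin n) : ⨂[ℤ]^k (H n) := PiTensorProduct.tprod ℤ fun i => x (a i)

/-- The basis of `H^{⊗ k}` consisting of the words. -/
def wordBasis (n k : ℕ) : Module.Basis (Fin k → Fin n) ℤ (⨂[ℤ]^k (H n)) :=
  Basis.piTensorProduct fun _ => FreeAbelianGroup.basis (Fin n)

theorem wordBasis_apply {n k : ℕ} (a : Fin k → Fin n) : wordBasis n k a = tw a := by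
  rw [wordBasis, Basis.piTensorProduct_apply]
  simp only [basis_eq_x]
  rfl

theorem Wd_eq_tprod {n k : ℕ} (a : Fin k → Fin n) :
    Wd (List.ofFn a) = TensorAlgebra.tprod ℤ (H n) k fun i => x (a i) := by
  rw [TensorAlgebra.tprod_apply, Wd, List.map_ofFn]; rfl

theorem component_Wd_ofFn {n k : ℕ} (a : Fin k → Fin n) :
    component n k (Wd (List.ofFn a)) = tw a := by
  rw [Wd_eq_tprod, component, LinearMap.comp_apply, AlgHom.toLinearMap_apply,
    TensorAlgebra.toDirectSum_tensorPower_tprod]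
  exact DirectSum.component.lof_self _ _ _

theorem component_Wd_of_ne {n k : ℕ} {l : List (Fin n)} (h : l.length ≠ k) :
    component n k (Wd l) = 0 := by
  obtain ⟨a, ha⟩ : ∃ a : Fin l.length → Fin n, List.ofFn a = l := ⟨l.get, List.ofFn_get l⟩
  rw [← ha, Wd_eq_tprod, component, LinearMap.comp_apply, AlgHom.toLinearMap_apply,
    TensorAlgebra.toDirectSum_tensorPower_tprod]
  exact DirectSum.of_eq_of_ne _ _ _ (Ne.symm h)

/-- The coefficient of a word in an element of the tensor algebra. -/
def co {n : ℕ} (l : List (Fin n)) : TensorAlgebra ℤ (H n) →ₗ[ℤ] ℤ :=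
  (wordBasis n l.length).coord l.get ∘ₗ component n l.length

theorem co_ofFn {n k : ℕ} (a : Fin k → Fin n) (z : TensorAlgebra ℤ (H n)) :
    co (List.ofFn a) z = (wordBasis n k).coord a (component n k z) := by
  have h : ∀ (l : List (Fin n)) (hl : l.length = k), l.get = a ∘ Fin.cast hl →
      co l z = (wordBasis n k).coord a (component n k z) := by
    rintro l rfl h
    rw [co, LinearMap.comp_apply, h]; rfl
  exact h _ (List.length_ofFn) (by ext i; simp [Fin.cast])

theorem co_Wd {n : ℕ} (l l' : List (Fin n)) : co l (Wd l') = if l' = l then 1 else 0 := by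
  by_cases h : l'.length = l.length
  · obtain ⟨a, ha⟩ : ∃ a : Fin l.length → Fin n, List.ofFn a = l := ⟨l.get, List.ofFn_get l⟩
    obtain ⟨b, hb⟩ : ∃ b : Fin l.length → Fin n, List.ofFn b = l' := by
      rw [← h]; exact ⟨l'.get, List.ofFn_get l'⟩
    rw [← ha, ← hb, co_ofFn, component_Wd_ofFn, ← wordBasis_apply, Module.Basis.coord_apply,
      Module.Basis.repr_self, Finsupp.single_apply]
    simp [List.ofFn_inj]
  · rw [co, LinearMap.comp_apply, component_Wd_of_ne h, map_zero, if_neg]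
    rintro rfl; exact h rfl

theorem component_eq_zero_iff {n k : ℕ} (z : TensorAlgebra ℤ (H n)) :
    component n k z = 0 ↔ ∀ l : List (Fin n), l.length = k → co l z = 0 := by
  constructor
  · rintro h l rfl
    rw [co, LinearMap.comp_apply, h, map_zero]
  · intro h
    refine (wordBasis n k).ext_elem fun a => ?_
    rw [← Module.Basis.coord_apply, ← co_ofFn, h _ List.length_ofFn, map_zero]; rfl

/-- The left derivative: `∂_i (x_j z) = δ_{ij} z`. -/
def dLmat {n : ℕ} (i : Fin n) :
    TensorAlgebra ℤ (H n) →ₐ[ℤ] Matrix (Fin 2) (Fin 2) (TensorAlgebra ℤ (H n)) :=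
  TensorAlgebra.lift ℤ ((FreeAbelianGroup.basis (Fin n)).constr ℤ fun j =>
    !![0, if j = i then 1 else 0; 0, X j])

theorem dLmat_X {n : ℕ} (i j : Fin n) : dLmat i (X j) =
    !![0, if j = i then 1 else 0; 0, X j] := by
  rw [dLmat, TensorAlgebra.lift_ι_apply, ← basis_eq_x, Module.Basis.constr_basis]

/-- The lower row of the matrix of z is (0, z), so the corner entry for x_j z is δ_{ij} z. Thus the
universal property of the tensor algebra yields an operator that is not an algebra map. -/
theorem dLmat_Wd {n : ℕ} (i : Fin n) (l : List (Fin n)) : dLmat i (Wd l) 1 0 = 0 ∧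
    dLmat i (Wd l) 1 1 = Wd l := by
  induction l with
  | nil => simp
  | cons a l ih => simp [Wd_cons, dLmat_X, Matrix.mul_apply, Fin.sum_univ_two, ih]

/-- The left derivative: `∂_i (x_j z) = δ_{ij} z`. -/
def dL {n : ℕ} (i : Fin n) : TensorAlgebra ℤ (H n) →ₗ[ℤ] TensorAlgebra ℤ (H n) :=
  (Matrix.entryLinearMap ℤ _ 0 1) ∘ₗ (dLmat i).toLinearMap

theorem dL_Wd_cons {n : ℕ} (i j : Fin n) (l : List (Fin n)) :
    dL i (Wd (j :: l)) = if j = i then Wd l else 0 := by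
  have h : dL i (Wd (j :: l)) = (dLmat i (X j) * dLmat i (Wd l)) 0 1 := by
    rw [← map_mul, ← Wd_cons]; rfl
  rw [h, Matrix.mul_apply, Fin.sum_univ_two, (dLmat_Wd i l).2, dLmat_X]
  simp

@[simp] theorem dL_Wd_nil {n : ℕ} (i : Fin n) : dL i (1 : TensorAlgebra ℤ (H n)) = 0 := by
  simp [dL]

theorem dL_X_mul {n : ℕ} (i j : Fin n) (z : TensorAlgebra ℤ (H n)) :
    dL i (X j * z) = if j = i then z else 0 := by
  have h : dL i ∘ₗ LinearMap.mulLeft ℤ (X j) = if j = i then LinearMap.id else 0 := by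
    refine hom_ext_Wd fun l => ?_
    rw [LinearMap.comp_apply, LinearMap.mulLeft_apply, ← Wd_cons, dL_Wd_cons]
    split_ifs <;> rfl
  have := LinearMap.congr_fun h z
  rw [LinearMap.comp_apply, LinearMap.mulLeft_apply] at this
  rw [this]; split_ifs <;> rfl

/-- This moves the contraction from tensor powers to the tensor algebra, where all later trace
computations take place. -/
theorem contract_component {n : ℕ} (k : ℕ) (i : Fin n) (z : TensorAlgebra ℤ (H n)) :
    contract k (xdual i) (component n (k + 1) z) = component n k (dL i z) := by
  suffices h : contract k (xdual i) ∘ₗ component n (k + 1) = component n k ∘ₗ dL i from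
    LinearMap.congr_fun h z
  refine hom_ext_Wd fun l => ?_
  rw [LinearMap.comp_apply, LinearMap.comp_apply]
  rcases l with _ | ⟨j, l⟩
  · rw [component_Wd_of_ne (by simp), Wd_nil, dL_Wd_nil, map_zero, map_zero]
  · rw [dL_Wd_cons]
    by_cases hl : l.length = k
    · subst hl
      have h1 : component n (l.length + 1) (Wd (j :: l)) = tw (Fin.cons j l.get) := by
        rw [← component_Wd_ofFn, List.ofFn_succ]; simp
      have h2 : component n l.length (Wd l) = tw l.get := by
        rw [← component_Wd_ofFn, List.ofFn_get]
      rw [h1, tw, contract_tprod, Fin.cons_zero, xdual_x]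
      split_ifs
      · rw [one_smul, h2]; simp [tw]
      · rw [zero_smul, map_zero]
    · rw [component_Wd_of_ne (by simpa using hl), map_zero]
      split_ifs
      · rw [component_Wd_of_ne hl]
      · rw [map_zero]

theorem co_cons {n : ℕ} (i : Fin n) (l : List (Fin n)) (z : TensorAlgebra ℤ (H n)) :
    co (i :: l) z = co l (dL i z) := by
  suffices h : co (i :: l) = co l ∘ₗ dL i from LinearMap.congr_fun h z
  refine hom_ext_Wd fun l' => ?_
  rw [LinearMap.comp_apply, co_Wd]
  rcases l' with _ | ⟨j, l'⟩
  · simp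
  · rw [dL_Wd_cons]
    split_ifs with h1 h2 h3
    · simp at h1; simp [co_Wd, h1.2]
    · simp at h1; tauto
    · rw [co_Wd, if_neg]; rintro rfl; simp [h3] at h1
    · simp

theorem co_cons_mul {n : ℕ} (i j : Fin n) (l : List (Fin n)) (z : TensorAlgebra ℤ (H n)) :
    co (i :: l) (X j * z) = if j = i then co l z else 0 := by
  rw [co_cons, dL_X_mul]; split_ifs <;> simp

theorem co_concat_mul {n : ℕ} (i j : Fin n) (l : List (Fin n)) (z : TensorAlgebra ℤ (H n)) :
    co (l ++ [i]) (z * X j) = if j = i then co l z else 0 := by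
  have h : co (l ++ [i]) ∘ₗ LinearMap.mulRight ℤ (X j) = if j = i then co l else 0 := by
    refine hom_ext_Wd fun l' => ?_
    rw [LinearMap.comp_apply, LinearMap.mulRight_apply, ← Wd_concat, co_Wd]
    by_cases h : j = i
    · simp [h, co_Wd]
    · rw [if_neg h, if_neg]; · rfl
      intro h'
      exact h (List.singleton_inj.1 (List.append_inj' h' rfl).2)
  have := LinearMap.congr_fun h z
  rw [LinearMap.comp_apply, LinearMap.mulRight_apply] at this
  rw [this]; split_ifs <;> rfl

/-! ### Magnus coefficients -/

/-- The component of degree `k` of the Magnus expansion. -/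
def mag {n : ℕ} (k : ℕ) (g : F n) : TensorAlgebra ℤ (H n) := PowerSeries.coeff k (magnusSub g)

theorem le_order_of_mem {n k : ℕ} {g : F n} (hg : g ∈ gamma n k) :
    (k : ℕ∞) ≤ (magnusSub g).order := by
  cases k with
  | zero => simp
  | succ k => exact le_order_magnusSub hg

theorem mag_eq_zero {n k j : ℕ} {g : F n} (hg : g ∈ gamma n k) (h : j < k) : mag j g = 0 :=
  PowerSeries.coeff_of_lt_order _ (lt_of_lt_of_le (by exact_mod_cast h) (le_order_of_mem hg))

theorem iota_cls {n k : ℕ} {g : F n} (hg : g ∈ gamma n k) :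
    iota n k (cls k g) = component n k (mag k g) := by
  rw [cls_of_mem hg]; rfl

theorem coeff_mul_of_le_order {R : Type} [Semiring R] {f g : PowerSeries R} {a b : ℕ}
    (hf : (a : ℕ∞) ≤ f.order) (hg : (b : ℕ∞) ≤ g.order) :
    PowerSeries.coeff (a + b) (f * g) = PowerSeries.coeff a f * PowerSeries.coeff b g := by
  rw [PowerSeries.coeff_mul, Finset.sum_eq_single (a, b)]
  · rintro ⟨c, d⟩ hcd hne
    have hcd : c + d = a + b := by simpa using hcd
    by_cases hc : c < a
    · rw [PowerSeries.coeff_of_lt_order c (lt_of_lt_of_le (by exact_mod_cast hc) hf), zero_mul]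
    · have hd : d < b := by
        by_contra hd
        exact hne (Prod.ext (by simp only; omega) (by simp only; omega))
      rw [PowerSeries.coeff_of_lt_order d (lt_of_lt_of_le (by exact_mod_cast hd) hg), mul_zero]
  · intro h; simp at h

theorem mag_mul {n k : ℕ} {g h : F n} (hg : g ∈ gamma n k) :
    mag k (g * h) = mag k g + mag k h := by
  rw [mag, magnusSub_mul, map_add, map_add, PowerSeries.coeff_of_lt_order (φ := _ * _), add_zero]
  · rfl
  · refine lt_of_lt_of_le ?_ (le_order_mul_of_le (le_order_of_mem hg) (one_le_order_magnusSub h))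
    exact_mod_cast Nat.lt_succ_self k

theorem coeff_zero_magnus {n : ℕ} (g : F n) :
    PowerSeries.coeff 0 (magnus n g : PowerSeries (TensorAlgebra ℤ (H n))) = 1 := by
  have h := PowerSeries.coeff_of_lt_order 0
    (lt_of_lt_of_le (by simp) (one_le_order_magnusSub g) : ((0 : ℕ) : ℕ∞) < _)
  rw [magnusSub, map_sub, sub_eq_zero] at h
  rw [h]; simp

/-- The expansion of ⁅a, b⁆ minus one is the ring commutator of the two expansions times a unit with
constant term 1, and that unit does not affect the leading term. -/
theorem mag_commutator {n i j m : ℕ} (hm : m = i + j) {a b : F n} (ha : a ∈ gamma n i)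
    (hb : b ∈ gamma n j) : mag m ⁅a, b⁆ = mag i a * mag j b - mag j b * mag i a := by
  subst hm
  have h1 := le_order_of_mem ha
  have h2 := le_order_of_mem hb
  have h3 : (((i + j : ℕ)) : ℕ∞) ≤ (magnusSub a * magnusSub b - magnusSub b * magnusSub a).order := by
    rw [sub_eq_add_neg]
    refine le_order_add_of_le ?_ ?_
    · exact_mod_cast le_order_mul_of_le h1 h2
    · rw [PowerSeries.order_neg]
      have := le_order_mul_of_le h2 h1
      rw [add_comm] at this
      exact_mod_cast this
  rw [mag, magnusSub_commutator]
  have h4 := coeff_mul_of_le_order (b := 0) h3 (g := (((magnus n (b * a))⁻¹ :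
    (PowerSeries (TensorAlgebra ℤ (H n)))ˣ) : PowerSeries (TensorAlgebra ℤ (H n)))) (by simp)
  rw [add_zero] at h4
  rw [h4, ← map_inv, coeff_zero_magnus, mul_one, map_sub, coeff_mul_of_le_order h1 h2, add_comm i j,
    coeff_mul_of_le_order h2 h1]
  rfl

theorem mag_of {n : ℕ} (i : Fin n) : mag 1 (FreeGroup.of i) = X i := by
  simp [mag, magnusSub, magnus]

/-- The iterated bracket `[z, x_{l_0}, x_{l_1}, …]` in the tensor algebra. -/
def lp {n : ℕ} (z : TensorAlgebra ℤ (H n)) (l : List (Fin n)) : TensorAlgebra ℤ (H n) :=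
  l.foldl (fun w b => w * X b - X b * w) z

@[simp] theorem lp_nil {n : ℕ} (z : TensorAlgebra ℤ (H n)) : lp z [] = z := rfl

@[simp] theorem lp_cons {n : ℕ} (z : TensorAlgebra ℤ (H n)) (b : Fin n) (l : List (Fin n)) :
    lp z (b :: l) = lp (z * X b - X b * z) l := rfl

theorem lp_concat {n : ℕ} (z : TensorAlgebra ℤ (H n)) (b : Fin n) (l : List (Fin n)) :
    lp z (l ++ [b]) = lp z l * X b - X b * lp z l := List.foldl_append

theorem mag_lnc {n k m : ℕ} {g : F n} (hg : g ∈ gamma n k) {l : List (Fin n)}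
    (hm : m = k + l.length) : mag m (lnc g l) = lp (mag k g) l := by
  induction l generalizing k g with
  | nil => obtain rfl : m = k := by simpa using hm
           rfl
  | cons b l ih =>
    rw [lnc_cons, ih (commutator_mem_gamma hg _) (by rw [hm, List.length_cons]; ring),
      mag_commutator rfl hg (mem_gamma_one _), mag_of, lp_cons]

theorem iota_lnc {n k : ℕ} (a : Fin n) {l : List (Fin n)} (hl : l.length = k) :
    iota n (k + 1) (cls (k + 1) (lnc (FreeGroup.of a) l)) = component n (k + 1) (lp (X a) l) := by
  rw [iota_cls (lnc_mem (mem_gamma_one _) (by omega)),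
    mag_lnc (mem_gamma_one _) (by omega), mag_of]

/-! ### Injectivity of the embedding `𝓛_n(k) → H^{⊗ k}` in low degrees -/

/-- The linear map on `H^{⊗ k}` with prescribed values on words. -/
def wc {n : ℕ} {M : Type*} [AddCommGroup M] (k : ℕ) (f : List (Fin n) → M) :
    (⨂[ℤ]^k (H n)) →ₗ[ℤ] M :=
  (wordBasis n k).constr ℤ fun a => f (List.ofFn a)

theorem wc_tw {n k : ℕ} {M : Type*} [AddCommGroup M] (f : List (Fin n) → M) (a : Fin k → Fin n) :
    wc k f (tw a) = f (List.ofFn a) := by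
  rw [wc, ← wordBasis_apply, Module.Basis.constr_basis]

theorem wc_component_Wd {n k : ℕ} {M : Type*} [AddCommGroup M] (f : List (Fin n) → M)
    {l : List (Fin n)} (hl : l.length = k) : wc k f (component n k (Wd l)) = f l := by
  subst hl
  have h := component_Wd_ofFn l.get
  rw [List.ofFn_get] at h
  rw [h, wc_tw, List.ofFn_get]

theorem lp_one {n : ℕ} (a b : Fin n) : lp (X a) [b] = Wd [a, b] - Wd [b, a] := by
  simp [Wd]

theorem lp_two {n : ℕ} (a b c : Fin n) :
    lp (X a) [b, c] = Wd [a, b, c] - Wd [b, a, c] - Wd [c, a, b] + Wd [c, b, a] := by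
  simp [Wd]; noncomm_ring

theorem lp_three {n : ℕ} (a b c d : Fin n) :
    lp (X a) [b, c, d] = Wd [a, b, c, d] - Wd [b, a, c, d] - Wd [c, a, b, d] + Wd [c, b, a, d]
      - Wd [d, a, b, c] + Wd [d, b, a, c] + Wd [d, c, a, b] - Wd [d, c, b, a] := by
  simp [Wd]; noncomm_ring

/-- The class of the left-normed commutator of a word of length `k`. -/
abbrev cl {n : ℕ} (k : ℕ) (a : Fin n) (l : List (Fin n)) : L n k := cls k (lnc (FreeGroup.of a) l)

theorem cl_mem {n k : ℕ} (a : Fin n) {l : List (Fin n)} (hl : l.length + 1 = k) :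
    lnc (FreeGroup.of a) l ∈ gamma n k := lnc_mem (mem_gamma_one _) (by omega)

theorem cl_swap {n k : ℕ} (a b : Fin n) (l : List (Fin n)) (hl : l.length + 2 = k) :
    cl k b (a :: l) = - cl k a (b :: l) := by
  have h (a b : Fin n) : cl k a (b :: l) =
      L.lncMap 2 k l (by omega) (cls 2 ⁅FreeGroup.of a, FreeGroup.of b⁆) := by
    rw [L.lncMap_cls _ _ (commutator_mem_gamma (mem_gamma_one _) _)]; rfl
  rw [h, h, ← map_neg, cls_commutator_swap le_rfl le_rfl rfl (mem_gamma_one _) (mem_gamma_one _)]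

theorem cl_self {n k : ℕ} (a : Fin n) (l : List (Fin n)) (hl : l.length + 2 = k) :
    cl k a (a :: l) = 0 := by
  have h : cl k a (a :: l) =
      L.lncMap 2 k l (by omega) (cls 2 ⁅FreeGroup.of a, FreeGroup.of a⁆) := by
    rw [L.lncMap_cls _ _ (commutator_mem_gamma (mem_gamma_one _) _)]; rfl
  rw [h]; simp

theorem cl_jacobi {n k : ℕ} (a b c : Fin n) (l : List (Fin n)) (hl : l.length + 3 = k) :
    cl k a (b :: c :: l) + cl k b (c :: a :: l) + cl k c (a :: b :: l) = 0 := by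
  have h (a b c : Fin n) : cl k a (b :: c :: l) =
      L.lncMap 3 k l (by omega) (cls 3 ⁅⁅FreeGroup.of a, FreeGroup.of b⁆, FreeGroup.of c⁆) := by
    rw [L.lncMap_cls _ _ (commutator_mem_gamma (commutator_mem_gamma (mem_gamma_one _) _) _)]; rfl
  rw [h, h, h, ← map_add, ← map_add, cls_jacobi le_rfl le_rfl rfl le_rfl rfl
    (mem_gamma_one _) (mem_gamma_one _) (mem_gamma_one _), map_zero]

theorem iota_cl {n k : ℕ} (a : Fin n) {l : List (Fin n)} (hl : l.length + 1 = k) :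
    iota n k (cl k a l) = component n k (lp (X a) l) := by
  subst hl; exact iota_lnc a rfl

/-- A retraction is given by reading only the words ab with b < a, one for each basic commutator [a,
b]; it is enough to test it on left-normed commutators. -/
theorem iota_two_injective {n : ℕ} : Function.Injective (iota n 2) := by
  set f : List (Fin n) → L n 2 := fun l => match l with
    | [a, b] => if b < a then cl 2 a [b] else 0
    | _ => 0 with hf
  have key (z : L n 2) : z ∈ LinearMap.eqLocus (wc 2 f ∘ₗ iota n 2) LinearMap.id := by
    refine L.induction_lnc (k := 1) _ (fun a l hl => ?_) z
    obtain ⟨b, rfl⟩ := List.length_eq_one_iff.1 hl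
    rw [LinearMap.mem_eqLocus, LinearMap.comp_apply, LinearMap.id_apply]
    have e := iota_cl (k := 2) a (l := [b]) rfl
    rw [lp_one] at e
    change wc 2 f (iota n 2 (cl 2 a [b])) = cl 2 a [b]
    have wf (p q : Fin n) : wc 2 f (component n 2 (Wd [p, q])) = f [p, q] :=
      wc_component_Wd f rfl
    rw [e, map_sub, map_sub, wf, wf]
    simp only [hf]
    rcases lt_trichotomy a b with h | rfl | h
    · rw [if_neg h.not_gt, if_pos h, cl_swap (k := 2) a b [] rfl]; simp
    · rw [cl_self (k := 2) a [] rfl]; simp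
    · rw [if_pos h, if_neg h.not_gt]; simp
  refine (injective_iff_map_eq_zero _).2 fun z hz => ?_
  have h := key z
  rw [LinearMap.mem_eqLocus, LinearMap.comp_apply, hz, map_zero] at h
  exact h.symm

/-- The retraction is symmetric in the last two letters and vanishes when the first letter is
smallest. In the expansion of a basic commutator [b, a, c] (a < b, a ≤ c) the two words starting
with c then cancel, the word abc gives 0, and only bac survives. The other commutators reduce to
these by antisymmetry and Jacobi. -/
theorem iota_three_injective {n : ℕ} : Function.Injective (iota n 3) := by
  set f : List (Fin n) → L n 3 := fun l => match l with
    | [a, b, c] => if min b c < a then cl 3 a [min b c, max b c] else 0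
    | _ => 0 with hf
  set S : Submodule ℤ (L n 3) := LinearMap.eqLocus (wc 3 f ∘ₗ iota n 3) LinearMap.id with hS
  have basic (b a c : Fin n) (h1 : a < b) (h2 : a ≤ c) : cl 3 b [a, c] ∈ S := by
    rw [hS, LinearMap.mem_eqLocus, LinearMap.comp_apply, LinearMap.id_apply, iota_cl (k := 3) b (l := [a, c]) rfl, lp_two]
    simp only [map_sub, map_add]
    have wf (p q r : Fin n) : wc 3 f (component n 3 (Wd [p, q, r])) = f [p, q, r] :=
      wc_component_Wd f rfl
    simp only [wf]
    simp only [hf]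
    rw [min_comm b a, max_comm b a, if_neg (c := min b c < a) (by simp [h1.le, h2]), min_eq_left h2,
      max_eq_right h2, if_pos h1]
    abel
  have gt (b a c : Fin n) (h1 : a < b) : cl 3 b [a, c] ∈ S := by
    rcases le_or_gt a c with h2 | h2
    · exact basic b a c h1 h2
    · have e := cl_jacobi (k := 3) b a c [] rfl
      have e2 := cl_swap (k := 3) b c [a] rfl
      have h3 := basic a c b h2 (by omega)
      have h4 := basic b c a (by omega) h2.le
      have : cl 3 b [a, c] = cl 3 b [c, a] - cl 3 a [c, b] := by
        rw [e2] at e; rw [← sub_eq_zero, ← e]; abel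
      rw [this]; exact sub_mem h4 h3
  have key (z : L n 3) : z ∈ S := by
    refine L.induction_lnc (k := 2) _ (fun b l hl => ?_) z
    obtain ⟨a, c, rfl⟩ := List.length_eq_two.1 hl
    change cl 3 b [a, c] ∈ S
    rcases lt_trichotomy a b with h | rfl | h
    · exact gt b a c h
    · rw [cl_self (k := 3) a [c] rfl]; exact zero_mem _
    · rw [cl_swap (k := 3) a b [c] rfl]; exact neg_mem (gt _ _ _ h)
  refine (injective_iff_map_eq_zero _).2 fun z hz => ?_
  have h := key z
  rw [hS, LinearMap.mem_eqLocus, LinearMap.comp_apply, hz, map_zero] at h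
  exact h.symm

/-- Sorting the last three letters produces a function symmetric in them; it serves as the first
retraction in degree four. -/
theorem exists_sorted_triple {n : ℕ} (M : Type) [AddCommGroup M]
    (g : Fin n → Fin n → Fin n → Fin n → M) : ∃ f : Fin n → Fin n → Fin n → Fin n → M,
      (∀ w a b c, f w b a c = f w a b c) ∧ (∀ w a b c, f w a c b = f w a b c) ∧
      (∀ w a b c, a < w → a ≤ b → b ≤ c → f w a b c = g w a b c) ∧
      ∀ w a b c, w ≤ a → w ≤ b → w ≤ c → f w a b c = 0 := by
  set G : Fin n → List (Fin n) → M := fun w l => match l with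
    | [p, q, r] => if p < w then g w p q r else 0
    | _ => 0 with hG
  refine ⟨fun w a b c => G w ((([a, b, c] : List (Fin n)) : Multiset (Fin n)).sort (· ≤ ·)),
    fun w a b c => ?_, fun w a b c => ?_, fun w a b c h1 h2 h3 => ?_, fun w a b c h1 h2 h3 => ?_⟩
  · refine congrArg (fun s => G w (Multiset.sort s (· ≤ ·))) ?_
    exact Multiset.coe_eq_coe.2 (List.Perm.swap _ _ _)
  · refine congrArg (fun s => G w (Multiset.sort s (· ≤ ·))) ?_
    exact Multiset.coe_eq_coe.2 (List.Perm.cons _ (List.Perm.swap _ _ _))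
  · have : (([a, b, c] : List (Fin n)) : Multiset (Fin n)).sort (· ≤ ·) = [a, b, c] := by
      rw [Multiset.coe_sort]
      refine List.mergeSort_of_pairwise ?_
      simp only [List.pairwise_cons, List.mem_cons, List.not_mem_nil, or_false,
        decide_eq_true_eq]
      refine ⟨?_, ?_, ?_, ?_⟩
      · rintro x (rfl | rfl); exacts [h2, h2.trans h3]
      · rintro x rfl; exact h3
      · simp
      · simp
    simp only [this, hG, if_pos h1]
  · have hm : ∀ x ∈ (([a, b, c] : List (Fin n)) : Multiset (Fin n)).sort (· ≤ ·), w ≤ x := by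
      intro x hx
      rw [Multiset.mem_sort, Multiset.mem_coe] at hx
      simp only [List.mem_cons, List.not_mem_nil, or_false] at hx
      rcases hx with rfl | rfl | rfl <;> assumption
    have G0 (l : List (Fin n)) (hl : ∀ x ∈ l, w ≤ x) : G w l = 0 := by
      simp only [hG]
      split
      · rw [if_neg (hl _ (by simp)).not_gt]
      · rfl
    exact G0 _ hm

/-- The class of `[[x_a, x_b], [x_c, x_d]]`. -/
def dbl {n : ℕ} (a b c d : Fin n) : L n 4 :=
  cls 4 ⁅⁅FreeGroup.of a, FreeGroup.of b⁆, ⁅FreeGroup.of c, FreeGroup.of d⁆⁆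

theorem comm_of_mem {n : ℕ} (a b : Fin n) :
    ⁅(FreeGroup.of a : F n), FreeGroup.of b⁆ ∈ gamma n 2 :=
  commutator_mem_gamma (mem_gamma_one _) _

theorem dbl_eq {n : ℕ} (a b c d : Fin n) : dbl a b c d = cl 4 a [b, c, d] - cl 4 a [b, d, c] :=
  cls_jacobi' le_rfl le_rfl rfl (by omega) rfl (mem_gamma_one _) (mem_gamma_one _)
    (comm_of_mem a b)

theorem dbl_swap_right {n : ℕ} (a b c d : Fin n) : dbl a b d c = - dbl a b c d := by
  rw [dbl_eq, dbl_eq]; abel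

theorem dbl_swap {n : ℕ} (a b c d : Fin n) : dbl c d a b = - dbl a b c d :=
  cls_commutator_swap (i := 2) (j := 2) (by omega) (by omega) rfl (comm_of_mem a b) (comm_of_mem c d)

theorem iota_dbl {n : ℕ} (a b c d : Fin n) : iota n 4 (dbl a b c d) = component n 4
    (Wd [a, b, c, d] - Wd [b, a, c, d] - Wd [a, b, d, c] + Wd [b, a, d, c] - Wd [c, d, a, b]
      + Wd [d, c, a, b] + Wd [c, d, b, a] - Wd [d, c, b, a]) := by
  rw [dbl, iota_cls (commutator_mem (i := 2) (j := 2) (by omega) (by omega) rfl (comm_of_mem a b)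
    (comm_of_mem c d)),
    mag_commutator (i := 2) (j := 2) rfl (comm_of_mem a b) (comm_of_mem c d),
    mag_commutator rfl (mem_gamma_one _) (mem_gamma_one _),
    mag_commutator rfl (mem_gamma_one _) (mem_gamma_one _)]
  simp only [mag_of]
  congr 1
  simp [Wd]; noncomm_ring

/-- There are two kinds of basic commutators in degree four, [b, a, c, d] with a < b, a ≤ c ≤ d, and
[[a, b], [c, d]], and they are detected in two stages. The function `f`, symmetric in the last three
letters, recovers the first kind and kills the second; what remains is recovered by `h`, which reads
one word for each unordered pair of distinct basic brackets. -/
theorem iota_four_injective {n : ℕ} : Function.Injective (iota n 4) := by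
  obtain ⟨f₀, f1, f2, f3, f4⟩ := exists_sorted_triple (L n 4) (fun w a b c : Fin n => cl 4 w [a, b, c])
  set f : List (Fin n) → L n 4 := fun l => match l with
    | [w, a, b, c] => f₀ w a b c
    | _ => 0 with hf
  set h : List (Fin n) → L n 4 := fun l => match l with
    | [a, b, c, d] => if b < a ∧ d < c ∧ (c < a ∨ c = a ∧ d < b) then dbl a b c d else 0
    | _ => 0 with hh
  have f' (w a b c : Fin n) : f [w, a, b, c] = f₀ w a b c := rfl
  -- `E` removes the part seen by `f`: it kills the basic left-normed commutators and fixes the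
  -- double brackets. If ι z = 0 then E z = z, so z ∈ S gives z = 0.
  set E : L n 4 →ₗ[ℤ] L n 4 := LinearMap.id - wc 4 f ∘ₗ iota n 4 with hE
  set S : Submodule ℤ (L n 4) := LinearMap.eqLocus (wc 4 h ∘ₗ iota n 4 ∘ₗ E) E with hS
  have wf (p q r s : Fin n) : wc 4 f (component n 4 (Wd [p, q, r, s])) = f [p, q, r, s] :=
    wc_component_Wd f rfl
  have wh (p q r s : Fin n) : wc 4 h (component n 4 (Wd [p, q, r, s])) = h [p, q, r, s] :=
    wc_component_Wd h rfl
  have memS (z : L n 4) : z ∈ S ↔ wc 4 h (iota n 4 (E z)) = E z := Iff.rfl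
  have Edbl (a b c d : Fin n) : E (dbl a b c d) = dbl a b c d := by
    rw [hE, LinearMap.sub_apply, LinearMap.comp_apply, iota_dbl, LinearMap.id_apply]
    simp only [map_sub, map_add]
    simp only [wf, f']
    rw [f2 a b c d, f2 b a c d, f2 c d a b, f2 d c a b]
    abel
  have dblS (a b c d : Fin n) (h1 : b < a) (h2 : d < c) (h3 : c < a ∨ c = a ∧ d < b) :
      dbl a b c d ∈ S := by
    rw [memS, Edbl, iota_dbl]
    simp only [map_sub, map_add]
    simp only [wh]
    simp only [hh]
    rw [if_pos ⟨h1, h2, h3⟩, if_neg (by omega), if_neg (by omega), if_neg (by omega),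
      if_neg (by omega), if_neg (by omega), if_neg (by omega), if_neg (by omega)]
    abel
  have dblS' (a b c d : Fin n) (h1 : b < a) (h2 : d < c) : dbl a b c d ∈ S := by
    by_cases h3 : c < a ∨ c = a ∧ d < b
    · exact dblS a b c d h1 h2 h3
    · by_cases h4 : a < c ∨ a = c ∧ b < d
      · rw [dbl_swap c d a b]; exact neg_mem (dblS c d a b h2 h1 h4)
      · obtain rfl : a = c := by omega
        obtain rfl : b = d := by omega
        have : dbl a b a b = 0 := by simp [dbl]
        rw [this]; exact zero_mem _
  have dblS'' (a b c d : Fin n) (h1 : b < a) : dbl a b c d ∈ S := by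
    rcases lt_trichotomy c d with h2 | rfl | h2
    · rw [dbl_swap_right a b d c]; exact neg_mem (dblS' _ _ _ _ h1 h2)
    · have : dbl a b c c = 0 := by simp [dbl]
      rw [this]; exact zero_mem _
    · exact dblS' _ _ _ _ h1 h2
  have basic (b a c d : Fin n) (h1 : a < b) (h2 : a ≤ c) (h3 : c ≤ d) : cl 4 b [a, c, d] ∈ S := by
    have : E (cl 4 b [a, c, d]) = 0 := by
      rw [hE, LinearMap.sub_apply, LinearMap.comp_apply, iota_cl (k := 4) b (l := [a, c, d]) rfl, lp_three,
        LinearMap.id_apply]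
      simp only [map_sub, map_add]
      simp only [wf, f']
      rw [f3 b a c d h1 h2 h3, f4 a b c d h1.le h2 (h2.trans h3), f1 c a b d, f1 d a b c,
        f2 d c a b]
      abel
    rw [memS, this, map_zero, map_zero]
  have basic' (b a c d : Fin n) (h1 : a < b) (h2 : a ≤ c) (h3 : a ≤ d) : cl 4 b [a, c, d] ∈ S := by
    rcases le_total c d with h4 | h4
    · exact basic _ _ _ _ h1 h2 h4
    · have e : cl 4 b [a, c, d] = cl 4 b [a, d, c] + dbl b a c d := by rw [dbl_eq]; abel
      rw [e]; exact add_mem (basic _ _ _ _ h1 h3 h4) (dblS'' _ _ _ _ h1)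
  have mid (b a c d : Fin n) (h1 : a < b) (h3 : c ≤ d) : cl 4 b [a, c, d] ∈ S := by
    rcases le_or_gt a c with h2 | h2
    · exact basic' _ _ _ _ h1 h2 (h2.trans h3)
    · have e := cl_jacobi (k := 4) b a c [d] rfl
      have e2 := cl_swap (k := 4) b c [a, d] rfl
      have h3 := basic' a c b d h2 (by omega) h3
      have h4 := basic' b c a d (by omega) h2.le (by omega)
      have : cl 4 b [a, c, d] = cl 4 b [c, a, d] - cl 4 a [c, b, d] := by
        rw [e2] at e; rw [← sub_eq_zero, ← e]; abel
      rw [this]; exact sub_mem h4 h3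
  have gt (b a c d : Fin n) (h1 : a < b) : cl 4 b [a, c, d] ∈ S := by
    rcases le_total c d with h2 | h2
    · exact mid _ _ _ _ h1 h2
    · have e : cl 4 b [a, c, d] = cl 4 b [a, d, c] + dbl b a c d := by rw [dbl_eq]; abel
      rw [e]; exact add_mem (mid _ _ _ _ h1 h2) (dblS'' _ _ _ _ h1)
  have key (z : L n 4) : z ∈ S := by
    refine L.induction_lnc (k := 3) _ (fun b l hl => ?_) z
    obtain ⟨a, c, d, rfl⟩ := List.length_eq_three.1 hl
    change cl 4 b [a, c, d] ∈ S
    rcases lt_trichotomy a b with h | rfl | h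
    · exact gt b a c d h
    · rw [cl_self (k := 4) a [c, d] rfl]; exact zero_mem _
    · rw [cl_swap (k := 4) a b [c, d] rfl]; exact neg_mem (gt _ _ _ _ h)
  refine (injective_iff_map_eq_zero _).2 fun z hz => ?_
  have hEz : E z = z := by
    rw [hE, LinearMap.sub_apply, LinearMap.comp_apply, hz, map_zero, sub_zero]; rfl
  have h := (memS z).1 (key z)
  rw [hEz, hz, map_zero] at h
  exact h.symm

/-! ### The derivations `x_i ↦ [w, x_i]` and the values of the Johnson homomorphism -/

/-- The element `x_i^* ⊗ [w, x_i]` of `Hom(H, 𝓛_n(k + 1))`. -/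
def D {n k : ℕ} (i : Fin n) : L n k →ₗ[ℤ] (H n →ₗ[ℤ] L n (k + 1)) :=
  LinearMap.smulRightₗ (xdual i) ∘ₗ L.ad k (FreeGroup.of i)

theorem D_apply {n k : ℕ} (i : Fin n) (w : L n k) : D i w = star i (L.ad k (FreeGroup.of i) w) :=
  rfl

theorem D_x {n k : ℕ} (i j : Fin n) (w : L n k) :
    D i w (x j) = if j = i then L.ad k (FreeGroup.of i) w else 0 := by
  rw [D_apply, star, LinearMap.smulRight_apply, xdual_x]
  split_ifs <;> simp

theorem H_hom_ext {n : ℕ} {M : Type} [AddCommGroup M] {f g : H n →ₗ[ℤ] M}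
    (h : ∀ i, f (x i) = g (x i)) : f = g :=
  (FreeAbelianGroup.basis (Fin n)).ext fun i => by rw [basis_eq_x, h]

theorem generator_eq_D {n k : ℕ} (i : Fin n) (j : Fin (k + 1) → Fin n) :
    star i (L.mk (leftNormed n (k + 1) (Fin.snoc (α := fun _ => Fin n) j i))) =
      D i (cl (k + 1) (j 0) (List.ofFn fun a : Fin k => j a.succ)) := by
  rw [D_apply, L.ad_cls _ (cl_mem _ (by simp)), mk_eq_cls]
  congr 2
  change ⁅(leftNormed n k (Fin.init (Fin.snoc (α := fun _ => Fin n) j i)) : F n), _⁆ = _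
  rw [Fin.init_snoc, Fin.snoc_last, leftNormed_eq_lnc]

theorem p_le_iff {n k : ℕ} {S : Submodule ℤ (H n →ₗ[ℤ] L n (k + 1 + 1))} :
    p n (k + 1) ≤ S ↔ ∀ (i a : Fin n) (l : List (Fin n)), l.length = k → D i (cl (k + 1) a l) ∈ S := by
  rw [p, Submodule.span_le]
  constructor
  · rintro h i a l rfl
    have := h ⟨(i, Fin.cons a l.get), rfl⟩
    simp only at this
    rw [generator_eq_D] at this
    simpa using this
  · rintro h _ ⟨⟨i, j⟩, rfl⟩
    simp only
    rw [generator_eq_D]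
    exact h _ _ _ (by simp)

theorem D_mem_p {n k : ℕ} (i : Fin n) (w : L n (k + 1)) : D i w ∈ p n (k + 1) := by
  have h : w ∈ (p n (k + 1)).comap (D i) :=
    L.induction_lnc _ (fun a l hl => p_le_iff.1 le_rfl i a l hl) w
  exact h

theorem mem_P_of_conj {n k : ℕ} (hk : 1 ≤ k) {σ : MulAut (F n)} {w : Fin n → F n}
    (hw : ∀ i, w i ∈ gamma n k)
    (hσ : ∀ i, σ (FreeGroup.of i) = w i * FreeGroup.of i * (w i)⁻¹) : σ ∈ P n k := by
  refine ⟨fun i => isConj_iff.2 ⟨w i, (hσ i).symm⟩, mem_A_iff.2 fun y => ?_⟩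
  have key : (QuotientGroup.mk' (gamma n (k + 1))).comp σ.toMonoidHom =
      QuotientGroup.mk' (gamma n (k + 1)) := by
    ext i
    simp only [MonoidHom.comp_apply]
    change QuotientGroup.mk (σ (FreeGroup.of i)) = QuotientGroup.mk (FreeGroup.of i)
    rw [eq_comm, QuotientGroup.eq, hσ]
    have := commutator_mem le_rfl hk (add_comm k 1)
      (inv_mem (mem_gamma_one (FreeGroup.of i))) (hw i)
    rwa [commutatorElement_def, inv_inv, mul_assoc, mul_assoc, ← mul_assoc (w i)] at this
  have h := DFunLike.congr_fun key y
  exact QuotientGroup.eq.1 h.symm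

/-- Here x_j⁻¹σ(x_j) = ⁅x_j⁻¹, w_j⁆, and the two sign changes, from the inverse and from the swap,
cancel. -/
theorem tau_of_conj {n k : ℕ} (hk : 1 ≤ k) (σ : P n k) {w : Fin n → F n}
    (hw : ∀ i, w i ∈ gamma n k)
    (hσ : ∀ i, (σ : MulAut (F n)) (FreeGroup.of i) = w i * FreeGroup.of i * (w i)⁻¹) :
    tau n k (gr.mk σ) = ∑ i, D i (cls k (w i)) := by
  refine H_hom_ext fun j => ?_
  rw [LinearMap.sum_apply, Finset.sum_eq_single j (fun i _ hi => by rw [D_x, if_neg hi.symm])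
    (by simp), D_x, if_pos rfl, L.ad_cls _ (hw j)]
  change tau n k (gr.mk σ) (H.mk (FreeGroup.of j)) = _
  rw [tau_mk_apply, mk_eq_cls]
  simp only [hσ]
  have e : (FreeGroup.of j)⁻¹ * (w j * FreeGroup.of j * (w j)⁻¹) = ⁅(FreeGroup.of j)⁻¹, w j⁆ := by
    rw [commutatorElement_def]; group
  rw [e, cls_commutator_inv_left le_rfl hk (by omega) (mem_gamma_one _) (hw j),
    cls_commutator_swap hk le_rfl rfl (hw j) (mem_gamma_one _), neg_neg]

/-! ### The centralizer of a generator. -/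

/-- Comparing coefficients of the word a·v·i in z x_i = x_i z: if a·v occurs in z then a = i and v·i
occurs too. Repeating this moves every letter to the end and shows each of them to be i. -/
theorem eq_replicate_of_co_ne_zero {n m : ℕ} {i : Fin n} {z : TensorAlgebra ℤ (H n)}
    (hz : component n (m + 1) (z * X i - X i * z) = 0) {l : List (Fin n)} (hl : l.length = m)
    (h : co l z ≠ 0) : l = List.replicate m i := by
  rw [component_eq_zero_iff] at hz
  have step (a : Fin n) (v : List (Fin n)) (hv : v.length + 1 = m) (hne : co (a :: v) z ≠ 0) :
      a = i ∧ co (v ++ [i]) z ≠ 0 := by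
    have e := hz (a :: v ++ [i]) (by simp [hv])
    rw [map_sub, co_concat_mul, if_pos rfl, List.cons_append, co_cons_mul] at e
    by_cases hi : i = a
    · rw [if_pos hi, sub_eq_zero] at e
      exact ⟨hi.symm, by rwa [← e]⟩
    · rw [if_neg hi, sub_zero] at e
      exact absurd e hne
  have main (u : List (Fin n)) : ∀ r, (u ++ List.replicate r i).length = m →
      co (u ++ List.replicate r i) z ≠ 0 → u = List.replicate u.length i := by
    induction u with
    | nil => intro r _ _; rfl
    | cons a u ih =>
      intro r hr hne
      obtain ⟨rfl, h2⟩ := step a (u ++ List.replicate r i) (by simpa [add_assoc] using hr) hne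
      rw [List.append_assoc, ← List.replicate_succ'] at h2
      have := ih (r + 1) (by simp at hr ⊢; omega) h2
      rw [List.length_cons, List.replicate_succ, ← this]
  have := main l 0 (by simpa using hl) (by simpa using h)
  rwa [hl] at this

/-- A constant word receives equal contributions from w x_b and x_b w, so it never occurs in a
bracket. Hence Lie elements of weight at least 2 contain no power of x_i, the only possible
obstruction to injectivity of ad x_i. -/
theorem co_replicate_lp {n : ℕ} (i a : Fin n) (l : List (Fin n)) (hl : l ≠ []) :
    co (List.replicate (l.length + 1) i) (lp (X a) l) = 0 := by
  obtain ⟨l, b, rfl⟩ := List.eq_nil_or_concat'  l |>.resolve_left hl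
  rw [lp_concat, map_sub]
  nth_rewrite 1 [List.replicate_succ']
  rw [co_concat_mul, List.replicate_succ, co_cons_mul, sub_self]

theorem coord_iota_const {n k : ℕ} (i : Fin n) (z : L n (k + 1 + 1)) :
    (wordBasis n (k + 1 + 1)).coord (fun _ => i) (iota n (k + 1 + 1) z) = 0 := by
  have h : z ∈ LinearMap.ker ((wordBasis n (k + 1 + 1)).coord (fun _ => i) ∘ₗ iota n (k + 1 + 1)) := by
    refine L.induction_lnc _ (fun a l hl => ?_) z
    rw [LinearMap.mem_ker, LinearMap.comp_apply, iota_lnc a hl, ← co_ofFn, List.ofFn_const, ← hl]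
    exact co_replicate_lp i a l (by rintro rfl; simp at hl)
  exact h

theorem iota_commutator_of {n k : ℕ} {g : F n} (hg : g ∈ gamma n k) (i : Fin n) :
    iota n (k + 1) (cls (k + 1) ⁅g, FreeGroup.of i⁆) =
      component n (k + 1) (mag k g * X i - X i * mag k g) := by
  rw [iota_cls (commutator_mem_gamma hg _), mag_commutator rfl hg (mem_gamma_one _), mag_of]

/-- An element of `𝓛_n(k)`, `k ≥ 2`, commuting with `x_i` in the tensor algebra is zero in it. -/
theorem iota_eq_zero_of_ad {n k : ℕ} (i : Fin n) (z : L n (k + 1 + 1))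
    (h : iota n _ (L.ad _ (FreeGroup.of i) z) = 0) : iota n (k + 1 + 1) z = 0 := by
  have hc := coord_iota_const i z
  induction z using L.ind_cls with | _ g hg
  rw [L.ad_cls _ hg, iota_commutator_of hg] at h
  rw [iota_cls hg] at hc ⊢
  rw [component_eq_zero_iff]
  intro l hl
  by_contra hne
  have := eq_replicate_of_co_ne_zero h hl hne
  rw [this, ← List.ofFn_const, co_ofFn] at hne
  exact hne hc

theorem iota_one_injective {n : ℕ} : Function.Injective (iota n 1) := by
  set f : List (Fin n) → L n 1 := fun l => match l with
    | [a] => cl 1 a []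
    | _ => 0 with hf
  have key (z : L n 1) : z ∈ LinearMap.eqLocus (wc 1 f ∘ₗ iota n 1) LinearMap.id := by
    refine L.induction_lnc (k := 0) _ (fun a l hl => ?_) z
    obtain rfl := List.length_eq_zero_iff.1 hl
    rw [LinearMap.mem_eqLocus, LinearMap.comp_apply, LinearMap.id_apply]
    have e := iota_cl (k := 1) a (l := []) rfl
    have e2 : lp (X a) [] = Wd [a] := by simp [Wd]
    rw [e2] at e
    have wf : wc 1 f (component n 1 (Wd [a])) = f [a] := wc_component_Wd f rfl
    change wc 1 f (iota n 1 (cl 1 a [])) = cl 1 a []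
    rw [e, wf]
  refine (injective_iff_map_eq_zero _).2 fun z hz => ?_
  have h := key z
  rw [LinearMap.mem_eqLocus, LinearMap.comp_apply, hz, map_zero] at h
  exact h.symm

theorem iota_injective {n k : ℕ} (hk : 1 ≤ k) (hk' : k ≤ 4) : Function.Injective (iota n k) := by
  obtain rfl | rfl | rfl | rfl : k = 1 ∨ k = 2 ∨ k = 3 ∨ k = 4 := by omega
  exacts [iota_one_injective, iota_two_injective, iota_three_injective, iota_four_injective]

theorem cls_zpow {n : ℕ} (g : F n) (c : ℤ) : cls 1 (g ^ c) = c • cls 1 g := by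
  have h := map_zpow (L.mkHom n) g c
  rw [cls_of_mem (mem_gamma_one _), cls_of_mem (mem_gamma_one _)]
  exact h

/-- The centralizer of `x_i` modulo the lower central series, in low degrees. -/
theorem exists_conj_mem_gamma {n k : ℕ} (hk : 1 ≤ k) (hk' : k ≤ 4) (i : Fin n) {g : F n}
    (hg : ⁅g, FreeGroup.of i⁆ ∈ gamma n (k + 1)) :
    ∃ w ∈ gamma n k, w * FreeGroup.of i * w⁻¹ = g * FreeGroup.of i * g⁻¹ := by
  suffices h : ∀ m, 1 ≤ m → m ≤ k →
      ∃ w ∈ gamma n m, w * FreeGroup.of i * w⁻¹ = g * FreeGroup.of i * g⁻¹ from h k hk le_rfl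
  intro m hm
  induction m, hm using Nat.le_induction with
  | base => exact fun _ => ⟨g, mem_gamma_one g, rfl⟩
  | succ m hm ih =>
    intro hmk
    obtain ⟨w, hw, e⟩ := ih (by omega)
    have hc : ⁅w, FreeGroup.of i⁆ ∈ gamma n (m + 1 + 1) := by
      rw [commutatorElement_def, e, ← commutatorElement_def]
      exact gamma_le (by omega) hg
    have h0 : iota n (m + 1) (L.ad m (FreeGroup.of i) (cls m w)) = 0 := by
      rw [L.ad_cls _ hw, cls_eq_zero hc, map_zero]
    rcases Nat.lt_or_ge 1 m with hm1 | hm1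
    · obtain ⟨r, rfl⟩ : ∃ r, m = r + 1 + 1 := ⟨m - 2, by omega⟩
      have h1 := iota_eq_zero_of_ad i _ h0
      have h2 : cls (r + 1 + 1) w = 0 :=
        (injective_iff_map_eq_zero _).1 (iota_injective (by omega) (by omega)) _ h1
      exact ⟨w, (cls_eq_zero_iff hw).1 h2, e⟩
    · obtain rfl : m = 1 := by omega
      rw [L.ad_cls _ hw, iota_commutator_of hw] at h0
      -- In weight 1 the centralizer of x_i contains x_i itself. Replacing w by w x_i^{-c}, with c
      -- the exponent of x_i in w, makes the class zero without changing the conjugate of x_i.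
      set c : ℤ := co [i] (mag 1 w)
      have hcls : cls 1 (w * FreeGroup.of i ^ (-c)) = 0 := by
        refine (injective_iff_map_eq_zero _).1 (iota_injective le_rfl (by omega)) _ ?_
        rw [cls_mul (mem_gamma_one _) (mem_gamma_one _), cls_zpow, map_add, map_zsmul,
          iota_cls (mem_gamma_one _), iota_cls (mem_gamma_one _), mag_of, ← map_zsmul, ← map_add,
          component_eq_zero_iff]
        intro l hl
        obtain ⟨a, rfl⟩ := List.length_eq_one_iff.1 hl
        have hX : co [a] (X i) = if i = a then 1 else 0 := by
          have := co_Wd [a] [i]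
          simpa [Wd] using this
        rw [map_add, map_zsmul, hX]
        by_cases ha : i = a
        · subst ha; simp [c]
        · rw [if_neg ha, smul_zero, add_zero]
          by_contra hne
          have := eq_replicate_of_co_ne_zero h0 hl hne
          simp at this
          exact ha this.symm
      refine ⟨_, (cls_eq_zero_iff (mem_gamma_one _)).1 hcls, ?_⟩
      rw [← e]; group

theorem exists_conj_of_mem_P {n k : ℕ} (hk : 1 ≤ k) (hk' : k ≤ 4) {σ : MulAut (F n)}
    (hσ : σ ∈ P n k) : ∃ w : Fin n → F n, (∀ i, w i ∈ gamma n k) ∧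
      ∀ i, σ (FreeGroup.of i) = w i * FreeGroup.of i * (w i)⁻¹ := by
  have h (i : Fin n) : ∃ w : F n, w ∈ gamma n k ∧
      σ (FreeGroup.of i) = w * FreeGroup.of i * w⁻¹ := by
    obtain ⟨g, hg⟩ := isConj_iff.1 (hσ.1 i)
    have h1 := mem_A_iff.1 hσ.2 (FreeGroup.of i)
    have h2 : ⁅g, FreeGroup.of i⁆ ∈ gamma n (k + 1) := by
      have := conj_mem_gamma h1 (FreeGroup.of i)
      rw [← hg] at this
      convert this using 1
      rw [commutatorElement_def]; group
    obtain ⟨w, hw, e⟩ := exists_conj_mem_gamma hk hk' i h2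
    exact ⟨w, hw, by rw [e, hg]⟩
  choose w hw using h
  exact ⟨w, fun i => (hw i).1, fun i => (hw i).2⟩

theorem tau_mem_p {n k : ℕ} (hk : 1 ≤ k) (hk' : k ≤ 4) (g : gr n k) : tau n k g ∈ p n k := by
  induction g using gr.ind with | _ σ
  obtain ⟨w, hw, e⟩ := exists_conj_of_mem_P hk hk' σ.2
  rw [tau_of_conj hk σ hw e]
  obtain ⟨k, rfl⟩ : ∃ r, k = r + 1 := ⟨k - 1, by omega⟩
  exact sum_mem fun i _ => D_mem_p i _

theorem tau_injective (n k : ℕ) : Function.Injective (tau n k) := by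
  refine (injective_iff_map_eq_zero _).2 fun g hg => ?_
  induction g using gr.ind with | _ σ
  have h : tauTilde n k σ = 1 := hg
  rw [tauTilde_eq_one_iff] at h
  exact (QuotientGroup.eq_one_iff σ).2 h

/-! ### Fox derivatives with coefficients in a ring -/

theorem cocycle_ext {n : ℕ} {S : Type*} [Ring S] {ρ : F n →* S} {Φ Ψ : F n → S}
    (hΦ : ∀ g h, Φ (g * h) = Φ g * ρ h + Φ h) (hΨ : ∀ g h, Ψ (g * h) = Ψ g * ρ h + Ψ h)
    (h : ∀ i, Φ (FreeGroup.of i) = Ψ (FreeGroup.of i)) (g : F n) : Φ g = Ψ g := by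
  have one {Φ : F n → S} (hΦ : ∀ g h, Φ (g * h) = Φ g * ρ h + Φ h) : Φ 1 = 0 := by
    simpa using hΦ 1 1
  have inv {Φ : F n → S} (hΦ : ∀ g h, Φ (g * h) = Φ g * ρ h + Φ h) (g : F n) :
      Φ g⁻¹ = - (Φ g * ρ g⁻¹) := by
    have e := hΦ g g⁻¹
    rw [mul_inv_cancel, one hΦ] at e
    exact (neg_eq_of_add_eq_zero_right e.symm).symm
  induction g using FreeGroup.induction_on with
  | C1 => rw [one hΦ, one hΨ]
  | of x => exact h x
  | inv_of x hx => rw [inv hΦ, inv hΨ, hx]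
  | mul x y hx hy => rw [hΦ, hΨ, hx, hy]

/-- A cocycle over ρ is the translation part of an action by affine maps s ↦ s ρ(g) + Φ(g), and on a
free group such an action may be prescribed on generators. -/
theorem exists_fox {n : ℕ} {S : Type*} [Ring S] (ρ : F n →* S) (j : Fin n) :
    ∃ Φ : F n → S, (∀ g h, Φ (g * h) = Φ g * ρ h + Φ h) ∧
      ∀ i, Φ (FreeGroup.of i) = if i = j then 1 else 0 := by
  -- The opposite group is needed because these affine maps multiply by ρ on the right and so form a
  -- right action.
  set T : F n →* (Equiv.Perm S)ᵐᵒᵖ := FreeGroup.lift fun i => MulOpposite.op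
    { toFun := fun s => s * ρ (FreeGroup.of i) + if i = j then 1 else 0
      invFun := fun s => (s - if i = j then 1 else 0) * ρ (FreeGroup.of i)⁻¹
      left_inv := fun s => by
        beta_reduce
        rw [add_sub_cancel_right, mul_assoc, ← map_mul, mul_inv_cancel, map_one, mul_one]
      right_inv := fun s => by
        beta_reduce
        rw [mul_assoc, ← map_mul, inv_mul_cancel, map_one, mul_one, sub_add_cancel] } with hT
  have hTmul (g h : F n) (s : S) : (T (g * h)).unop s = (T h).unop ((T g).unop s) := by
    rw [map_mul]; rfl
  have hof (i : Fin n) (s : S) : (T (FreeGroup.of i)).unop s =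
      s * ρ (FreeGroup.of i) + if i = j then 1 else 0 := by
    rw [hT, FreeGroup.lift_apply_of]; rfl
  have affine (g : F n) : ∀ s, (T g).unop s = s * ρ g + (T g).unop 0 := by
    induction g using FreeGroup.induction_on with
    | C1 => intro s; simp
    | of x => intro s; simp [hof]
    | inv_of x hx =>
      have inv (s : S) : (T (FreeGroup.of x)⁻¹).unop s =
          (s - if x = j then 1 else 0) * ρ (FreeGroup.of x)⁻¹ := by
        rw [map_inv, hT, FreeGroup.lift_apply_of]; rfl
      intro s
      rw [inv, inv]; noncomm_ring
    | mul x y hx hy =>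
      intro s
      rw [hTmul, hTmul, hy, hx, hy ((T x).unop 0), map_mul]; noncomm_ring
  refine ⟨fun g => (T g).unop 0, fun g h => ?_, fun i => ?_⟩
  · change (T (g * h)).unop 0 = _
    rw [hTmul, affine h]
  · change (T (FreeGroup.of i)).unop 0 = _
    rw [hof]; simp

/-- The chain rule for Fox derivatives: the inverse matrix is the Jacobian of σ⁻¹, formed with
derivatives over the twisted representation ρ ∘ σ. -/
theorem fox_mul_eq_one {n : ℕ} {S : Type*} [Ring S] (ρ : F n →* S) (σ : MulAut (F n))
    (Φ : Fin n → F n → S) (hΦ : ∀ j g h, Φ j (g * h) = Φ j g * ρ h + Φ j h)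
    (hΦ' : ∀ j i, Φ j (FreeGroup.of i) = if i = j then 1 else 0) :
    ∃ J' : Matrix (Fin n) (Fin n) S,
      (Matrix.of fun j i => Φ j (σ (FreeGroup.of i))) * J' = 1 := by
  choose Ψ hΨ hΨ' using exists_fox (ρ.comp σ.toMonoidHom)
  refine ⟨Matrix.of fun i l => Ψ i (σ⁻¹ (FreeGroup.of l)), ?_⟩
  have key (j : Fin n) (g : F n) : Φ j (σ g) = ∑ i, Φ j (σ (FreeGroup.of i)) * Ψ i g := by
    refine cocycle_ext (ρ := ρ.comp σ.toMonoidHom) (Φ := fun g => Φ j (σ g))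
      (Ψ := fun g => ∑ i, Φ j (σ (FreeGroup.of i)) * Ψ i g) (fun g h => ?_)
      (fun g h => ?_) (fun i => ?_) g
    · rw [map_mul, hΦ]; rfl
    · simp only [hΨ, mul_add, Finset.sum_add_distrib, Finset.sum_mul, mul_assoc]
    · simp [hΨ']
  ext j l
  rw [Matrix.mul_apply, Matrix.one_apply]
  simp only [Matrix.of_apply]
  rw [← key, MulAut.apply_inv_self, hΦ']
  simp only [eq_comm]

/-- If `J` is an invertible matrix over the polynomial ring of a matrix ring over `ℤ`, and
`J = 1 + t ^ k B` up to higher order, then `B` has trace zero. -/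
theorem trace_coeff_eq_zero {n k : ℕ} (hk : 1 ≤ k) {ι : Type} [Fintype ι] [DecidableEq ι]
    (J J' : Matrix (Fin n) (Fin n) (Polynomial (Matrix ι ι ℤ))) (hJ : J * J' = 1)
    (h0 : ∀ i j, (J i j).coeff 0 = if i = j then 1 else 0)
    (hlt : ∀ i j d, 0 < d → d < k → (J i j).coeff d = 0) :
    ∑ i, Matrix.trace ((J i i).coeff k) = 0 := by
  set φ : Matrix (Fin n) (Fin n) (Polynomial (Matrix ι ι ℤ)) →+*
      Matrix (Fin n × ι) (Fin n × ι) (Polynomial ℤ) :=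
    (Matrix.compRingEquiv (Fin n) ι (Polynomial ℤ)).toRingHom.comp
      (RingHom.mapMatrix (matPolyEquiv (n := ι) (R := ℤ)).symm.toRingEquiv.toRingHom) with hφ
  have φ_apply (M : Matrix (Fin n) (Fin n) (Polynomial (Matrix ι ι ℤ))) (a b : Fin n × ι) (d : ℕ) :
      (φ M a b).coeff d = (M a.1 b.1).coeff d a.2 b.2 := by
    have : φ M a b = (matPolyEquiv.symm (M a.1 b.1)) a.2 b.2 := rfl
    rw [this, ← matPolyEquiv_coeff_apply, AlgEquiv.apply_symm_apply]
  have hdet : IsUnit (φ J).det := by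
    refine IsUnit.of_mul_eq_one (φ J').det ?_
    rw [← Matrix.det_mul, ← map_mul, hJ, map_one, Matrix.det_one]
  -- Here polynomials matter: units of ℤ[t] are constants, whereas over power series invertibility
  -- would carry no information about the coefficient of t^k.
  obtain ⟨r, -, hr⟩ := Polynomial.isUnit_iff.1 hdet
  have hM : ∃ M : Matrix (Fin n × ι) (Fin n × ι) (Polynomial ℤ),
      φ J = 1 + (Polynomial.X ^ k : Polynomial ℤ) • M := by
    have h (a b : Fin n × ι) : ∃ m : Polynomial ℤ,
        φ J a b - (1 : Matrix (Fin n × ι) (Fin n × ι) (Polynomial ℤ)) a b =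
          Polynomial.X ^ k * m := by
      change (Polynomial.X ^ k : Polynomial ℤ) ∣ _
      rw [Polynomial.X_pow_dvd_iff]
      intro d hd
      rw [Polynomial.coeff_sub, φ_apply]
      rcases Nat.eq_zero_or_pos d with rfl | hd0
      · rw [h0]
        by_cases h1 : a.1 = b.1
        · rw [if_pos h1, Matrix.one_apply, Matrix.one_apply]
          by_cases h2 : a.2 = b.2
          · rw [if_pos h2, if_pos (Prod.ext h1 h2)]; simp
          · rw [if_neg h2, if_neg (fun h => h2 (by rw [h]))]; simp
        · rw [if_neg h1, Matrix.one_apply, if_neg (fun h => h1 (by rw [h]))]; simp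
      · rw [hlt _ _ d hd0 hd, Matrix.one_apply]
        split_ifs <;> simp [Polynomial.coeff_one, hd0.ne']
    choose m hm using h
    refine ⟨Matrix.of m, ?_⟩
    ext1 a b
    rw [Matrix.add_apply, Matrix.smul_apply, Matrix.of_apply, smul_eq_mul, ← hm]; ring
  obtain ⟨M, hM⟩ := hM
  have e := congrArg (fun q => Polynomial.coeff q k) hr
  -- The determinant is 1 + tr(M) t^k plus a multiple of t^{2k}, and 2k > k since k ≥ 1.
  rw [hM, Matrix.det_one_add_smul] at e
  simp only [Polynomial.coeff_add, Polynomial.coeff_one, Polynomial.coeff_C] at e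
  rw [if_neg (by omega), if_neg (by omega), mul_comm, Polynomial.coeff_X_pow_mul', if_pos le_rfl,
    ← pow_mul, mul_comm _ (Polynomial.X ^ _), Polynomial.coeff_X_pow_mul', if_neg (by omega),
    Nat.sub_self, zero_add, add_zero] at e
  have htr : ∑ i, Matrix.trace ((J i i).coeff k) = M.trace.coeff 0 := by
    have hc (a : Fin n × ι) : (J a.1 a.1).coeff k a.2 a.2 = (M a a).coeff 0 := by
      rw [← φ_apply, hM, Matrix.add_apply, Matrix.smul_apply, smul_eq_mul, Polynomial.coeff_add,
        Polynomial.coeff_X_pow_mul', if_pos le_rfl, Matrix.one_apply_eq, Polynomial.coeff_one,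
        if_neg (by omega), zero_add, Nat.sub_self]
    rw [Matrix.trace, Polynomial.finsetSum_coeff, Fintype.sum_prod_type]
    refine Finset.sum_congr rfl fun i _ => Finset.sum_congr rfl fun a _ => ?_
    exact hc (i, a)
  rw [htr, ← e]

/-! ### Evaluation of the Magnus expansion at nilpotent matrices -/

/-- Evaluation of the tensor algebra at a tuple of elements of a ring. -/
def ev {n : ℕ} {S : Type*} [Ring S] (a : Fin n → S) : TensorAlgebra ℤ (H n) →ₐ[ℤ] S :=
  TensorAlgebra.lift ℤ ((FreeAbelianGroup.basis (Fin n)).constr ℤ a)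

theorem ev_X {n : ℕ} {S : Type*} [Ring S] (a : Fin n → S) (i : Fin n) : ev a (X i) = a i := by
  rw [ev, TensorAlgebra.lift_ι_apply, ← basis_eq_x, Module.Basis.constr_basis]

/-- Nilpotency of a_i makes 1 + a_i t invertible among polynomials, so the evaluated Magnus
expansion of every group element is a polynomial. -/
theorem exists_polynomial_rep {n : ℕ} {S : Type*} [Ring S] (a : Fin n → S)
    (ha : ∀ i, IsNilpotent (a i)) : ∃ ρ : F n →* Polynomial S,
      ∀ g d, (ρ g).coeff d = ev a (PowerSeries.coeff d (magnus n g : PowerSeries _)) := by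
  have hu (i : Fin n) : IsUnit (1 + Polynomial.C (a i) * Polynomial.X) := by
    refine IsNilpotent.isUnit_one_add ?_
    obtain ⟨m, hm⟩ := ha i
    refine ⟨m, ?_⟩
    rw [(Polynomial.commute_X (Polynomial.C (a i))).symm.mul_pow, ← Polynomial.C_pow, hm]; simp
  set ρu : F n →* (Polynomial S)ˣ := FreeGroup.lift fun i => (hu i).unit
  refine ⟨(Units.coeHom _).comp ρu, fun g d => ?_⟩
  have key : (Units.map (Polynomial.coeToPowerSeries.ringHom (R := S)).toMonoidHom).comp ρu =
      (Units.map (PowerSeries.map (ev a).toRingHom).toMonoidHom).comp (magnus n) := by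
    ext i : 1
    refine Units.ext ?_
    simp only [MonoidHom.comp_apply, Units.coe_map, ρu, magnus, FreeGroup.lift_apply_of,
      IsUnit.unit_spec]
    change ((1 + Polynomial.C (a i) * Polynomial.X : Polynomial S) : PowerSeries S) =
      PowerSeries.map (ev a).toRingHom (1 + PowerSeries.monomial 1 (X i))
    ext d
    rw [PowerSeries.coeff_map, Polynomial.coeff_coe, map_add, Polynomial.coeff_add,
      PowerSeries.coeff_monomial, PowerSeries.coeff_one, Polynomial.coeff_one,
      Polynomial.coeff_C_mul, Polynomial.coeff_X]
    have e1 := ev_X a i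
    rw [map_add]
    by_cases h1 : d = 1
    · subst h1; simp; exact e1.symm
    · by_cases h0 : d = 0
      · subst h0; simp
      · simp [h1, h0, Ne.symm h1]
  have h := congrArg (fun u : (PowerSeries S)ˣ => PowerSeries.coeff d (u : PowerSeries S))
    (DFunLike.congr_fun key g)
  simpa using h

theorem dL_mul {n : ℕ} (i : Fin n) (z w : TensorAlgebra ℤ (H n)) :
    dL i (z * w) = dL i z * w + TensorAlgebra.algebraMapInv z • dL i w := by
  have h (w : TensorAlgebra ℤ (H n)) : dL i ∘ₗ LinearMap.mulRight ℤ w =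
      LinearMap.mulRight ℤ w ∘ₗ dL i +
        (TensorAlgebra.algebraMapInv (R := ℤ) (M := H n)).toLinearMap.smulRight (dL i w) := by
    refine hom_ext_Wd fun l => ?_
    rcases l with _ | ⟨j, l⟩
    · simp
    · simp only [LinearMap.comp_apply, LinearMap.mulRight_apply, LinearMap.add_apply,
        LinearMap.smulRight_apply, dL_Wd_cons]
      rw [Wd_cons, mul_assoc, dL_X_mul, AlgHom.toLinearMap_apply, map_mul]
      simp [TensorAlgebra.algebraMapInv, x]
  exact LinearMap.congr_fun (h w) z

/-- The subgroup of elements of the tensor algebra that are homogeneous of degree `d`. -/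
def homog (n d : ℕ) : Submodule ℤ (TensorAlgebra ℤ (H n)) :=
  Submodule.span ℤ (Wd '' {l : List (Fin n) | l.length = d})

theorem Wd_mem_homog {n : ℕ} (l : List (Fin n)) : Wd l ∈ homog n l.length :=
  Submodule.subset_span ⟨l, rfl, rfl⟩

theorem mul_mem_homog {n a b : ℕ} {z w : TensorAlgebra ℤ (H n)} (hz : z ∈ homog n a)
    (hw : w ∈ homog n b) : z * w ∈ homog n (a + b) := by
  have h := Submodule.mul_mem_mul hz hw
  rw [homog, homog, Submodule.span_mul_span] at h
  refine Submodule.span_mono ?_ h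
  rintro _ ⟨_, ⟨l, hl, rfl⟩, _, ⟨l', hl', rfl⟩, rfl⟩
  exact ⟨l ++ l', by simpa using congrArg₂ _ hl hl', Wd_append l l'⟩

/-- Homogeneity is what allows the trace against the cycle matrices to be read as coefficients of
words of a single length. For x_i⁻¹ it follows recursively from (1 + x_i t) y = 1. -/
theorem coeff_magnus_mem_homog {n : ℕ} (g : F n) (d : ℕ) :
    PowerSeries.coeff d (magnus n g : PowerSeries (TensorAlgebra ℤ (H n))) ∈ homog n d := by
  have hX (i : Fin n) : X i ∈ homog n 1 := by simpa [Wd] using Wd_mem_homog [i]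
  have hof (i : Fin n) : (magnus n (FreeGroup.of i) : PowerSeries (TensorAlgebra ℤ (H n))) =
    1 + PowerSeries.monomial 1 (X i) := by rw [magnus, FreeGroup.lift_apply_of]
  induction g using FreeGroup.induction_on generalizing d with
  | C1 =>
    rw [map_one, Units.val_one, PowerSeries.coeff_one]
    split_ifs with h
    · subst h; exact Wd_mem_homog []
    · exact zero_mem _
  | of i =>
    rw [hof, map_add, PowerSeries.coeff_one, PowerSeries.coeff_monomial]
    refine add_mem ?_ ?_
    · split_ifs with h
      · subst h; exact Wd_mem_homog []
      · exact zero_mem _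
    · split_ifs with h
      · subst h; exact hX i
      · exact zero_mem _
  | inv_of i hi =>
    have e : (magnus n (FreeGroup.of i) : PowerSeries (TensorAlgebra ℤ (H n))) *
        (magnus n (FreeGroup.of i)⁻¹ : _) = 1 := by
      rw [map_inv, Units.mul_inv]
    rw [hof, add_mul, one_mul, PowerSeries.monomial_eq_C_mul_X_pow, pow_one] at e
    induction d with
    | zero =>
      rw [coeff_zero_magnus]; exact Wd_mem_homog []
    | succ d ih =>
      have e' := congrArg (PowerSeries.coeff (d + 1)) e
      rw [map_add, mul_assoc, PowerSeries.coeff_C_mul, PowerSeries.coeff_succ_X_mul,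
        PowerSeries.coeff_one, if_neg (by omega)] at e'
      rw [eq_neg_of_add_eq_zero_left e', add_comm]
      exact neg_mem (mul_mem_homog (hX i) ih)
  | mul g h hg hh =>
    rw [map_mul, Units.val_mul, PowerSeries.coeff_mul]
    refine sum_mem fun ab hab => ?_
    have : ab.1 + ab.2 = d := by simpa using hab
    rw [← this]
    exact mul_mem_homog (hg _) (hh _)

theorem mag_eq_coeff_magnus {n d : ℕ} (g : F n) :
    mag (d + 1) g = PowerSeries.coeff (d + 1) (magnus n g : PowerSeries (TensorAlgebra ℤ (H n))) := by
  rw [mag, magnusSub, map_sub, PowerSeries.coeff_one, if_neg (by omega), sub_zero]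

theorem mag_mem_homog {n d : ℕ} (g : F n) : mag (d + 1) g ∈ homog n (d + 1) := by
  rw [mag_eq_coeff_magnus]; exact coeff_magnus_mem_homog g _

theorem algebraMapInv_of_mem_homog {n d : ℕ} {z : TensorAlgebra ℤ (H n)} (hz : z ∈ homog n (d + 1)) :
    TensorAlgebra.algebraMapInv z = 0 := by
  induction hz using Submodule.span_induction with
  | mem w hw =>
    obtain ⟨l, hl, rfl⟩ := hw
    rcases l with _ | ⟨j, l⟩
    · simp at hl
    · simp [Wd_cons, TensorAlgebra.algebraMapInv]
  | zero => simp
  | add x y _ _ hx hy => rw [map_add, hx, hy, add_zero]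
  | smul c x _ hx => rw [map_smul, hx, smul_zero]

theorem dL_mem_homog {n d : ℕ} (i : Fin n) {z : TensorAlgebra ℤ (H n)} (hz : z ∈ homog n (d + 1)) :
    dL i z ∈ homog n d := by
  induction hz using Submodule.span_induction with
  | mem w hw =>
    obtain ⟨l, hl, rfl⟩ := hw
    rcases l with _ | ⟨j, l⟩
    · simp at hl
    · rw [dL_Wd_cons]
      split_ifs
      · exact Submodule.subset_span ⟨l, by simpa using hl, rfl⟩
      · exact zero_mem _
  | zero => simp
  | add x y _ _ hx hy => rw [map_add]; exact add_mem hx hy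
  | smul c x _ hx => rw [map_smul]; exact Submodule.smul_mem _ c hx

/-- The Fox derivatives in terms of the Magnus expansion. -/
theorem coeff_fox {n : ℕ} {S : Type*} [Ring S] (a : Fin n → S) (ρ : F n →* Polynomial S)
    (hρ : ∀ g d, (ρ g).coeff d = ev a (PowerSeries.coeff d (magnus n g : PowerSeries _)))
    (j : Fin n) (Φ : F n → Polynomial S) (hΦ : ∀ g h, Φ (g * h) = Φ g * ρ h + Φ h)
    (hΦ' : ∀ i, Φ (FreeGroup.of i) = if i = j then 1 else 0) (g : F n) (d : ℕ) :
    (Φ g).coeff d = ev a (dL j (mag (d + 1) g)) := by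
  set ρ' : F n →* PowerSeries S := (Polynomial.coeToPowerSeries.ringHom (R := S)).toMonoidHom.comp ρ
  have h := cocycle_ext (ρ := ρ') (Φ := fun g => ((Φ g : Polynomial S) : PowerSeries S))
    (Ψ := fun g => PowerSeries.mk fun d => ev a (dL j (mag (d + 1) g)))
    (fun g h => ?_) (fun g h => ?_) (fun i => ?_) g
  · have := congrArg (PowerSeries.coeff d) h
    simpa using this
  · simp only [hΦ, Polynomial.coe_add, Polynomial.coe_mul]; rfl
  · ext d
    rw [PowerSeries.coeff_mk, map_add, PowerSeries.coeff_mk, PowerSeries.coeff_mul]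
    -- In the convolution the term with left degree 0 gives the derivative of h. In all others the
    -- left factor has zero augmentation, so ∂ acts on it alone, giving Φ(g) ρ(h).
    rw [mag_eq_coeff_magnus, map_mul, Units.val_mul, PowerSeries.coeff_mul,
      Finset.Nat.antidiagonal_succ, Finset.sum_cons, map_add, map_add, Finset.sum_map, map_sum,
      map_sum]
    have e : dL j (PowerSeries.coeff 0 (magnus n g : PowerSeries (TensorAlgebra ℤ (H n))) *
        PowerSeries.coeff (d + 1) (magnus n h : PowerSeries (TensorAlgebra ℤ (H n)))) =
        dL j (mag (d + 1) h) := by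
      rw [coeff_zero_magnus, one_mul, mag_eq_coeff_magnus]
    rw [e, add_comm]
    congr 1
    refine Finset.sum_congr rfl fun ab _ => ?_
    simp only [Function.Embedding.prodMap, Function.Embedding.coeFn_mk, Prod.map,
      Function.Embedding.refl_apply, Nat.succ_eq_add_one]
    rw [dL_mul, algebraMapInv_of_mem_homog (coeff_magnus_mem_homog g _), zero_smul, add_zero,
      map_mul, PowerSeries.coeff_mk, mag_eq_coeff_magnus]
    congr 1
    change _ = PowerSeries.coeff ab.2 ((ρ h : Polynomial S) : PowerSeries S)
    rw [Polynomial.coeff_coe, hρ]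
  · ext d
    rw [PowerSeries.coeff_mk, Polynomial.coeff_coe, hΦ']
    rcases Nat.eq_zero_or_pos d with rfl | hd
    · rw [zero_add, mag_of]
      have := dL_X_mul j i 1
      rw [mul_one] at this
      rw [this]; split_ifs <;> simp
    · have : mag (d + 1) (FreeGroup.of i) = 0 := by
        rw [mag_eq_coeff_magnus, magnus, FreeGroup.lift_apply_of, map_add, PowerSeries.coeff_one,
          PowerSeries.coeff_monomial, if_neg (by omega), if_neg (by omega), add_zero]
      rw [this]; split_ifs <;> simp [Polynomial.coeff_one, hd.ne']

theorem sum_trace_ev_eq_zero {n k : ℕ} (hk : 1 ≤ k) {ι : Type} [Fintype ι] [DecidableEq ι]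
    (a : Fin n → Matrix ι ι ℤ) (ha : ∀ i, IsNilpotent (a i)) {σ : MulAut (F n)} (hσ : σ ∈ A n k) :
    ∑ i, Matrix.trace (ev a (dL i (mag (k + 1) ((FreeGroup.of i)⁻¹ * σ (FreeGroup.of i))))) = 0 := by
  obtain ⟨ρ, hρ⟩ := exists_polynomial_rep a ha
  choose Φ hΦ hΦ' using exists_fox ρ
  obtain ⟨J', hJ'⟩ := fox_mul_eq_one ρ σ Φ hΦ hΦ'
  have hu (i : Fin n) := mem_A_iff.1 hσ (FreeGroup.of i)
  have hmag (i : Fin n) (d : ℕ) (hd : d ≤ k) : mag (d + 1) (σ (FreeGroup.of i)) =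
      (if d = 0 then X i else 0) +
        mag (d + 1) ((FreeGroup.of i)⁻¹ * σ (FreeGroup.of i)) := by
    -- With u = x_i⁻¹σ(x_i), the product x_i u is rewritten as u ⁅u⁻¹, x_i⁆ x_i, because `mag_mul`
    -- requires the deep factors on the left; the commutator is too deep to contribute.
    have e : σ (FreeGroup.of i) = ((FreeGroup.of i)⁻¹ * σ (FreeGroup.of i)) *
        ⁅((FreeGroup.of i)⁻¹ * σ (FreeGroup.of i))⁻¹, FreeGroup.of i⁆ * FreeGroup.of i := by
      rw [commutatorElement_def]; group
    have hc := commutator_mem_gamma (inv_mem (hu i)) (FreeGroup.of i)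
    have h1 : mag (d + 1) (FreeGroup.of i) = if d = 0 then X i else 0 := by
      rcases Nat.eq_zero_or_pos d with rfl | hd
      · rw [zero_add, mag_of, if_pos rfl]
      · rw [mag_eq_coeff_magnus, magnus, FreeGroup.lift_apply_of, map_add, PowerSeries.coeff_one,
          PowerSeries.coeff_monomial, if_neg (by omega), if_neg (by omega), if_neg (by omega),
          add_zero]
    conv_lhs => rw [e]
    rw [mag_mul, mag_mul, mag_eq_zero hc (by omega), h1, add_zero, add_comm]
    · exact gamma_le (by omega) (hu i)
    · exact mul_mem (gamma_le (by omega) (hu i)) (gamma_le (by omega) hc)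
  have hcoeff (j i : Fin n) (d : ℕ) := coeff_fox a ρ hρ j (Φ j) (hΦ j) (hΦ' j) (σ (FreeGroup.of i)) d
  have h := trace_coeff_eq_zero hk _ J' hJ' (fun i j => ?_) (fun i j d h0 hd => ?_)
  · rw [← h]
    refine Finset.sum_congr rfl fun i _ => ?_
    rw [Matrix.of_apply, hcoeff, hmag i k le_rfl, if_neg (by omega), zero_add]
  · rw [Matrix.of_apply, hcoeff, hmag j 0 (by omega), if_pos rfl, mag_eq_zero (hu j) (by omega),
      add_zero]
    have := dL_X_mul i j 1
    rw [mul_one] at this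
    rw [this]
    by_cases hij : i = j
    · rw [if_pos hij, if_pos hij.symm, map_one]
    · rw [if_neg hij, if_neg (Ne.symm hij), map_zero]
  · rw [Matrix.of_apply, hcoeff, hmag j d (by omega), if_neg (by omega),
      mag_eq_zero (hu j) (by omega), add_zero, map_zero, map_zero]

/-! ### Cyclic words -/

/-- The projection `H^{⊗ k} → 𝓒̄_n(k)`. -/
def qC (n k : ℕ) : (⨂[ℤ]^k (H n)) →ₗ[ℤ] CBar n k := (powers n k).mkQ ∘ₗ (cyclicRel n k).mkQ

theorem qC_surjective (n k : ℕ) : Function.Surjective (qC n k) :=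
  ((powers n k).mkQ_surjective).comp ((cyclicRel n k).mkQ_surjective)

theorem qC_rot {n k : ℕ} (a : Fin k → Fin n) : qC n k (tw fun i => a (finRotate k i)) = qC n k (tw a) := by
  refine congrArg (powers n k).mkQ ?_
  rw [eq_comm]
  refine (Submodule.Quotient.eq _).2 ?_
  exact Submodule.subset_span ⟨fun i => x (a i), rfl⟩

theorem qC_const {n k : ℕ} (i : Fin n) : qC n k (tw fun _ => i) = 0 :=
  (Submodule.Quotient.mk_eq_zero _).2 (Submodule.subset_span ⟨i, rfl⟩)

theorem exists_lift_qC {n k : ℕ} {M : Type*} [AddCommGroup M] (f : (⨂[ℤ]^k (H n)) →ₗ[ℤ] M)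
    (hrot : ∀ a : Fin k → Fin n, f (tw fun i => a (finRotate k i)) = f (tw a))
    (hconst : ∀ i : Fin n, f (tw fun _ => i) = 0) :
    ∃ g : CBar n k →ₗ[ℤ] M, ∀ y, g (qC n k y) = f y := by
  have h1 : cyclicRel n k ≤ LinearMap.ker f := by
    refine Submodule.span_le.2 ?_
    rintro _ ⟨a, rfl⟩
    rw [SetLike.mem_coe, LinearMap.mem_ker, map_sub, sub_eq_zero]
    -- The relations range over arbitrary tensors; by multilinearity invariance has to be checked
    -- only on words.
    have e : f.compMultilinearMap (PiTensorProduct.tprod ℤ) =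
        (f.compMultilinearMap (PiTensorProduct.tprod ℤ (s := fun _ : Fin k => H n))).domDomCongr
          (finRotate k) := by
      refine Module.Basis.ext_multilinear (fun _ => FreeAbelianGroup.basis (Fin n)) fun v => ?_
      simp only [basis_eq_x]
      exact (hrot v).symm
    exact congrArg (fun m => m a) e
  have h2 : powers n k ≤ LinearMap.ker ((cyclicRel n k).liftQ f h1) := by
    refine Submodule.span_le.2 ?_
    rintro _ ⟨i, rfl⟩
    exact hconst i
  exact ⟨(powers n k).liftQ _ h2, fun y => rfl⟩

theorem qC_tw_add {n K : ℕ} (a : Fin (K + 1) → Fin n) (s : Fin (K + 1)) :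
    qC n (K + 1) (tw fun r => a (s + r)) = qC n (K + 1) (tw a) := by
  obtain ⟨m, hm⟩ := s
  induction m with
  | zero => simp
  | succ m ih =>
    have e := qC_rot (fun r => a (⟨m, by omega⟩ + r))
    rw [ih (by omega)] at e
    rw [← e]
    congr 2
    ext r
    rw [finRotate_apply]
    congr 2
    have : (⟨m + 1, hm⟩ : Fin (K + 1)) = ⟨m, by omega⟩ + 1 := by
      ext; rw [Fin.val_add, Fin.val_one']
      simp [Nat.mod_eq_of_lt hm]
    rw [this, add_assoc, add_comm 1 r]

/-- 𝓒̄ is torsion-free: the map `g` to the free group on rotation classes, which sends constant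
words to 0, has the left inverse `b`. -/
theorem eq_zero_of_smul_eq_zero {n K : ℕ} {m : ℤ} (hm : m ≠ 0) {c : CBar n (K + 1)}
    (h : m • c = 0) : c = 0 := by
  classical
  let R : Setoid (Fin (K + 1) → Fin n) :=
    { r := fun a b => ∃ s, b = fun r => a (s + r)
      iseqv := ⟨fun a => ⟨0, by simp⟩, by
        rintro a _ ⟨s, rfl⟩; exact ⟨-s, by simp⟩, by
        rintro a _ _ ⟨s, rfl⟩ ⟨t, rfl⟩; exact ⟨s + t, by simp [add_assoc]⟩⟩ }
  set f : (⨂[ℤ]^(K + 1) (H n)) →ₗ[ℤ] (Quotient R →₀ ℤ) := (wordBasis n (K + 1)).constr ℤ fun a =>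
    if ∃ i, a = fun _ => i then 0 else Finsupp.single (Quotient.mk R a) 1 with hf
  have ftw (a : Fin (K + 1) → Fin n) : f (tw a) =
      if ∃ i, a = fun _ => i then 0 else Finsupp.single (Quotient.mk R a) 1 := by
    rw [hf, ← wordBasis_apply, Module.Basis.constr_basis]
  have hrot (a : Fin (K + 1) → Fin n) : f (tw fun i => a (finRotate (K + 1) i)) = f (tw a) := by
    rw [ftw, ftw]
    have h1 : (fun i => a (finRotate (K + 1) i)) = fun r => a (1 + r) := by
      ext r; rw [finRotate_apply, add_comm]
    have h2 : (Quotient.mk R fun i => a (finRotate (K + 1) i)) = Quotient.mk R a :=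
      Quotient.sound (R.symm ⟨1, h1⟩)
    rw [h2]
    refine if_congr ⟨?_, ?_⟩ rfl rfl
    · rintro ⟨i, hi⟩
      refine ⟨i, funext fun r => ?_⟩
      have := congrFun hi ((finRotate (K + 1)).symm r)
      simpa using this
    · rintro ⟨i, rfl⟩; exact ⟨i, rfl⟩
  obtain ⟨g, hg⟩ := exists_lift_qC f hrot (fun i => by rw [ftw, if_pos ⟨i, rfl⟩])
  set b : (Quotient R →₀ ℤ) →ₗ[ℤ] CBar n (K + 1) := Finsupp.linearCombination ℤ
    (Quotient.lift (fun a => qC n (K + 1) (tw a))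
      (by rintro a _ ⟨s, rfl⟩; exact (qC_tw_add a s).symm)) with hb
  have hbg : b ∘ₗ g ∘ₗ qC n (K + 1) = qC n (K + 1) := by
    refine (wordBasis n (K + 1)).ext fun a => ?_
    rw [wordBasis_apply, LinearMap.comp_apply, LinearMap.comp_apply, hg, ftw]
    split_ifs with hc
    · obtain ⟨i, rfl⟩ := hc
      rw [qC_const, map_zero]
    · rw [hb, Finsupp.linearCombination_single, one_smul]; rfl
  have hg0 : g c = 0 := by
    have := congrArg g h
    rw [map_smul, map_zero] at this
    exact (smul_eq_zero.1 this).resolve_left hm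
  obtain ⟨y, rfl⟩ := qC_surjective n (K + 1) c
  rw [← LinearMap.congr_fun hbg y, LinearMap.comp_apply, LinearMap.comp_apply, hg0, map_zero]

/-! ### Vanishing of the trace on the image of the Johnson homomorphism -/

/-- The letters read along a cyclic word. -/
def path {n K : ℕ} (w : Fin (K + 1) → Fin n) : ℕ → Fin (K + 1) → List (Fin n)
  | 0, _ => []
  | r + 1, s => w s :: path w r (s + 1)

theorem path_eq_ofFn {n K : ℕ} (w : Fin (K + 1) → Fin n) (r : ℕ) (s : Fin (K + 1)) :
    path w r s = List.ofFn fun t : Fin r => w (s + (t : ℕ) • 1) := by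
  induction r generalizing s with
  | zero => rfl
  | succ r ih =>
    rw [path, ih, List.ofFn_succ]
    simp [add_assoc, succ_nsmul']

theorem nsmul_one_val {K : ℕ} (t : Fin (K + 1)) : (t : ℕ) • (1 : Fin (K + 1)) = t := by
  obtain ⟨m, hm⟩ := t
  induction m with
  | zero => simp
  | succ m ih =>
    have h := ih (by omega)
    simp only at h ⊢
    rw [succ_nsmul, h]
    ext
    rw [Fin.val_add, Fin.val_one']
    simp [Nat.mod_eq_of_lt hm]

theorem path_full {n K : ℕ} (w : Fin (K + 1) → Fin n) (s : Fin (K + 1)) :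
    path w (K + 1) s = List.ofFn fun t : Fin (K + 1) => w (s + t) := by
  rw [path_eq_ofFn]; simp only [nsmul_one_val]

/-- The matrices detecting the cyclic word `w`. -/
def cycMat {n K : ℕ} (w : Fin (K + 1) → Fin n) (i : Fin n) : Matrix (Fin (K + 1)) (Fin (K + 1)) ℤ :=
  Matrix.of fun s s' => if w s = i ∧ s' = s + 1 then 1 else 0

/-- The matrices are the letters of a directed cycle whose edge s → s + 1 is labelled w(s). A
product of letters has a nonzero entry exactly where the word can be read along the cycle. -/
theorem ev_cycMat_Wd {n K : ℕ} (w : Fin (K + 1) → Fin n) (l : List (Fin n)) (s s' : Fin (K + 1)) :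
    ev (cycMat w) (Wd l) s s' =
      if path w l.length s = l ∧ s' = s + l.length • 1 then 1 else 0 := by
  induction l generalizing s with
  | nil => simp [path, Matrix.one_apply, eq_comm]
  | cons i l ih =>
    rw [Wd_cons, map_mul, ev_X, Matrix.mul_apply, Finset.sum_eq_single (s + 1)]
    · rw [ih]
      simp only [cycMat, Matrix.of_apply, List.length_cons, path, List.cons.injEq]
      rw [ite_mul, one_mul, zero_mul, ← ite_and]
      refine if_congr ?_ rfl rfl
      rw [add_assoc s, succ_nsmul']
      tauto
    · intro t _ ht
      simp [cycMat, ht]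
    · simp

/-- The word i^{K+1} can be read once around the cycle only if every label is i. -/
theorem cycMat_nilpotent {n K : ℕ} (w : Fin (K + 1) → Fin n) (hw : ¬ ∃ i, w = fun _ => i)
    (i : Fin n) : IsNilpotent (cycMat w i) := by
  refine ⟨K + 1, ?_⟩
  have e : cycMat w i ^ (K + 1) = ev (cycMat w) (Wd (List.replicate (K + 1) i)) := by
    rw [Wd, List.map_replicate, List.prod_replicate, map_pow, ev_X]
  rw [e]
  ext s s'
  rw [ev_cycMat_Wd, if_neg]; · rfl
  rintro ⟨h, -⟩
  rw [List.length_replicate, path_full, ← List.ofFn_const, List.ofFn_inj] at h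
  refine hw ⟨i, funext fun r => ?_⟩
  have := congrFun h (r - s)
  simpa using this

theorem trace_ev_cycMat {n K : ℕ} (w : Fin (K + 1) → Fin n) {z : TensorAlgebra ℤ (H n)}
    (hz : z ∈ homog n (K + 1)) : Matrix.trace (ev (cycMat w) z) =
      ∑ s, (wordBasis n (K + 1)).coord (fun t => w (s + t)) (component n (K + 1) z) := by
  induction hz using Submodule.span_induction with
  | mem v hv =>
    obtain ⟨l, hl, rfl⟩ := hv
    rw [Matrix.trace]
    refine Finset.sum_congr rfl fun s _ => ?_
    have hl' : l.length = K + 1 := hl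
    rw [Matrix.diag_apply, ev_cycMat_Wd, ← co_ofFn, co_Wd, hl', path_full]
    refine if_congr ?_ rfl rfl
    have h0 : (K + 1) • (1 : Fin (K + 1)) = 0 := by
      have := card_nsmul_eq_zero' (x := (1 : Fin (K + 1)))
      rwa [Nat.card_fin] at this
    rw [h0, add_zero, eq_self_iff_true, and_true, eq_comm]
  | zero => simp
  | add x y _ _ hx hy => simp only [map_add, Matrix.trace_add, hx, hy, Finset.sum_add_distrib]
  | smul c x _ hx => simp only [map_smul, Matrix.trace_smul, hx, Finset.smul_sum]

theorem Phi_eq_sum {n k : ℕ} {f : H n →ₗ[ℤ] L n (k + 1)} {u : Fin n → F n}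
    (hu : ∀ i, u i ∈ gamma n (k + 1)) (hf : ∀ i, f (x i) = cls (k + 1) (u i)) :
    Phi n k f = ∑ i, component n k (dL i (mag (k + 1) (u i))) := by
  rw [Phi, LinearMap.sum_apply]
  refine Finset.sum_congr rfl fun i _ => ?_
  rw [LinearMap.comp_apply, LinearMap.comp_apply, LinearMap.applyₗ_apply_apply, hf,
    iota_cls (hu i), contract_component]

/-- The determinant argument, applied to the cycle of each nonconstant word w, shows that the
coefficients of Φ(τ) over the K + 1 rotations of w add up to zero. -/
theorem qC_Phi_tau {n k : ℕ} (hk : 1 ≤ k) (g : gr n k) : qC n k (Phi n k (tau n k g)) = 0 := by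
  classical
  obtain ⟨K, rfl⟩ : ∃ K, k = K + 1 := ⟨k - 1, by omega⟩
  induction g using gr.ind with | _ σ
  set u : Fin n → F n := fun i => (FreeGroup.of i)⁻¹ * (σ : MulAut (F n)) (FreeGroup.of i) with hu
  have hu' (i : Fin n) : u i ∈ gamma n (K + 1 + 1) := mem_A_iff.1 σ.2.2 _
  have e := Phi_eq_sum hu' (f := tau n (K + 1) (gr.mk σ)) (fun i => by
    rw [cls_of_mem (hu' i)]; exact tau_mk_apply σ (FreeGroup.of i))
  set y := Phi n (K + 1) (tau n (K + 1) (gr.mk σ))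
  have key (w : Fin (K + 1) → Fin n) (hw : ¬ ∃ i, w = fun _ => i) :
      ∑ s, (wordBasis n (K + 1)).coord (fun t => w (s + t)) y = 0 := by
    have h := sum_trace_ev_eq_zero hk (cycMat w) (cycMat_nilpotent w hw) σ.2.2
    rw [← h, e]
    simp only [map_sum]
    rw [Finset.sum_comm]
    refine Finset.sum_congr rfl fun i _ => ?_
    rw [trace_ev_cycMat w (dL_mem_homog i (mag_mem_homog _))]
  -- The trace element is summed K + 1 times, once per rotation, so that every word w appears with
  -- the vanishing sum over its rotations. This treats periodic words uniformly, and the factor K +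
  -- 1 is removed by torsion-freeness.
  refine eq_zero_of_smul_eq_zero (m := ((K + 1 : ℕ) : ℤ)) (by omega) ?_
  have hy : ∀ s : Fin (K + 1), qC n (K + 1) y =
      ∑ w, (wordBasis n (K + 1)).coord (fun t => w (s + t)) y • qC n (K + 1) (tw w) := by
    intro s
    conv_lhs => rw [← (wordBasis n (K + 1)).sum_repr y]
    rw [map_sum]
    rw [← Equiv.sum_comp ((Equiv.addLeft s).arrowCongr (Equiv.refl (Fin n))).symm]
    refine Finset.sum_congr rfl fun w _ => ?_
    rw [map_smul, wordBasis_apply, Module.Basis.coord_apply, ← qC_tw_add w s]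
    rfl
  have hs : ((K + 1 : ℕ) : ℤ) • qC n (K + 1) y = ∑ _s : Fin (K + 1), qC n (K + 1) y := by
    rw [Finset.sum_const, Finset.card_univ, Fintype.card_fin, natCast_zsmul]
  rw [hs, Finset.sum_congr rfl (fun s _ => hy s), Finset.sum_comm]
  refine Finset.sum_eq_zero fun w _ => ?_
  rw [← Finset.sum_smul]
  by_cases hw : ∃ i, w = fun _ => i
  · obtain ⟨i, rfl⟩ := hw
    rw [qC_const, smul_zero]
  · rw [key w hw, zero_smul]

/-! ### Partial conjugations and their commutators -/

/-- The endomorphism `x_i ↦ w x_i w⁻¹` fixing the other generators. -/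
def pconjHom {n : ℕ} (i : Fin n) (w : F n) : F n →* F n :=
  FreeGroup.lift fun j => if j = i then w * FreeGroup.of i * w⁻¹ else FreeGroup.of j

theorem pconjHom_self {n : ℕ} (i : Fin n) (w : F n) :
    pconjHom i w (FreeGroup.of i) = w * FreeGroup.of i * w⁻¹ := by
  rw [pconjHom, FreeGroup.lift_apply_of, if_pos rfl]

theorem pconjHom_of_ne {n : ℕ} {i j : Fin n} (w : F n) (h : j ≠ i) :
    pconjHom i w (FreeGroup.of j) = FreeGroup.of j := by
  rw [pconjHom, FreeGroup.lift_apply_of, if_neg h]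

/-- The subgroup generated by all `x_j` with `j ≠ i`. -/
def avoid {n : ℕ} (i : Fin n) : Subgroup (F n) :=
  Subgroup.closure (FreeGroup.of '' {j | j ≠ i})

theorem pconjHom_of_avoid {n : ℕ} {i : Fin n} (w : F n) {g : F n} (hg : g ∈ avoid i) :
    pconjHom i w g = g := by
  have h : avoid i ≤ (pconjHom i w).eqLocus (MonoidHom.id _) := by
    rw [avoid, Subgroup.closure_le]
    rintro _ ⟨j, hj, rfl⟩
    exact pconjHom_of_ne w hj
  exact h hg

theorem lnc_mem_avoid {n : ℕ} {i a : Fin n} {l : List (Fin n)} (h : i ∉ a :: l) :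
    lnc (FreeGroup.of a) l ∈ avoid i := by
  have of_mem {b : Fin n} (hb : i ≠ b) : FreeGroup.of b ∈ avoid i :=
    Subgroup.subset_closure ⟨b, hb.symm, rfl⟩
  rw [List.mem_cons, not_or] at h
  have main (l : List (Fin n)) : ∀ g ∈ avoid i, i ∉ l → lnc g l ∈ avoid i := by
    induction l with
    | nil => exact fun g hg _ => hg
    | cons b l ih =>
      intro g hg hl
      rw [List.mem_cons, not_or] at hl
      refine ih _ ?_ hl.2
      change ⁅g, FreeGroup.of b⁆ ∈ avoid i
      rw [commutatorElement_def]
      exact mul_mem (mul_mem (mul_mem hg (of_mem hl.1)) (inv_mem hg)) (inv_mem (of_mem hl.1))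
  exact main l _ (of_mem h.1) h.2

theorem pconjHom_comp {n : ℕ} {i : Fin n} {w v : F n} (hv : v ∈ avoid i) (h : v * w = 1) :
    (pconjHom i w).comp (pconjHom i v) = MonoidHom.id _ := by
  ext j
  rw [MonoidHom.comp_apply]
  by_cases hj : j = i
  · subst hj
    rw [pconjHom_self, map_mul, map_mul, map_inv, pconjHom_self, pconjHom_of_avoid _ hv]
    have : w = v⁻¹ := (inv_eq_of_mul_eq_one_right h).symm
    rw [this, MonoidHom.id_apply]; group
  · rw [pconjHom_of_ne _ hj, pconjHom_of_ne _ hj]; rfl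

/-- The automorphism `x_i ↦ w x_i w⁻¹` fixing the other generators, where `w` does not
involve `x_i`. -/
def pconj {n : ℕ} (i : Fin n) (w : F n) (hw : w ∈ avoid i) : MulAut (F n) :=
  MonoidHom.toMulEquiv (pconjHom i w) (pconjHom i w⁻¹)
    (pconjHom_comp hw (mul_inv_cancel w)) (pconjHom_comp (inv_mem hw) (inv_mul_cancel w))

theorem pconj_apply {n : ℕ} {i : Fin n} {w : F n} (hw : w ∈ avoid i) (g : F n) :
    pconj i w hw g = pconjHom i w g := rfl

theorem pconj_inv_apply {n : ℕ} {i : Fin n} {w : F n} (hw : w ∈ avoid i) (g : F n) :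
    (pconj i w hw)⁻¹ g = pconjHom i w⁻¹ g := rfl

theorem sum_D_mem_range {n k : ℕ} (hk : 1 ≤ k) (σ : MulAut (F n)) {w : Fin n → F n}
    (hw : ∀ i, w i ∈ gamma n k)
    (hσ : ∀ i, σ (FreeGroup.of i) = w i * FreeGroup.of i * (w i)⁻¹) :
    ∑ i, D i (cls k (w i)) ∈ LinearMap.range (tau n k) :=
  ⟨gr.mk ⟨σ, mem_P_of_conj hk hw hσ⟩, tau_of_conj hk ⟨σ, mem_P_of_conj hk hw hσ⟩ hw hσ⟩

/-- These are the images of the inner automorphisms, for which all conjugators coincide. -/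
theorem sum_D_mem_range_tau {n k : ℕ} (hk : 1 ≤ k) (z : L n k) :
    ∑ i, D i z ∈ LinearMap.range (tau n k) := by
  induction z using L.ind_cls with | _ g hg
  exact sum_D_mem_range hk (MulAut.conj g) (w := fun _ => g) (fun _ => hg)
    (fun i => MulAut.conj_apply _ _)

/-- If w does not involve x_i, then x_i ↦ w x_i w⁻¹ is itself an automorphism, with inverse given by
w⁻¹. -/
theorem D_mem_range_of_not_mem {n k : ℕ} (i a : Fin n) (l : List (Fin n)) (hl : l.length + 1 = k)
    (h : i ∉ a :: l) : D i (cl k a l) ∈ LinearMap.range (tau n k) := by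
  have hm := cl_mem a hl
  have := sum_D_mem_range (k := k) (by omega) (pconj i _ (lnc_mem_avoid h))
    (w := fun j => if j = i then lnc (FreeGroup.of a) l else 1) (fun j => ?_) (fun j => ?_)
  · rw [Finset.sum_eq_single i (fun j _ hj => by rw [if_neg hj]; simp) (by simp), if_pos rfl] at this
    exact this
  · split_ifs
    · exact hm
    · exact one_mem _
  · rw [pconj_apply]
    by_cases hj : j = i
    · subst hj; rw [pconjHom_self, if_pos rfl]
    · rw [pconjHom_of_ne _ hj, if_neg hj]; simp

/-- Perturbing the first entry of a left-normed commutator. -/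
theorem exists_lnc_mul {n a m : ℕ} (ha : 1 ≤ a) (l : List (Fin n)) (hm : m = a + l.length)
    {h : F n} (hh : h ∈ gamma n a) (g : F n) :
    ∃ h' ∈ gamma n m, lnc (h * g) l = h' * lnc g l ∧ cls m h' = cls m (lnc h l) := by
  induction l generalizing a h g with
  | nil => obtain rfl : m = a := by simpa using hm
           exact ⟨h, hh, rfl, rfl⟩
  | cons b l ih =>
    have hb := commutator_mem_gamma hh (FreeGroup.of b)
    have h1 : ⁅h, ⁅g, FreeGroup.of b⁆⁆ ∈ gamma n (a + 1 + 1) :=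
      commutator_mem ha (by omega) (by ring) hh
        (commutator_mem_gamma (mem_gamma_one g) (FreeGroup.of b))
    have h2 := conj_mem_gamma hb ⁅g, FreeGroup.of b⁆
    set h₁ := ⁅h, ⁅g, FreeGroup.of b⁆⁆ *
      (⁅g, FreeGroup.of b⁆ * ⁅h, FreeGroup.of b⁆ * ⁅g, FreeGroup.of b⁆⁻¹) with hh₁
    have hmem : h₁ ∈ gamma n (a + 1) := mul_mem (gamma_succ_le _ _ h1) h2
    have hcls : cls (a + 1) h₁ = cls (a + 1) ⁅h, FreeGroup.of b⁆ := by
      rw [hh₁, cls_mul (gamma_succ_le _ _ h1) h2, cls_eq_zero h1, zero_add, cls_conj hb]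
    have e : ⁅h * g, FreeGroup.of b⁆ = h₁ * ⁅g, FreeGroup.of b⁆ := by
      rw [hh₁, commutatorElement_mul_left_eq_conj_mul, commutatorElement_def h ⁅g, _⁆]; group
    have hm' : m = a + 1 + l.length := by rw [hm, List.length_cons]; ring
    obtain ⟨h', hm1, e1, e2⟩ := ih (by omega) hm' hmem ⁅g, FreeGroup.of b⁆
    refine ⟨h', hm1, by rw [lnc_cons, lnc_cons, e, e1], ?_⟩
    rw [e2, lnc_cons, ← L.lncMap_cls l hm' hmem, hcls, L.lncMap_cls l hm' hb]

/-- Take the partial conjugations of x_p by u = [x_q, x_β] and of x_q by v = [x_p, x_α]. Their group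
commutator has leading term the bracket of the two derivations: substituting [u, x_p] for x_p in v
gives [x_q, x_β, x_p, x_α], and symmetrically for u. The weights |β| + 1 and |α| + 1 of u and v add
up to k. -/
theorem rotate_mem_range {n k : ℕ} {p q : Fin n} (hpq : p ≠ q) (α β : List (Fin n))
    (hk : α.length + β.length + 2 = k) (hpα : p ∉ α) (hqα : q ∉ α) (hpβ : p ∉ β) (hqβ : q ∉ β) :
    D q (cl k q (β ++ p :: α)) - D p (cl k p (α ++ q :: β)) ∈ LinearMap.range (tau n k) := by
  set u := lnc (FreeGroup.of q) β with hu
  set v := lnc (FreeGroup.of p) α with hv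
  have hu' : u ∈ avoid p := lnc_mem_avoid (by simp [hpq, hpβ])
  have hv' : v ∈ avoid q := lnc_mem_avoid (by simp [hpq.symm, hqα])
  have hud : u ∈ gamma n (β.length + 1) := lnc_mem (mem_gamma_one _) (by omega)
  have hvd : v ∈ gamma n (α.length + 1) := lnc_mem (mem_gamma_one _) (by omega)
  set ξ := pconjHom p u with hξ
  set η := pconjHom q v with hη
  have conj_eq (a b : F n) : a * b * a⁻¹ = ⁅a, b⁆ * b := by rw [commutatorElement_def]; group
  have ξp : ξ (FreeGroup.of p) = u * FreeGroup.of p * u⁻¹ := pconjHom_self p u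
  have ξl (l : List (Fin n)) (hl : p ∉ l) (g : F n) : ξ (lnc g l) = lnc (ξ g) l :=
    map_lnc _ _ _ fun b hb => pconjHom_of_ne _ (fun h => hl (h ▸ hb))
  have ηl (l : List (Fin n)) (hl : q ∉ l) (g : F n) : η (lnc g l) = lnc (η g) l :=
    map_lnc _ _ _ fun b hb => pconjHom_of_ne _ (fun h => hl (h ▸ hb))
  have ξq : ξ (FreeGroup.of q) = FreeGroup.of q := pconjHom_of_ne _ hpq.symm
  have ηp : η (FreeGroup.of p) = FreeGroup.of p := pconjHom_of_ne _ hpq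
  have ηq : η (FreeGroup.of q) = v * FreeGroup.of q * v⁻¹ := pconjHom_self q v
  -- the image of `v`
  have hup := commutator_mem_gamma hud (FreeGroup.of p)
  obtain ⟨h2, h2m, ξv, h2c⟩ := exists_lnc_mul (m := k) (by omega) α (by omega) hup (FreeGroup.of p)
  rw [← conj_eq, ← ξp, ← ξl α hpα, ← hv] at ξv
  have ξvd : ξ v ∈ gamma n (α.length + 1) := by
    rw [ξv]; exact mul_mem (gamma_le (by omega) h2m) hvd
  have ξvc : cls (α.length + 1) (ξ v) = cls (α.length + 1) v := by
    rw [ξv, cls_mul (gamma_le (by omega) h2m) hvd, cls_eq_zero (gamma_le (by omega) h2m), zero_add]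
  -- the image of `u`
  have hvq := commutator_mem_gamma ξvd (FreeGroup.of q)
  obtain ⟨h1, h1m, ξηu, h1c⟩ := exists_lnc_mul (m := k) (by omega) β (by omega) hvq (FreeGroup.of q)
  have eu : ξ (η u) = h1 * u := by
    rw [hu, ηl β hqβ, ξl β hpβ, ηq, map_mul, map_mul, map_inv, ξq, conj_eq, ξηu]
  have h1c' : cls k h1 = cl k p (α ++ q :: β) := by
    rw [h1c, cl, lnc_append, lnc_cons, ← hv,
      ← L.lncMap_cls β (k := α.length + 1 + 1) (by omega) hvq,
      ← L.lncMap_cls β (k := α.length + 1 + 1) (by omega) (commutator_mem_gamma hvd _),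
      cls_commutator_congr (by omega) le_rfl rfl ξvd hvd (mem_gamma_one _) (mem_gamma_one _) ξvc rfl]
  have h2c' : cls k h2 = cl k q (β ++ p :: α) := by
    rw [h2c, cl, lnc_append, lnc_cons]
  -- The commutator ξηξ⁻¹η⁻¹ conjugates x_p by this element, since η fixes x_p.
  set wp := (ξ (η u))⁻¹ * u with hwp
  have hwp' : wp = u⁻¹ * h1⁻¹ * u⁻¹⁻¹ := by rw [hwp, eu]; group
  have wpm : wp ∈ gamma n k := by rw [hwp']; exact conj_mem_gamma (inv_mem h1m) _
  have wpc : cls k wp = - cl k p (α ++ q :: β) := by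
    rw [hwp', cls_conj (inv_mem h1m), cls_inv h1m, h1c']
  -- the second conjugator
  have hwpp := commutator_mem_gamma wpm (FreeGroup.of p)
  obtain ⟨h3, h3m, e3, -⟩ := exists_lnc_mul (m := k + 1 + α.length) (by omega) α rfl hwpp
    (FreeGroup.of p)
  -- `y` is v carried along by ξ⁻¹ and then η. Applying ξ brings it back to v up to `h3`, of weight
  -- above k, so the conjugator of x_q has the class of ξ(v) v⁻¹.
  set y := η (pconjHom p u⁻¹ v) with hy
  have ey : ξ y = h3 * v := by
    have a1 : pconjHom p u⁻¹ v = lnc (u⁻¹ * FreeGroup.of p * u⁻¹⁻¹) α := by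
      rw [hv, map_lnc (pconjHom p u⁻¹) _ _
        (fun b hb => pconjHom_of_ne _ (by rintro rfl; exact hpα hb)), pconjHom_self]
    rw [hy, a1, ηl α hqα, ξl α hpα, ← e3, ← conj_eq]
    simp only [map_mul, map_inv, ηp, ξp, hwp]
    congr 1; group
  set wq := ξ (y⁻¹ * v) with hwq
  have hwq' : wq = v⁻¹ * (h3⁻¹ * h2) * v⁻¹⁻¹ := by
    rw [hwq, map_mul, map_inv, ey, ξv]; group
  have h3k : h3 ∈ gamma n (k + 1) := gamma_le (by omega) h3m
  have h32 : h3⁻¹ * h2 ∈ gamma n k := mul_mem (gamma_succ_le _ _ (inv_mem h3k)) h2m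
  have wqm : wq ∈ gamma n k := by rw [hwq']; exact conj_mem_gamma h32 _
  have wqc : cls k wq = cl k q (β ++ p :: α) := by
    rw [hwq', cls_conj h32, cls_mul (gamma_succ_le _ _ (inv_mem h3k)) h2m,
      cls_eq_zero (inv_mem h3k), zero_add, h2c']
  have main := sum_D_mem_range (k := k) (by omega)
    (pconj p u hu' * pconj q v hv' * (pconj p u hu')⁻¹ * (pconj q v hv')⁻¹)
    (w := fun j => if j = p then wp else if j = q then wq else 1) (fun j => ?_) (fun j => ?_)
  · rw [Finset.sum_eq_add_of_mem p q (Finset.mem_univ _) (Finset.mem_univ _) hpq] at main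
    · rw [if_pos rfl, if_neg hpq.symm, if_pos rfl, wpc, wqc, map_neg] at main
      rwa [sub_eq_neg_add]
    · rintro c - ⟨hc1, hc2⟩
      rw [if_neg hc1, if_neg hc2]; simp
  · split_ifs
    exacts [wpm, wqm, one_mem _]
  · simp only [MulAut.mul_apply, pconj_apply, pconj_inv_apply]
    by_cases hjp : j = p
    · subst hjp
      rw [if_pos rfl, pconjHom_of_ne _ hpq, pconjHom_self]
      simp only [map_mul, map_inv, ← hη, ← hξ, ηp, ξp, hwp]
      group
    · rw [if_neg hjp]
      by_cases hjq : j = q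
      · subst hjq
        rw [if_pos rfl, pconjHom_self]
        simp only [map_mul, map_inv]
        rw [pconjHom_of_ne u⁻¹ hjp, ← hη, ← hy, ηq, ← hξ, hwq]
        simp only [map_mul, map_inv, ξq]
        group
      · rw [if_neg hjq, pconjHom_of_ne _ hjq, pconjHom_of_ne _ hjp, pconjHom_of_ne _ hjq,
          pconjHom_of_ne _ hjp]
        simp

/-! ### Traces of words -/

/-- The projection of the tensor algebra to `𝓒̄_n(k)`. -/
def tr (n k : ℕ) : TensorAlgebra ℤ (H n) →ₗ[ℤ] CBar n k := qC n k ∘ₗ component n k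

theorem tr_Wd_ofFn {n k : ℕ} (a : Fin k → Fin n) : tr n k (Wd (List.ofFn a)) = qC n k (tw a) := by
  rw [tr, LinearMap.comp_apply, component_Wd_ofFn]

theorem tr_Wd_of_ne {n k : ℕ} {l : List (Fin n)} (h : l.length ≠ k) : tr n k (Wd l) = 0 := by
  rw [tr, LinearMap.comp_apply, component_Wd_of_ne h, map_zero]

theorem ofFn_rotate_one {α : Type*} {k : ℕ} (a : Fin k → α) :
    List.ofFn (fun i => a (finRotate k i)) = (List.ofFn a).rotate 1 := by
  cases k with
  | zero => simp
  | succ k =>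
    rw [List.ofFn_succ', List.ofFn_succ (f := a), List.rotate_cons_succ, List.rotate_zero,
      List.concat_eq_append, finRotate_last]
    congr 2
    ext i
    rw [finRotate_of_lt (by simp)]
    rfl

theorem tr_rotate {n k : ℕ} (l : List (Fin n)) (m : ℕ) :
    tr n k (Wd (l.rotate m)) = tr n k (Wd l) := by
  induction m with
  | zero => rw [List.rotate_zero]
  | succ m ih =>
    rw [← ih, ← List.rotate_rotate]
    generalize l.rotate m = l
    by_cases h : l.length = k
    · obtain ⟨a, rfl⟩ : ∃ a : Fin k → Fin n, l = List.ofFn a := by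
        subst h; exact ⟨l.get, by simp⟩
      rw [← ofFn_rotate_one, tr_Wd_ofFn, tr_Wd_ofFn, qC_rot]
    · rw [tr_Wd_of_ne h, tr_Wd_of_ne (by rwa [List.length_rotate])]

theorem tr_isRotated {n k : ℕ} {l l' : List (Fin n)} (h : l ~r l') :
    tr n k (Wd l) = tr n k (Wd l') := by
  obtain ⟨m, rfl⟩ := h
  rw [tr_rotate]

theorem tr_mul_X {n k : ℕ} (z : TensorAlgebra ℤ (H n)) (b : Fin n) :
    tr n k (z * X b) = tr n k (X b * z) := by
  have e : tr n k ∘ₗ LinearMap.mulRight ℤ (X b) = tr n k ∘ₗ LinearMap.mulLeft ℤ (X b) :=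
    hom_ext_Wd fun l => by
      rw [LinearMap.comp_apply, LinearMap.comp_apply, LinearMap.mulRight_apply,
        LinearMap.mulLeft_apply, ← Wd_cons, ← Wd_concat]
      exact (tr_isRotated (List.IsRotated.cons_append_singleton)).symm
  exact LinearMap.congr_fun e z

theorem tr_lp {n k : ℕ} (z : TensorAlgebra ℤ (H n)) {l : List (Fin n)} (hl : l ≠ []) :
    tr n k (lp z l) = 0 := by
  induction l using List.reverseRecOn with
  | nil => exact absurd rfl hl
  | append_singleton l b _ => rw [lp_concat, map_sub, tr_mul_X, sub_self]

theorem algebraMapInv_lp_X {n : ℕ} (i : Fin n) (l : List (Fin n)) :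
    TensorAlgebra.algebraMapInv (lp (X i) l) = 0 := by
  have hX (j : Fin n) : TensorAlgebra.algebraMapInv (X j) = 0 :=
    algebraMapInv_of_mem_homog (d := 0) (by simpa [Wd] using Wd_mem_homog [j])
  induction l using List.reverseRecOn with
  | nil => exact hX i
  | append_singleton l c _ =>
    rw [lp_concat, map_sub, map_mul, map_mul, hX, mul_zero, zero_mul, sub_zero]

/-- Among the words of the expanded bracket only x_i x_l begins with x_i. -/
theorem dL_lp_self {n : ℕ} {i : Fin n} {l : List (Fin n)} (h : i ∉ l) :
    dL i (lp (X i) l) = Wd l := by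
  induction l using List.reverseRecOn with
  | nil =>
    have := dL_X_mul i i (1 : TensorAlgebra ℤ (H n))
    simpa [lp_nil, Wd_nil] using this
  | append_singleton l b ih =>
    rw [List.mem_append, not_or] at h
    have hb : i ≠ b := by simpa using h.2
    rw [lp_concat, map_sub, dL_mul, dL_X_mul, if_neg hb.symm, ih h.1, algebraMapInv_lp_X, zero_smul, add_zero,
      sub_zero, Wd_concat]

/-- With w the bracket [x_a, x_l], ∂_i(w x_i − x_i w) = ∂_i(w) x_i − w. As `l` is nonempty, w is a
commutator and has zero cyclic trace. -/
theorem qC_Phi_D {n k : ℕ} (i a : Fin n) {l : List (Fin n)} (hl : l.length + 1 = k) (hl' : l ≠ []) :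
    qC n k (Phi n k (D i (cl k a l))) = tr n k (dL i (lp (X a) l) * X i) := by
  classical
  have hm : lnc (FreeGroup.of a) (l ++ [i]) ∈ gamma n (k + 1) :=
    cl_mem a (l := l ++ [i]) (by simp [hl])
  rw [Phi_eq_sum (u := fun j => if j = i then lnc (FreeGroup.of a) (l ++ [i]) else 1)
    (fun j => by split_ifs; exacts [hm, one_mem _]) (fun j => ?_)]
  · rw [Finset.sum_eq_single i (fun j _ hj => by
      rw [if_neg hj, mag_eq_zero (one_mem (gamma n (k + 1 + 1))) (by omega)]; simp) (by simp),
      if_pos rfl, mag_lnc (k := 1) (mem_gamma_one _) (by simp; omega), mag_of, lp_concat, map_sub,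
      dL_mul, dL_X_mul, if_pos rfl, algebraMapInv_lp_X, zero_smul, add_zero]
    change tr n k _ = _
    rw [map_sub, tr_lp _ hl', sub_zero]
  · rw [D_x, cl, L.ad_cls _ (cl_mem a hl), ← lnc_concat]
    split_ifs
    · rfl
    · rw [cls_one]

/-! ### The kernel of the trace -/

theorem eq_of_isRotated_cons {α : Type*} {p : α} {r s : List α} (h : (p :: r) ~r (p :: s))
    (hp : p ∉ r) : r = s := by
  obtain ⟨m, hm, e⟩ := List.isRotated_iff_mod.1 h
  rw [List.rotate_eq_drop_append_take hm] at e
  rcases m with _ | m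
  · simpa using e
  · rw [List.drop_succ_cons, List.take_succ_cons] at e
    rcases h : r.drop m with _ | ⟨c, t⟩
    · have hl : r.length ≤ m := by simpa using h
      rw [h, List.take_of_length_le hl] at e
      simpa using e
    · rw [h, List.cons_append, List.cons.injEq] at e
      have hc : c ∈ r.drop m := by rw [h]; exact List.mem_cons_self
      exact absurd (e.1 ▸ List.mem_of_mem_drop hc) hp

/-- The class of `D_p [x_p, x_r]` modulo the image of the Johnson homomorphism. -/
def dd (n k : ℕ) (p : Fin n) (r : List (Fin n)) :
    (H n →ₗ[ℤ] L n (k + 1)) ⧸ LinearMap.range (tau n k) :=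
  (LinearMap.range (tau n k)).mkQ (D p (cl k p r))

theorem dd_rotate {n k : ℕ} {p q : Fin n} (hpq : p ≠ q) (α β : List (Fin n))
    (hk : α.length + β.length + 2 = k) (hp : p ∉ α ++ q :: β) (hq : q ∉ β ++ p :: α) :
    dd n k q (β ++ p :: α) = dd n k p (α ++ q :: β) := by
  simp only [List.mem_append, List.mem_cons, not_or] at hp hq
  exact (Submodule.Quotient.eq _).2 (rotate_mem_range hpq α β hk hp.1 hq.2.2 hp.2.2 hq.1)

open Classical in
/-- The value on a cyclic word of the inverse of the trace. -/
def cycVal (n k : ℕ) (c : Cycle (Fin n)) :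
    (H n →ₗ[ℤ] L n (k + 1)) ⧸ LinearMap.range (tau n k) :=
  if h : ∃ x : Fin n × List (Fin n), c = ↑(x.1 :: x.2) ∧ x.1 ∉ x.2 then
    dd n k h.choose.1 h.choose.2
  else if h : ∃ x : Fin n × Fin n, x.1 ≠ x.2 ∧ c = ↑[x.1, x.1, x.2, x.2] then
    - dd n k h.choose.1 [h.choose.2, h.choose.1, h.choose.2]
  else 0

/-- Independence of the chosen letter: if p and q both occur once, the cyclic word is p α q β, and
`dd_rotate` identifies the two classes. -/
theorem cycVal_single {n k : ℕ} {p : Fin n} {r : List (Fin n)} (hr : r.length + 1 = k)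
    (hp : p ∉ r) : cycVal n k ↑(p :: r) = dd n k p r := by
  have h : ∃ x : Fin n × List (Fin n), ((p :: r : List (Fin n)) : Cycle (Fin n)) = ↑(x.1 :: x.2) ∧
    x.1 ∉ x.2 := ⟨(p, r), rfl, hp⟩
  rw [cycVal, dif_pos h]
  obtain ⟨h1, h2⟩ := h.choose_spec
  rw [Cycle.coe_eq_coe] at h1
  generalize h.choose = x at h1 h2
  obtain ⟨q, s⟩ := x
  dsimp only at h1 h2 ⊢
  by_cases hpq : p = q
  · subst hpq
    rw [eq_of_isRotated_cons h1 hp]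
  · have hq : q ∈ r := by
      have := h1.mem_iff.2 (List.mem_cons_self (a := q))
      simpa [Ne.symm hpq] using this
    obtain ⟨α, β, rfl⟩ := List.append_of_mem hq
    have h3 : (p :: (α ++ q :: β)) ~r (q :: (β ++ p :: α)) :=
      List.isRotated_append (l := p :: α) (l' := q :: β)
    have h4 := eq_of_isRotated_cons (h1.symm.trans h3) h2
    subst h4
    exact dd_rotate hpq α β (by simp at hr; omega) hp h2

theorem isRotated_double {α : Type*} {i j : α} {l : List α} (h : [i, i, j, j] ~r l) :
    l = [i, i, j, j] ∨ l = [i, j, j, i] ∨ l = [j, j, i, i] ∨ l = [j, i, i, j] := by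
  obtain ⟨m, hm, rfl⟩ := List.isRotated_iff_mod.1 h
  simp only [List.length_cons, List.length_nil] at hm
  interval_cases m <;> simp [List.rotate]

theorem isRotated_alternating {α : Type*} {i j : α} {l : List α} (h : [i, j, i, j] ~r l) :
    l = [i, j, i, j] ∨ l = [j, i, j, i] := by
  obtain ⟨m, hm, rfl⟩ := List.isRotated_iff_mod.1 h
  simp only [List.length_cons, List.length_nil] at hm
  interval_cases m <;> simp [List.rotate]

/-- The difference of the two sides is [[x_i, x_j], [x_i, x_j]] = 0. -/
theorem cl_double_eq {n : ℕ} (i j : Fin n) : cl 4 i [j, j, i] = cl 4 i [j, i, j] := by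
  have h := dbl_eq i j i j
  rw [dbl, commutatorElement_self, cls_one] at h
  exact (sub_eq_zero.1 h.symm).symm

theorem cl_double_swap {n : ℕ} (i j : Fin n) : cl 4 j [i, j, i] = - cl 4 i [j, i, j] := by
  rw [cl_swap (k := 4) i j [j, i] rfl, cl_double_eq]

/-- The inner derivation of w = [x_i, x_j, x_i, x_j] is ∑_p D_p(w). The terms with p ≠ i, j come
from partial conjugations, so D_i(w) + D_j(w) lies in the image, while [x_j, x_i, x_j, x_i] = −w. -/
theorem dd_double_swap {n : ℕ} {i j : Fin n} (h : i ≠ j) :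
    dd n 4 j [i, j, i] = dd n 4 i [j, i, j] := by
  have h1 := sum_D_mem_range_tau (k := 4) (by omega) (cl 4 i [j, i, j])
  rw [← Finset.add_sum_erase _ _ (Finset.mem_univ i),
    ← Finset.add_sum_erase _ _ (Finset.mem_erase.2 ⟨h.symm, Finset.mem_univ j⟩), ← add_assoc] at h1
  have h2 : ∑ p ∈ (Finset.univ.erase i).erase j, D p (cl 4 i [j, i, j]) ∈
      LinearMap.range (tau n 4) := by
    refine sum_mem fun p hp => D_mem_range_of_not_mem p i _ rfl ?_
    simp only [Finset.mem_erase] at hp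
    simp [hp.1, hp.2.1]
  have h3 := (Submodule.add_mem_iff_left _ h2).1 h1
  refine (Submodule.Quotient.eq _).2 ?_
  rw [cl_double_swap, map_neg, ← neg_add', neg_mem_iff]
  exact (add_comm _ _).subst (motive := (· ∈ LinearMap.range (tau n 4))) h3

theorem cycVal_double {n : ℕ} {i j : Fin n} (hij : i ≠ j) :
    cycVal n 4 ↑[i, i, j, j] = - dd n 4 i [j, i, j] := by
  have h0 : ¬ ∃ x : Fin n × List (Fin n), (([i, i, j, j] : List (Fin n)) : Cycle (Fin n)) =
      ↑(x.1 :: x.2) ∧ x.1 ∉ x.2 := by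
    rintro ⟨⟨p, r⟩, h1, h2⟩
    rw [Cycle.coe_eq_coe] at h1
    rcases isRotated_double h1 with h | h | h | h <;>
    · simp only [List.cons.injEq] at h
      obtain ⟨rfl, rfl⟩ := h
      simp at h2
  have h : ∃ x : Fin n × Fin n, x.1 ≠ x.2 ∧ (([i, i, j, j] : List (Fin n)) : Cycle (Fin n)) =
      ↑[x.1, x.1, x.2, x.2] := ⟨(i, j), hij, rfl⟩
  rw [cycVal, dif_neg h0, dif_pos h]
  obtain ⟨h1, h2⟩ := h.choose_spec
  rw [Cycle.coe_eq_coe] at h2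
  generalize h.choose = x at h1 h2
  obtain ⟨p, q⟩ := x
  dsimp only at h1 h2 ⊢
  rcases isRotated_double h2 with h | h | h | h <;>
  · simp only [List.cons.injEq, and_true] at h
    obtain ⟨h3, h4, h5, h6⟩ := h
    subst h3
    first
    | exact absurd h4 hij
    | exact absurd h4.symm hij
    | exact absurd h4 hij.symm
    | (subst h5; first | rfl | rw [dd_double_swap hij])

/-- The value 0 is a normalization. Only the combination 2·ijij − iijj is constrained, so one of the
two values may be chosen freely. -/
theorem cycVal_alternating {n : ℕ} {i j : Fin n} (hij : i ≠ j) :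
    cycVal n 4 ↑[i, j, i, j] = 0 := by
  rw [cycVal, dif_neg, dif_neg]
  · rintro ⟨⟨p, q⟩, h1, h2⟩
    rw [Cycle.coe_eq_coe] at h2
    rcases isRotated_alternating h2 with h | h <;> simp_all
  · rintro ⟨⟨p, r⟩, h1, h2⟩
    rw [Cycle.coe_eq_coe] at h1
    rcases isRotated_alternating h1 with h | h <;> simp_all

theorem cycVal_replicate {n k : ℕ} (hk : 2 ≤ k) (i : Fin n) :
    cycVal n k ↑(List.replicate k i) = 0 := by
  have key {l : List (Fin n)} (h : List.replicate k i ~r l) : l = List.replicate k i := by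
    obtain ⟨m, rfl⟩ := h
    rw [List.rotate_replicate]
  rw [cycVal, dif_neg, dif_neg]
  · rintro ⟨⟨p, q⟩, h1, h2⟩
    rw [Cycle.coe_eq_coe] at h2
    have h3 := List.eq_replicate_iff.1 (key h2)
    exact h1 ((h3.2 p (by simp)).trans (h3.2 q (by simp)).symm)
  · rintro ⟨⟨p, r⟩, h1, h2⟩
    rw [Cycle.coe_eq_coe] at h1
    have h3 := List.eq_replicate_iff.1 (key h1)
    dsimp only at h2 h3
    rcases r with _ | ⟨q, r⟩
    · simp at h3; omega
    · exact h2 (by rw [h3.2 p (by simp), h3.2 q (by simp)]; simp)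

theorem exists_cycVal_lift {n k : ℕ} (hk : 2 ≤ k) :
    ∃ S : CBar n k →ₗ[ℤ] (H n →ₗ[ℤ] L n (k + 1)) ⧸ LinearMap.range (tau n k),
      ∀ l : List (Fin n), l.length = k → S (tr n k (Wd l)) = cycVal n k ↑l := by
  set f := (wordBasis n k).constr ℤ fun a => cycVal n k ↑(List.ofFn a) with hf
  have ftw (a : Fin k → Fin n) : f (tw a) = cycVal n k ↑(List.ofFn a) := by
    rw [hf, ← wordBasis_apply, Module.Basis.constr_basis]
  obtain ⟨g, hg⟩ := exists_lift_qC f (fun a => by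
    rw [ftw, ftw, ofFn_rotate_one]
    exact congrArg _ (Cycle.coe_eq_coe.2 (List.IsRotated.symm ⟨1, rfl⟩))) (fun i => by
    rw [ftw, List.ofFn_const, cycVal_replicate hk])
  refine ⟨g, fun l hl => ?_⟩
  obtain ⟨a, rfl⟩ : ∃ a : Fin k → Fin n, l = List.ofFn a := by
    subst hl; exact ⟨l.get, by simp⟩
  rw [tr_Wd_ofFn, hg, ftw]

/-! ### Generators of 𝔭_n(k) modulo the image of τ. -/

/-- The span of the left-normed commutators starting with `x_i` and not involving `x_i` again. -/
def spanSingle (n k : ℕ) (i : Fin n) : Submodule ℤ (L n k) :=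
  Submodule.span ℤ {z | ∃ r : List (Fin n), r.length + 1 = k ∧ i ∉ r ∧ z = cl k i r}

theorem lncMap_mem_spanSingle {n k m : ℕ} {i : Fin n} {β : List (Fin n)} (hβ : i ∉ β)
    (hm : m = k + β.length) {z : L n k} (hz : z ∈ spanSingle n k i) :
    L.lncMap k m β hm z ∈ spanSingle n m i := by
  induction hz using Submodule.span_induction with
  | mem z hz =>
    obtain ⟨r, h1, h2, rfl⟩ := hz
    refine Submodule.subset_span ⟨r ++ β, by rw [List.length_append]; omega, by simp [h2, hβ], ?_⟩
    rw [cl, L.lncMap_cls β hm (cl_mem i h1), cl, lnc_append]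
  | zero => rw [map_zero]; exact zero_mem _
  | add x y _ _ hx hy => rw [map_add]; exact add_mem hx hy
  | smul c x _ hx => rw [map_smul]; exact Submodule.smul_mem _ c hx

/-- The Jacobi identity [c, [g, b]] = [[c, g], b] − [[c, b], g] unfolds the right-hand entry letter
by letter. -/
theorem cls_commutator_mem_spanSingle {n : ℕ} {i a : Fin n} (α : List (Fin n)) :
    ∀ (r : List (Fin n)) (m : ℕ), i ∉ r → i ∉ a :: α → m = r.length + α.length + 2 →
      cls m ⁅lnc (FreeGroup.of i) r, lnc (FreeGroup.of a) α⁆ ∈ spanSingle n m i := by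
  induction α using List.reverseRecOn with
  | nil =>
    intro r m hr ha hm
    refine Submodule.subset_span ⟨r ++ [a], by simp [hm], by simpa [hr] using ha, ?_⟩
    rw [cl, lnc_concat]; rfl
  | append_singleton α b ih =>
    intro r m hr ha hm
    simp only [List.mem_cons, List.mem_append, List.length_append, List.not_mem_nil, or_false,
      List.length_cons, List.length_nil, not_or] at ha hm
    have ha' : i ∉ a :: α := by simp [ha.1, ha.2.1]
    have hg : lnc (FreeGroup.of a) α ∈ gamma n (α.length + 1) :=
      lnc_mem (mem_gamma_one _) (by omega)
    have hc : lnc (FreeGroup.of i) r ∈ gamma n (r.length + 1) :=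
      lnc_mem (mem_gamma_one _) (by omega)
    rw [lnc_concat, cls_jacobi' (i := α.length + 1) (j := 1) (k := r.length + 1) (by omega)
      (by omega) rfl (by omega) (by omega) hg (mem_gamma_one _) hc]
    refine sub_mem ?_ ?_
    · have h := lncMap_mem_spanSingle (β := [b]) (m := m) (by simpa using ha.2.2)
        (by simp; omega) (ih r (r.length + α.length + 2) hr ha' rfl)
      rwa [L.lncMap_cls _ _ (commutator_mem (by omega) (by omega) (by omega) hc hg)] at h
    · have h := ih (r ++ [b]) m (by simp [hr, ha.2.2]) ha' (by simp; omega)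
      rwa [lnc_concat] at h

theorem cl_mem_spanSingle {n k : ℕ} {i a : Fin n} {l : List (Fin n)} (hl : l.length + 1 = k)
    (h : (a :: l).count i = 1) : cl k a l ∈ spanSingle n k i := by
  by_cases ha : a = i
  · subst ha
    refine Submodule.subset_span ⟨l, hl, ?_, rfl⟩
    rw [← List.count_eq_zero]
    simpa using h
  · rw [List.count_cons_of_ne ha] at h
    have hi : i ∈ l := List.count_pos_iff.1 (by omega)
    obtain ⟨α, β, rfl⟩ := List.append_of_mem hi
    rw [List.count_append, List.count_cons_self] at h
    have hα : i ∉ α := List.count_eq_zero.1 (by omega)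
    have hβ : i ∉ β := List.count_eq_zero.1 (by omega)
    rw [List.length_append, List.length_cons] at hl
    have h1 := cls_commutator_mem_spanSingle (i := i) (a := a) α [] (α.length + 2) (by simp)
      (by simp [hα, Ne.symm ha]) (by simp)
    rw [lnc_nil, cls_commutator_swap (i := α.length + 1) (j := 1) (by omega) (by omega) (by omega)
      (lnc_mem (mem_gamma_one _) (by omega)) (mem_gamma_one _), neg_mem_iff] at h1
    have h2 := lncMap_mem_spanSingle (m := k) hβ (by omega) h1
    rw [L.lncMap_cls β (by omega) (commutator_mem_gamma (lnc_mem (mem_gamma_one _) (by omega)) _)]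
      at h2
    rw [cl, lnc_append, lnc_cons]
    exact h2

theorem tr_double {n : ℕ} {i j : Fin n} (hij : i ≠ j) :
    tr n 4 (dL i (lp (X i) [j, i, j]) * X i) =
      (2 : ℤ) • tr n 4 (Wd [i, j, i, j]) - tr n 4 (Wd [i, i, j, j]) := by
  have e : dL i (lp (X i) [j, i, j]) * X i = (2 : ℤ) • Wd [j, i, j, i] - Wd [i, j, j, i] := by
    rw [lp_three]
    simp only [map_sub, map_add, dL_Wd_cons, if_neg hij.symm, if_true]
    simp [Wd]; noncomm_ring
  have e1 : tr n 4 (Wd [j, i, j, i]) = tr n 4 (Wd [i, j, i, j]) := tr_isRotated ⟨1, rfl⟩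
  have e2 : tr n 4 (Wd [i, j, j, i]) = tr n 4 (Wd [i, i, j, j]) := tr_isRotated ⟨3, rfl⟩
  rw [e, map_sub, map_smul, e1, e2]

theorem eq_of_count_ge_two {α : Type*} [DecidableEq α] {i j a : α} (hij : i ≠ j) {l : List α}
    (hl : l.length = 3) (hi : 2 ≤ (a :: l).count i) (hj : 2 ≤ (a :: l).count j) :
    (a = i ∧ l = [i, j, j]) ∨ (a = i ∧ l = [j, i, j]) ∨ (a = i ∧ l = [j, j, i]) ∨
      (a = j ∧ l = [j, i, i]) ∨ (a = j ∧ l = [i, j, i]) ∨ (a = j ∧ l = [i, i, j]) := by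
  obtain ⟨b, c, d, rfl⟩ := List.length_eq_three.1 hl
  simp only [List.count_cons, List.count_nil, beq_iff_eq] at hi hj
  grind (splits := 20)

theorem count_add_count_le_length {α : Type*} [DecidableEq α] {i j : α} (hij : i ≠ j)
    (l : List α) : l.count i + l.count j ≤ l.length := by
  induction l with
  | nil => simp
  | cons a l ih =>
    simp only [List.count_cons, List.length_cons, beq_iff_eq]
    split_ifs with h1 h2
    · exact absurd (h1.symm.trans h2) hij
    all_goals omega

/-- Consider D_i(w) for a left-normed w. If i occurs at most once in w, partial conjugations or
`spanSingle` apply. If i repeats, an inner derivation replaces D_i(w) by −∑_{j ≠ i} D_j(w), which is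
covered unless some j ≠ i repeats as well; in that case w involves i and j twice each. -/
theorem p_le_of_generators {n k : ℕ} (hk : 2 ≤ k) (hk' : k ≤ 4)
    {G : Submodule ℤ (H n →ₗ[ℤ] L n (k + 1))} (hN : LinearMap.range (tau n k) ≤ G)
    (hsingle : ∀ (i : Fin n) (r : List (Fin n)), r.length + 1 = k → i ∉ r → D i (cl k i r) ∈ G)
    (hdouble : ∀ i j : Fin n, i ≠ j → k = 4 → D i (cl k i [j, i, j]) ∈ G) : p n k ≤ G := by
  have h1 (i a : Fin n) (l : List (Fin n)) (hl : l.length + 1 = k) (h : (a :: l).count i ≤ 1) :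
      D i (cl k a l) ∈ G := by
    rcases Nat.le_one_iff_eq_zero_or_eq_one.1 h with h | h
    · exact hN (D_mem_range_of_not_mem i a l hl (List.count_eq_zero.1 h))
    · suffices h3 : spanSingle n k i ≤ G.comap (D i) from h3 (cl_mem_spanSingle hl h)
      refine Submodule.span_le.2 ?_
      rintro _ ⟨r, h1, h2, rfl⟩
      exact hsingle i r h1 h2
  have h2 (i : Fin n) (w : L n k) (h : ∀ j, j ≠ i → D j w ∈ G) : D i w ∈ G := by
    have h3 := hN (sum_D_mem_range_tau (by omega) w)
    rw [← Finset.add_sum_erase _ _ (Finset.mem_univ i)] at h3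
    exact (Submodule.add_mem_iff_left _ (sum_mem fun j hj => h j (Finset.ne_of_mem_erase hj))).1 h3
  obtain ⟨K, rfl⟩ : ∃ K, k = K + 1 := ⟨k - 1, by omega⟩
  refine p_le_iff.2 fun i a l hl => ?_
  by_cases hi : (a :: l).count i ≤ 1
  · exact h1 i a l (by omega) hi
  by_cases hj : ∀ j, j ≠ i → (a :: l).count j ≤ 1
  · exact h2 i _ fun j hji => h1 j a l (by omega) (hj j hji)
  push Not at hi hj
  obtain ⟨j, hji, hj⟩ := hj
  -- Two letters occurring at least twice each fill at least four places, and k ≤ 4.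
  have hK : K = 3 := by
    have := count_add_count_le_length hji (a :: l)
    simp at this
    omega
  subst hK
  have h4 : D i (cl 4 i [j, i, j]) ∈ G := hdouble i j hji.symm rfl
  rcases eq_of_count_ge_two hji.symm hl hi hj with ⟨rfl, rfl⟩ | ⟨rfl, rfl⟩ | ⟨rfl, rfl⟩ |
    ⟨rfl, rfl⟩ | ⟨rfl, rfl⟩ | ⟨rfl, rfl⟩
  · rw [cl_self (k := 4) a [j, j] rfl, map_zero]; exact zero_mem _
  · exact h4
  · rw [cl_double_eq]; exact h4
  · rw [cl_self (k := 4) a [i, i] rfl, map_zero]; exact zero_mem _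
  · rw [cl_double_swap, map_neg]; exact neg_mem h4
  · rw [cl_double_eq, cl_double_swap, map_neg]; exact neg_mem h4

theorem qC_Phi_D_single {n k : ℕ} (hk : 2 ≤ k) {i : Fin n} {r : List (Fin n)}
    (hr : r.length + 1 = k) (h : i ∉ r) : qC n k (Phi n k (D i (cl k i r))) = tr n k (Wd (i :: r)) := by
  have h0 : r ≠ [] := by rintro rfl; simp at hr; omega
  rw [qC_Phi_D i i hr h0, dL_lp_self h, tr_mul_X, ← Wd_cons]

theorem qC_Phi_D_double {n : ℕ} {i j : Fin n} (hij : i ≠ j) :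
    qC n 4 (Phi n 4 (D i (cl 4 i [j, i, j]))) =
      (2 : ℤ) • tr n 4 (Wd [i, j, i, j]) - tr n 4 (Wd [i, i, j, j]) := by
  rw [qC_Phi_D (k := 4) i i (l := [j, i, j]) rfl (by simp), tr_double hij]

/-- S ∘ trace and the projection modulo Im τ agree on generators: both kill Im τ, and the values in
`cycVal` are chosen to match on the remaining ones. -/
theorem p_le_of_cycVal_lift {n k : ℕ} (hk : 2 ≤ k) (hk' : k ≤ 4)
    {S : CBar n k →ₗ[ℤ] (H n →ₗ[ℤ] L n (k + 1)) ⧸ LinearMap.range (tau n k)}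
    (hS : ∀ l : List (Fin n), l.length = k → S (tr n k (Wd l)) = cycVal n k ↑l) :
    p n k ≤ LinearMap.ker ((LinearMap.range (tau n k)).mkQ - S ∘ₗ qC n k ∘ₗ Phi n k) := by
  set G := LinearMap.ker ((LinearMap.range (tau n k)).mkQ - S ∘ₗ qC n k ∘ₗ Phi n k) with hG
  have mem_G (f) : f ∈ G ↔ (LinearMap.range (tau n k)).mkQ f = S (qC n k (Phi n k f)) := by
    rw [hG, LinearMap.mem_ker, LinearMap.sub_apply, sub_eq_zero]; rfl
  refine p_le_of_generators hk hk' ?_ (fun i r h1 h2 => ?_) (fun i j hij h4 => ?_)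
  · rintro _ ⟨g, rfl⟩
    rw [mem_G, qC_Phi_tau (by omega), map_zero]
    exact (Submodule.Quotient.mk_eq_zero _).2 ⟨g, rfl⟩
  · rw [mem_G, qC_Phi_D_single hk h1 h2, hS (i :: r) h1, cycVal_single h1 h2]
    rfl
  · subst h4
    rw [mem_G, qC_Phi_D_double hij, map_sub, map_smul, hS _ rfl, hS _ rfl,
      cycVal_alternating hij, cycVal_double hij, smul_zero, zero_sub, neg_neg]
    rfl

theorem mem_range_tau_iff {n k : ℕ} (hk : 2 ≤ k) (hk' : k ≤ 4) {f : H n →ₗ[ℤ] L n (k + 1)}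
    (hf : f ∈ p n k) : f ∈ LinearMap.range (tau n k) ↔ qC n k (Phi n k f) = 0 := by
  constructor
  · rintro ⟨g, rfl⟩
    exact qC_Phi_tau (by omega) g
  · intro h
    obtain ⟨S, hS⟩ := exists_cycVal_lift (n := n) hk
    have h1 := p_le_of_cycVal_lift hk hk' hS hf
    rw [LinearMap.mem_ker, LinearMap.sub_apply, LinearMap.comp_apply, LinearMap.comp_apply, h,
      map_zero, sub_zero] at h1
    exact (Submodule.Quotient.mk_eq_zero _).1 h1

/-! ### The image of the trace -/

theorem TrBar_apply {n k : ℕ} (f : p n k) : TrBar n k f = qC n k (Phi n k f) := rfl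

theorem tr_single_mem_range {n k : ℕ} (hk : 2 ≤ k) {i : Fin n} {r : List (Fin n)}
    (hr : r.length + 1 = k) (h : i ∉ r) : tr n k (Wd (i :: r)) ∈ LinearMap.range (TrBar n k) := by
  obtain ⟨K, rfl⟩ : ∃ K, k = K + 1 := ⟨k - 1, by omega⟩
  exact ⟨⟨D i (cl (K + 1) i r), D_mem_p _ _⟩, qC_Phi_D_single hk hr h⟩

theorem tr_replicate {n k : ℕ} (i : Fin n) : tr n k (Wd (List.replicate k i)) = 0 := by
  rw [← List.ofFn_const, tr_Wd_ofFn, qC_const]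

theorem CBar_hom_ext {n k : ℕ} {M : Type*} [AddCommGroup M] {f g : CBar n k →ₗ[ℤ] M}
    (h : ∀ l : List (Fin n), l.length = k → f (tr n k (Wd l)) = g (tr n k (Wd l))) : f = g := by
  have e : f ∘ₗ qC n k = g ∘ₗ qC n k := (wordBasis n k).ext fun a => by
    rw [wordBasis_apply, LinearMap.comp_apply, LinearMap.comp_apply, ← tr_Wd_ofFn]
    exact h _ (by simp)
  ext y
  exact LinearMap.congr_fun e _

/-- In length 2 or 3 every nonconstant word has a letter occurring once, which a rotation brings to
the front. -/
theorem TrBar_surjective {n k : ℕ} (hk : k = 2 ∨ k = 3) : Function.Surjective (TrBar n k) := by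
  rw [← LinearMap.range_eq_top, ← Submodule.ker_mkQ (LinearMap.range (TrBar n k)),
    LinearMap.ker_eq_top]
  refine CBar_hom_ext fun l hl => ?_
  rw [LinearMap.zero_apply, Submodule.mkQ_apply, Submodule.Quotient.mk_eq_zero]
  rcases hk with rfl | rfl
  · obtain ⟨a, b, rfl⟩ := List.length_eq_two.1 hl
    by_cases h : a = b
    · subst h
      rw [show [a, a] = List.replicate 2 a from rfl, tr_replicate]
      exact zero_mem _
    · exact tr_single_mem_range le_rfl rfl (by simpa using h)
  · obtain ⟨a, b, c, rfl⟩ := List.length_eq_three.1 hl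
    by_cases hab : a = b
    · subst hab
      by_cases hac : a = c
      · subst hac
        rw [show [a, a, a] = List.replicate 3 a from rfl, tr_replicate]
        exact zero_mem _
      · have h : [a, a, c] ~r [c, a, a] := ⟨2, rfl⟩
        rw [tr_isRotated h]
        exact tr_single_mem_range (by omega) rfl (by simpa using Ne.symm hac)
    · by_cases hac : a = c
      · subst hac
        have h : [a, b, a] ~r [b, a, a] := ⟨1, rfl⟩
        rw [tr_isRotated h]
        exact tr_single_mem_range (by omega) rfl (by simpa using Ne.symm hab)
      · exact tr_single_mem_range (by omega) rfl (by simp [hab, hac])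

/-! ### The cokernel in degree four and the permutation module on pairs. -/

/-- The basis element `{i, j}` of the permutation module on pairs, and `0` if `i = j`. -/
def pr {n : ℕ} (i j : Fin n) : MonoidAlgebra ℤ (Set.powersetCard (Fin n) 2) :=
  if h : i ≠ j then MonoidAlgebra.single (Set.powersetCard.ofCard (Finset.card_pair h)) 1 else 0

theorem pr_self {n : ℕ} (i : Fin n) : pr i i = 0 := dif_neg (by simp)

theorem pr_comm {n : ℕ} (i j : Fin n) : pr i j = pr j i := by
  by_cases h : i = j
  · rw [h]
  · rw [pr, pr, dif_pos h, dif_pos (Ne.symm h)]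
    congr 1
    exact Subtype.ext (Finset.pair_comm i j)

theorem pr_hom_ext {n : ℕ} {M : Type*} [AddCommGroup M]
    {f g : MonoidAlgebra ℤ (Set.powersetCard (Fin n) 2) →ₗ[ℤ] M}
    (h : ∀ i j, i ≠ j → f (pr i j) = g (pr i j)) : f = g := by
  refine (MonoidAlgebra.basis (Set.powersetCard (Fin n) 2) ℤ).ext fun s => ?_
  obtain ⟨s, hs⟩ := s
  obtain ⟨i, j, hij, rfl⟩ := Finset.card_eq_two.1 hs
  have := h i j hij
  rw [pr, dif_pos hij] at this
  rw [MonoidAlgebra.basis_apply]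
  exact this

theorem rhoPairs_pr {n : ℕ} (s : Equiv.Perm (Fin n)) (i j : Fin n) :
    rhoPairs n s (pr i j) = pr (s i) (s j) := by
  by_cases h : i = j
  · rw [h, pr_self, pr_self, map_zero]
  · rw [pr, pr, dif_pos h, dif_pos (by simpa using h), Representation.ofMulAction_single]
    congr 1
    refine Subtype.ext ?_
    rw [Set.powersetCard.coe_smul]
    simp [Finset.smul_finset_insert]

/-- The obstruction carried by the cyclic word `x_a x_b x_c x_d`. -/
def pairVal {n : ℕ} (a b c d : Fin n) : MonoidAlgebra ℤ (Set.powersetCard (Fin n) 2) :=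
  (if a = c ∧ b = d then pr a b else 0) + (if a = b ∧ c = d then (2 : ℤ) • pr a c else 0) +
    (if a = d ∧ b = c then (2 : ℤ) • pr a b else 0)

/-- Rotation preserves the pattern abab and exchanges aabb with abba, so both of the latter need the
same coefficient. The coefficients 1 and 2 make 2·ijij − iijj go to 0. -/
theorem pairVal_rotate {n : ℕ} (a b c d : Fin n) : pairVal b c d a = pairVal a b c d := by
  rw [pairVal, pairVal, add_assoc, add_assoc, add_comm (ite _ ((2 : ℤ) • pr b d) 0)]
  congr 1
  · by_cases h : a = c ∧ b = d
    · rw [if_pos h, if_pos ⟨h.2, h.1.symm⟩, ← h.1, pr_comm]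
    · rw [if_neg h, if_neg fun h' => h ⟨h'.2.symm, h'.1⟩]
  congr 1
  · by_cases h : a = b ∧ c = d
    · rw [if_pos h, if_pos ⟨h.1.symm, h.2⟩, ← h.1]
    · rw [if_neg h, if_neg fun h' => h ⟨h'.1.symm, h'.2⟩]
  · by_cases h : a = d ∧ b = c
    · rw [if_pos h, if_pos ⟨h.2, h.1.symm⟩, ← h.1, pr_comm]
    · rw [if_neg h, if_neg fun h' => h ⟨h'.2.symm, h'.1⟩]

theorem pairVal_perm {n : ℕ} (s : Equiv.Perm (Fin n)) (a b c d : Fin n) :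
    rhoPairs n s (pairVal a b c d) = pairVal (s a) (s b) (s c) (s d) := by
  simp only [pairVal, map_add, apply_ite (rhoPairs n s), map_smul, rhoPairs_pr, map_zero,
    EmbeddingLike.apply_eq_iff_eq]

theorem pairVal_alternating {n : ℕ} {i j : Fin n} (h : i ≠ j) : pairVal i j i j = pr i j := by
  simp [pairVal, h]

theorem pairVal_double {n : ℕ} {i j : Fin n} (h : i ≠ j) :
    pairVal i i j j = (2 : ℤ) • pr i j := by
  simp [pairVal, h]

theorem pairVal_single {n : ℕ} {a b c d : Fin n} (h : a ∉ [b, c, d]) : pairVal a b c d = 0 := by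
  simp only [List.mem_cons, List.not_mem_nil, or_false, not_or] at h
  simp [pairVal, h]

theorem exists_pairs_lift (n : ℕ) :
    ∃ q : CBar n 4 →ₗ[ℤ] MonoidAlgebra ℤ (Set.powersetCard (Fin n) 2),
      ∀ a b c d, q (tr n 4 (Wd [a, b, c, d])) = pairVal a b c d := by
  set f := (wordBasis n 4).constr ℤ fun a => pairVal (a 0) (a 1) (a 2) (a 3) with hf
  have ftw (a : Fin 4 → Fin n) : f (tw a) = pairVal (a 0) (a 1) (a 2) (a 3) := by
    rw [hf, ← wordBasis_apply, Module.Basis.constr_basis]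
  obtain ⟨q, hq⟩ := exists_lift_qC f (fun a => by
    rw [ftw, ftw]; exact pairVal_rotate _ _ _ _) (fun i => by
    rw [ftw]; simp [pairVal, pr_self])
  refine ⟨q, fun a b c d => ?_⟩
  have h : [a, b, c, d] = List.ofFn ![a, b, c, d] := by simp
  rw [h, tr_Wd_ofFn, hq, ftw]
  rfl

theorem word_cases {α : Type*} (a b c d : α) :
    (∃ p q r s, [a, b, c, d] ~r [p, q, r, s] ∧ p ∉ [q, r, s]) ∨ (a = b ∧ a = c ∧ a = d) ∨
      (∃ i j, i ≠ j ∧ [a, b, c, d] ~r [i, i, j, j]) ∨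
      (∃ i j, i ≠ j ∧ [a, b, c, d] ~r [i, j, i, j]) := by
  by_cases h : ∃ p q r s, [a, b, c, d] ~r [p, q, r, s] ∧ p ∉ [q, r, s]
  · exact Or.inl h
  push Not at h
  have h1 := h a b c d (List.IsRotated.refl _)
  have h2 := h b c d a ⟨1, rfl⟩
  have h3 := h c d a b ⟨2, rfl⟩
  have h4 := h d a b c ⟨3, rfl⟩
  simp only [List.mem_cons, List.not_mem_nil, or_false] at h1 h2 h3 h4
  by_cases hab : a = b
  · subst hab
    by_cases hac : a = c
    · subst hac
      have had : a = d := by tauto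
      exact Or.inr (Or.inl ⟨rfl, rfl, had⟩)
    · have hcd : c = d := by rcases h3 with h | h | h <;> [exact h; exact absurd h.symm hac; exact absurd h.symm hac]
      subst hcd
      exact Or.inr (Or.inr (Or.inl ⟨a, c, hac, List.IsRotated.refl _⟩))
  · by_cases hac : a = c
    · subst hac
      have hbd : b = d := by rcases h2 with h | h | h <;> [exact absurd h.symm hab; exact h; exact absurd h.symm hab]
      subst hbd
      exact Or.inr (Or.inr (Or.inr ⟨a, b, hab, List.IsRotated.refl _⟩))
    · have had : a = d := by tauto
      subst had
      have hbc : b = c := by rcases h2 with h | h | h <;> [exact h; exact absurd h.symm hab; exact absurd h.symm hab]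
      subst hbc
      exact Or.inr (Or.inr (Or.inl ⟨a, b, hab, ⟨3, rfl⟩⟩))

theorem pairVal_eq_zero {n : ℕ} {q : CBar n 4 →ₗ[ℤ] MonoidAlgebra ℤ (Set.powersetCard (Fin n) 2)}
    (hq : ∀ a b c d, q (tr n 4 (Wd [a, b, c, d])) = pairVal a b c d) :
    LinearMap.range (TrBar n 4) ≤ LinearMap.ker q := by
  have h : p n 4 ≤ LinearMap.ker (q ∘ₗ qC n 4 ∘ₗ Phi n 4) := by
    refine p_le_of_generators (by omega) le_rfl ?_ (fun i r h1 h2 => ?_) (fun i j hij _ => ?_)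
    · rintro _ ⟨g, rfl⟩
      change q (qC n 4 _) = 0
      rw [qC_Phi_tau (by omega), map_zero]
    · change q (qC n 4 _) = 0
      obtain ⟨a, b, c, rfl⟩ := List.length_eq_three.1 (Nat.succ_injective h1 : r.length = 3)
      rw [qC_Phi_D_single (by omega) h1 h2, hq, pairVal_single h2]
    · change q (qC n 4 _) = 0
      rw [qC_Phi_D_double hij, map_sub, map_smul, hq, hq, pairVal_alternating hij,
        pairVal_double hij, sub_self]
  rintro _ ⟨f, rfl⟩
  exact h f.2

/-- A map `r` back to the cokernel sends {i, j} to the class of ijij. On words r ∘ q is the quotient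
map, so ker q is contained in the range of the trace. -/
theorem exact_TrBar_four {n : ℕ}
    {q : CBar n 4 →ₗ[ℤ] MonoidAlgebra ℤ (Set.powersetCard (Fin n) 2)}
    (hq : ∀ a b c d, q (tr n 4 (Wd [a, b, c, d])) = pairVal a b c d) :
    Function.Exact (TrBar n 4) q := by
  classical
  rw [LinearMap.exact_iff]
  refine le_antisymm ?_ (pairVal_eq_zero hq)
  set N := LinearMap.range (TrBar n 4) with hN
  set r : MonoidAlgebra ℤ (Set.powersetCard (Fin n) 2) →ₗ[ℤ] CBar n 4 ⧸ N :=
    (MonoidAlgebra.basis (Set.powersetCard (Fin n) 2) ℤ).constr ℤ fun s =>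
      if h : ∃ x : Fin n × Fin n, x.1 ≠ x.2 ∧ s.1 = {x.1, x.2} then
        N.mkQ (tr n 4 (Wd [h.choose.1, h.choose.2, h.choose.1, h.choose.2])) else 0 with hr
  have rpr (i j : Fin n) (hij : i ≠ j) : r (pr i j) = N.mkQ (tr n 4 (Wd [i, j, i, j])) := by
    have h : ∃ x : Fin n × Fin n, x.1 ≠ x.2 ∧
        (Set.powersetCard.ofCard (Finset.card_pair hij)).1 = {x.1, x.2} := ⟨(i, j), hij, rfl⟩
    have e : pr i j = MonoidAlgebra.basis (Set.powersetCard (Fin n) 2) ℤ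
        (Set.powersetCard.ofCard (Finset.card_pair hij)) := by
      rw [pr, dif_pos hij]; simp
    rw [e, hr, Module.Basis.constr_basis, dif_pos h]
    obtain ⟨h1, h2⟩ := h.choose_spec
    generalize h.choose = x at h1 h2 ⊢
    rw [Set.powersetCard.val_ofCard] at h2
    -- The order chosen for the pair does not matter, since ijij and jiji are the same cyclic word.
    have h3 : [i, j, i, j] ~r [x.1, x.2, x.1, x.2] := by
      rw [← Finset.coe_inj] at h2
      push_cast at h2
      rcases Set.pair_eq_pair_iff.1 h2 with ⟨h3, h4⟩ | ⟨h3, h4⟩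
      · rw [h3, h4]
      · rw [h3, h4]; exact ⟨1, rfl⟩
    rw [tr_isRotated h3]
  have key : r ∘ₗ q = N.mkQ := by
    refine CBar_hom_ext fun l hl => ?_
    obtain ⟨a, b, c, d, rfl⟩ : ∃ a b c d, l = [a, b, c, d] := by
      rcases l with _ | ⟨a, l⟩
      · simp at hl
      · obtain ⟨b, c, d, rfl⟩ := List.length_eq_three.1 (Nat.succ_injective hl)
        exact ⟨a, b, c, d, rfl⟩
    rw [LinearMap.comp_apply]
    rcases word_cases a b c d with ⟨p, s, t, u, h1, h2⟩ | ⟨rfl, rfl, rfl⟩ | ⟨i, j, h1, h2⟩ |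
      ⟨i, j, h1, h2⟩
    · rw [tr_isRotated h1, hq, pairVal_single h2, map_zero, eq_comm, Submodule.mkQ_apply,
        Submodule.Quotient.mk_eq_zero]
      exact tr_single_mem_range (by omega) rfl h2
    · rw [show [a, a, a, a] = List.replicate 4 a from rfl, tr_replicate, map_zero, map_zero,
        map_zero]
    · rw [tr_isRotated h2, hq, pairVal_double h1, map_smul, rpr i j h1, ← map_smul]
      refine (Submodule.Quotient.eq _).2 ?_
      rw [← qC_Phi_D_double h1]
      exact ⟨⟨_, D_mem_p _ _⟩, rfl⟩
    · rw [tr_isRotated h2, hq, pairVal_alternating h1, rpr i j h1]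
  intro z hz
  have := LinearMap.congr_fun key z
  rw [LinearMap.comp_apply, LinearMap.mem_ker.1 hz, map_zero] at this
  exact (Submodule.Quotient.mk_eq_zero _).1 this.symm

theorem pairs_surjective {n : ℕ}
    {q : CBar n 4 →ₗ[ℤ] MonoidAlgebra ℤ (Set.powersetCard (Fin n) 2)}
    (hq : ∀ a b c d, q (tr n 4 (Wd [a, b, c, d])) = pairVal a b c d) : Function.Surjective q := by
  rw [← LinearMap.range_eq_top, ← Submodule.ker_mkQ (LinearMap.range q), LinearMap.ker_eq_top]
  refine pr_hom_ext fun i j hij => ?_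
  rw [LinearMap.zero_apply, Submodule.mkQ_apply, Submodule.Quotient.mk_eq_zero]
  exact ⟨_, by rw [hq, pairVal_alternating hij]⟩

theorem finrank_pairs (n : ℕ) :
    Module.finrank ℤ (MonoidAlgebra ℤ (Set.powersetCard (Fin n) 2)) = n * (n - 1) / 2 := by
  rw [Module.finrank_eq_nat_card_basis (MonoidAlgebra.basis (Set.powersetCard (Fin n) 2) ℤ), Set.powersetCard.card,
    Nat.card_fin, Nat.choose_two_right]

/-- The cokernel of the trace in degree four. -/
theorem exists_coker_equiv (n : ℕ) : Nonempty ((CBar n 4 ⧸ LinearMap.range (TrBar n 4)) ≃ₗ[ℤ]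
    MonoidAlgebra ℤ (Set.powersetCard (Fin n) 2)) := by
  obtain ⟨q, hq⟩ := exists_pairs_lift n
  have h := LinearMap.exact_iff.1 (exact_TrBar_four hq)
  exact ⟨(Submodule.quotEquivOfEq _ _ h.symm).trans
    (q.quotKerEquivOfSurjective (pairs_surjective hq))⟩

theorem coker_free (n : ℕ) : Module.Free ℤ (CBar n 4 ⧸ LinearMap.range (TrBar n 4)) := by
  obtain ⟨e⟩ := exists_coker_equiv n
  exact Module.Free.of_equiv e.symm

theorem finrank_coker (n : ℕ) :
    Module.finrank ℤ (CBar n 4 ⧸ LinearMap.range (TrBar n 4)) = n * (n - 1) / 2 := by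
  obtain ⟨e⟩ := exists_coker_equiv n
  rw [e.finrank_eq, finrank_pairs]

/-! ### Ranks -/

instance (n k : ℕ) : Module.Free ℤ (⨂[ℤ]^k (H n)) := Module.Free.of_basis (wordBasis n k)

instance (n k : ℕ) : Module.Finite ℤ (⨂[ℤ]^k (H n)) := Module.Finite.of_basis (wordBasis n k)

/-- By tr(AB) = tr(BA), the trace of f equals that of its restriction to its image, where f is
multiplication by c. This computes ranks without exhibiting bases. -/
theorem trace_eq_mul_finrank_range {M : Type*} [AddCommGroup M] [Module.Free ℤ M] [Module.Finite ℤ M]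
    {f : M →ₗ[ℤ] M} {c : ℤ} (h : ∀ y, f (f y) = c • f y) :
    LinearMap.trace ℤ M f = c * Module.finrank ℤ (LinearMap.range f) := by
  have e : f.rangeRestrict ∘ₗ (LinearMap.range f).subtype = c • LinearMap.id := by
    ext ⟨_, y, rfl⟩
    exact h y
  have e' : (LinearMap.range f).subtype ∘ₗ f.rangeRestrict = f := rfl
  conv_lhs => rw [← e']
  rw [LinearMap.trace_comp_comm', e, map_smul, LinearMap.trace_id, smul_eq_mul]

theorem sum_fin_succ_fun {α : Type*} [Fintype α] {k : ℕ} {M : Type*} [AddCommMonoid M]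
    (g : (Fin (k + 1) → α) → M) : ∑ a, g a = ∑ x, ∑ a : Fin k → α, g (Fin.cons x a) := by
  rw [← (Fin.consEquiv fun _ => α).sum_comp, Fintype.sum_prod_type]
  rfl

theorem trace_tensor_four {n : ℕ} {f : (⨂[ℤ]^4 (H n)) →ₗ[ℤ] (⨂[ℤ]^4 (H n))}
    {u : Fin n → Fin n → Fin n → Fin n → TensorAlgebra ℤ (H n)}
    (h : ∀ a b c d, f (component n 4 (Wd [a, b, c, d])) = component n 4 (u a b c d)) :
    LinearMap.trace ℤ _ f = ∑ a, ∑ b, ∑ c, ∑ d, co [a, b, c, d] (u a b c d) := by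
  rw [LinearMap.trace_eq_matrix_trace ℤ (wordBasis n 4), Matrix.trace]
  simp only [sum_fin_succ_fun, Fintype.sum_unique, Matrix.diag_apply, LinearMap.toMatrix_apply]
  refine Finset.sum_congr rfl fun a _ => Finset.sum_congr rfl fun b _ =>
    Finset.sum_congr rfl fun c _ => Finset.sum_congr rfl fun d _ => ?_
  have e : [a, b, c, d] = List.ofFn (Fin.cons a (Fin.cons b (Fin.cons c (Fin.cons d default))) :
    Fin 4 → Fin n) := by simp [List.ofFn_succ]
  rw [wordBasis_apply, ← component_Wd_ofFn, ← e, h, e, co_ofFn, Module.Basis.coord_apply]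

/-- The Dynkin operator in degree four. -/
def dynkin (n : ℕ) : (⨂[ℤ]^4 (H n)) →ₗ[ℤ] (⨂[ℤ]^4 (H n)) :=
  wc 4 fun l => match l with
    | a :: l => component n 4 (lp (X a) l)
    | [] => 0

theorem dynkin_Wd {n : ℕ} (a b c d : Fin n) :
    dynkin n (component n 4 (Wd [a, b, c, d])) = component n 4 (lp (X a) [b, c, d]) :=
  wc_component_Wd _ rfl

theorem tensor_four_hom_ext {n : ℕ} {M : Type*} [AddCommGroup M] {f g : (⨂[ℤ]^4 (H n)) →ₗ[ℤ] M}
    (h : ∀ a b c d, f (component n 4 (Wd [a, b, c, d])) = g (component n 4 (Wd [a, b, c, d]))) :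
    f = g := by
  refine (wordBasis n 4).ext fun a => ?_
  rw [wordBasis_apply, ← component_Wd_ofFn]
  simp only [List.ofFn_succ, List.ofFn_zero]
  exact h _ _ _ _

/-- The Dynkin–Specht–Wever identity in degree four, checked by expanding on words. -/
theorem dynkin_dynkin {n : ℕ} (y : ⨂[ℤ]^4 (H n)) :
    dynkin n (dynkin n y) = (4 : ℤ) • dynkin n y := by
  have e : dynkin n ∘ₗ dynkin n = (4 : ℤ) • dynkin n := tensor_four_hom_ext fun a b c d => by
    rw [LinearMap.comp_apply, LinearMap.smul_apply, dynkin_Wd, lp_three]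
    simp only [map_sub, map_add, dynkin_Wd]
    simp only [lp_three, map_sub, map_add]
    abel
  exact LinearMap.congr_fun e y

theorem trace_dynkin (n : ℕ) : LinearMap.trace ℤ _ (dynkin n) = (n : ℤ) ^ 4 - (n : ℤ) ^ 2 := by
  rw [trace_tensor_four dynkin_Wd]
  have e (a b c d : Fin n) : co [a, b, c, d] (lp (X a) [b, c, d]) =
      1 - (if a = b then 1 else 0) - (if a = b then if b = c then 1 else 0 else 0) +
        (if a = c then 1 else 0) + (if a = c then if c = d then 1 else 0 else 0) -
        (if a = d then if b = c then 1 else 0 else 0) := by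
    simp only [lp_three, map_sub, map_add, co_Wd, List.cons.injEq, and_true]
    by_cases h1 : a = b <;> by_cases h2 : a = c <;> by_cases h3 : a = d <;>
      by_cases h4 : b = c <;> by_cases h5 : b = d <;> by_cases h6 : c = d <;> grind
  simp only [e]
  simp only [Finset.sum_add_distrib, Finset.sum_sub_distrib]
  simp
  ring

theorem range_dynkin (n : ℕ) : LinearMap.range (dynkin n) = LinearMap.range (iota n 4) := by
  apply le_antisymm
  · rw [← Submodule.ker_mkQ (LinearMap.range (iota n 4)), LinearMap.range_le_ker_iff]
    refine tensor_four_hom_ext fun a b c d => ?_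
    rw [LinearMap.comp_apply, dynkin_Wd, LinearMap.zero_apply, Submodule.mkQ_apply,
      Submodule.Quotient.mk_eq_zero]
    exact ⟨_, iota_cl (k := 4) a (l := [b, c, d]) rfl⟩
  · rintro _ ⟨z, rfl⟩
    suffices h : z ∈ (LinearMap.range (dynkin n)).comap (iota n 4) from h
    refine L.induction_lnc _ (fun a l hl => ?_) z
    obtain ⟨b, c, d, rfl⟩ := List.length_eq_three.1 hl
    exact ⟨_, (dynkin_Wd a b c d).trans (iota_cl (k := 4) a (l := [b, c, d]) rfl).symm⟩

theorem four_mul_finrank_L (n : ℕ) :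
    4 * (Module.finrank ℤ (L n 4) : ℤ) = (n : ℤ) ^ 4 - (n : ℤ) ^ 2 := by
  have h := trace_eq_mul_finrank_range (f := dynkin n) (c := 4) dynkin_dynkin
  rw [trace_dynkin, range_dynkin] at h
  rw [h, (LinearEquiv.ofInjective _ iota_four_injective).finrank_eq]

theorem L_four_free (n : ℕ) : Module.Free ℤ (L n 4) :=
  Module.Free.of_equiv (LinearEquiv.ofInjective _ (iota_four_injective (n := n))).symm

theorem L_four_finite (n : ℕ) : Module.Finite ℤ (L n 4) :=
  Module.Finite.equiv (LinearEquiv.ofInjective _ (iota_four_injective (n := n))).symm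

/-- The sum of the rotations of a nonconstant word. -/
def rotSum (n : ℕ) : (⨂[ℤ]^4 (H n)) →ₗ[ℤ] (⨂[ℤ]^4 (H n)) :=
  wc 4 fun l => match l with
    | [a, b, c, d] => component n 4 (if a = b ∧ b = c ∧ c = d then 0 else
        Wd [a, b, c, d] + Wd [b, c, d, a] + Wd [c, d, a, b] + Wd [d, a, b, c])
    | _ => 0

theorem rotSum_Wd {n : ℕ} (a b c d : Fin n) :
    rotSum n (component n 4 (Wd [a, b, c, d])) =
      component n 4 (if a = b ∧ b = c ∧ c = d then 0 else
        Wd [a, b, c, d] + Wd [b, c, d, a] + Wd [c, d, a, b] + Wd [d, a, b, c]) :=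
  wc_component_Wd _ rfl

theorem rotSum_rotate {n : ℕ} (a b c d : Fin n) :
    rotSum n (component n 4 (Wd [b, c, d, a])) = rotSum n (component n 4 (Wd [a, b, c, d])) := by
  rw [rotSum_Wd, rotSum_Wd]
  congr 1
  refine if_congr ?_ rfl ?_
  · constructor
    · rintro ⟨rfl, rfl, rfl⟩; simp
    · rintro ⟨rfl, rfl, rfl⟩; simp
  · abel

theorem rotSum_rotSum {n : ℕ} (y : ⨂[ℤ]^4 (H n)) :
    rotSum n (rotSum n y) = (4 : ℤ) • rotSum n y := by
  have e : rotSum n ∘ₗ rotSum n = (4 : ℤ) • rotSum n := tensor_four_hom_ext fun a b c d => by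
    rw [LinearMap.comp_apply, LinearMap.smul_apply]
    by_cases h : a = b ∧ b = c ∧ c = d
    · rw [rotSum_Wd, if_pos h, map_zero, map_zero, smul_zero]
    · rw [congrArg (rotSum n) (rotSum_Wd a b c d), if_neg h]
      simp only [map_add]
      rw [rotSum_rotate c d a b, rotSum_rotate b c d a, rotSum_rotate a b c d]
      abel
  exact LinearMap.congr_fun e y

/-- The identity contributes n⁴ and the half-turn contributes n² through the words abab; the
correction −2n makes the constant words contribute 0. -/
theorem trace_rotSum (n : ℕ) :
    LinearMap.trace ℤ _ (rotSum n) = (n : ℤ) ^ 4 + (n : ℤ) ^ 2 - 2 * n := by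
  rw [trace_tensor_four rotSum_Wd]
  have e (a b c d : Fin n) : co [a, b, c, d] (if a = b ∧ b = c ∧ c = d then 0 else
      Wd [a, b, c, d] + Wd [b, c, d, a] + Wd [c, d, a, b] + Wd [d, a, b, c]) =
      1 + (if a = c then if b = d then 1 else 0 else 0) -
        2 * (if a = b then if b = c then if c = d then 1 else 0 else 0 else 0) := by
    by_cases h : a = b ∧ b = c ∧ c = d
    · rw [if_pos h]
      obtain ⟨rfl, rfl, rfl⟩ := h
      simp
    · rw [if_neg h]
      simp only [map_add, co_Wd, List.cons.injEq, and_true]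
      by_cases h1 : a = b <;> by_cases h2 : b = c <;> by_cases h3 : c = d <;>
        by_cases h4 : a = c <;> by_cases h5 : b = d <;> grind
  simp only [e]
  simp only [Finset.sum_add_distrib, Finset.sum_sub_distrib, ← Finset.mul_sum]
  simp
  ring

/-- The sum of rotations descends to a map 𝓒̄ → H^{⊗4}, which is injective because projecting back
gives multiplication by 4 on a torsion-free group. The rank is therefore that of the image of
`rotSum`. -/
theorem four_mul_finrank_CBar (n : ℕ) :
    4 * (Module.finrank ℤ (CBar n 4) : ℤ) = (n : ℤ) ^ 4 + (n : ℤ) ^ 2 - 2 * n := by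
  obtain ⟨g, hg⟩ := exists_lift_qC (rotSum n) (fun a => by
    rw [← component_Wd_ofFn, ← component_Wd_ofFn]
    simp only [List.ofFn_succ, List.ofFn_zero]
    exact rotSum_rotate _ _ _ _) (fun i => by
    rw [← component_Wd_ofFn]
    simp only [List.ofFn_succ, List.ofFn_zero]
    rw [rotSum_Wd, if_pos ⟨rfl, rfl, rfl⟩, map_zero])
  have h4 : qC n 4 ∘ₗ rotSum n = (4 : ℤ) • qC n 4 := tensor_four_hom_ext fun a b c d => by
    rw [LinearMap.comp_apply, LinearMap.smul_apply, rotSum_Wd]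
    change tr n 4 _ = (4 : ℤ) • tr n 4 _
    split_ifs with h
    · obtain ⟨rfl, rfl, rfl⟩ := h
      rw [show [a, a, a, a] = List.replicate 4 a from rfl, tr_replicate, map_zero, smul_zero]
    · have h1 : tr n 4 (Wd [b, c, d, a]) = tr n 4 (Wd [a, b, c, d]) := tr_isRotated ⟨3, rfl⟩
      have h2 : tr n 4 (Wd [c, d, a, b]) = tr n 4 (Wd [a, b, c, d]) := tr_isRotated ⟨2, rfl⟩
      have h3 : tr n 4 (Wd [d, a, b, c]) = tr n 4 (Wd [a, b, c, d]) := tr_isRotated ⟨1, rfl⟩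
      rw [map_add, map_add, map_add, h1, h2, h3]
      abel
  have ginj : Function.Injective g := by
    rw [← LinearMap.ker_eq_bot, LinearMap.ker_eq_bot']
    intro c hc
    obtain ⟨y, rfl⟩ := qC_surjective n 4 c
    refine eq_zero_of_smul_eq_zero (m := 4) (by norm_num) ?_
    have := LinearMap.congr_fun h4 y
    rw [LinearMap.comp_apply, ← hg, hc, map_zero] at this
    exact this.symm
  have hr : LinearMap.range g = LinearMap.range (rotSum n) := by
    have e : g ∘ₗ qC n 4 = rotSum n := LinearMap.ext hg
    rw [← e, LinearMap.range_comp_of_range_eq_top _ (LinearMap.range_eq_top.2 (qC_surjective n 4))]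
  have h := trace_eq_mul_finrank_range (f := rotSum n) (c := 4) rotSum_rotSum
  rw [trace_rotSum, ← hr] at h
  rw [h, (LinearEquiv.ofInjective g ginj).finrank_eq]

/-! ### The rank of the image of τ in degree four. -/

/-- The map `(w_1, …, w_n) ↦ ∑ i, x_i^* ⊗ [w_i, x_i]`. -/
def DSum (n : ℕ) : (Fin n → L n 4) →ₗ[ℤ] (H n →ₗ[ℤ] L n 5) := 
  ∑ i, D i ∘ₗ LinearMap.proj i

theorem DSum_apply {n : ℕ} (w : Fin n → L n 4) : DSum n w = ∑ i, D i (w i) := by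
  rw [DSum, LinearMap.sum_apply]; rfl

/-- Evaluation at x_j isolates [w_j, x_j], and ad x_j is injective on 𝓛(4). -/
theorem DSum_injective (n : ℕ) : Function.Injective (DSum n) := by
  rw [← LinearMap.ker_eq_bot, LinearMap.ker_eq_bot']
  intro w hw
  ext j
  refine iota_four_injective ((iota_eq_zero_of_ad (k := 2) j (w j) ?_).trans (map_zero _).symm)
  have h := LinearMap.congr_fun hw (x j)
  rw [DSum_apply, LinearMap.sum_apply, Finset.sum_eq_single j] at h
  · rw [D_x, if_pos rfl] at h
    rw [h]; simp
  · intro i _ hi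
    rw [D_x, if_neg hi.symm]
  · simp

theorem range_DSum (n : ℕ) : LinearMap.range (DSum n) = p n 4 := by
  apply le_antisymm
  · rintro _ ⟨w, rfl⟩
    rw [DSum_apply]
    exact sum_mem fun i _ => D_mem_p i (w i)
  · refine p_le_iff.2 fun i a l _ => ⟨Pi.single i (cl 4 a l), ?_⟩
    rw [DSum_apply, Finset.sum_eq_single i, Pi.single_eq_same]
    · intro j _ hj; rw [Pi.single_eq_of_ne hj, map_zero]
    · simp

/-- `𝔭_n(4)` is a sum of `n` copies of `𝓛_n(4)`. -/
def pEquiv (n : ℕ) : (Fin n → L n 4) ≃ₗ[ℤ] p n 4 :=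
  (LinearEquiv.ofInjective _ (DSum_injective n)).trans (LinearEquiv.ofEq _ _ (range_DSum n))

theorem range_tau_le_p (n : ℕ) : LinearMap.range (tau n 4) ≤ p n 4 := by
  rintro _ ⟨g, rfl⟩
  exact tau_mem_p (by omega) le_rfl g

/-- The image of the Johnson homomorphism is the kernel of the trace. -/
def rangeTauEquiv (n : ℕ) : LinearMap.range (tau n 4) ≃ₗ[ℤ] LinearMap.ker (TrBar n 4) :=
  (Submodule.comapSubtypeEquivOfLe (range_tau_le_p n)).symm.trans (LinearEquiv.ofEq _ _ (by
    ext f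
    exact mem_range_tau_iff (by omega) le_rfl f.2))

theorem range_tau_free (n : ℕ) : Module.Free ℤ (LinearMap.range (tau n 4)) := by
  have := L_four_free n
  have := L_four_finite n
  have : Module.Free ℤ (p n 4) := Module.Free.of_equiv (pEquiv n)
  have : Module.Finite ℤ (p n 4) := Module.Finite.equiv (pEquiv n)
  exact Module.Free.of_equiv (rangeTauEquiv n).symm

theorem finrank_range_tau (n : ℕ) : Module.finrank ℤ (LinearMap.range (tau n 4)) =
    n ^ 2 * (n - 1) ^ 2 * (n + 1) / 4 := by
  have := L_four_free n
  have := L_four_finite n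
  have : Module.Finite ℤ (p n 4) := Module.Finite.equiv (pEquiv n)
  have h1 : Module.finrank ℤ (p n 4) = n * Module.finrank ℤ (L n 4) := by
    rw [← (pEquiv n).finrank_eq, Module.finrank_pi_fintype]; simp
  have h2 : Module.finrank ℤ (LinearMap.range (TrBar n 4)) +
      Module.finrank ℤ (LinearMap.ker (TrBar n 4)) = Module.finrank ℤ (p n 4) := by
    rw [← (TrBar n 4).quotKerEquivRange.finrank_eq]
    exact Submodule.finrank_quotient_add_finrank _
  have h3 : n * (n - 1) / 2 + Module.finrank ℤ (LinearMap.range (TrBar n 4)) =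
      Module.finrank ℤ (CBar n 4) := by
    rw [← finrank_coker]
    exact Submodule.finrank_quotient_add_finrank _
  rw [(rangeTauEquiv n).finrank_eq]
  have h4 := four_mul_finrank_L n
  have h5 := four_mul_finrank_CBar n
  have h6 : n * (n - 1) / 2 * 2 = n * (n - 1) :=
    Nat.div_mul_cancel (Nat.even_mul_pred_self n).two_dvd
  symm
  refine Nat.div_eq_of_eq_mul_right (by norm_num) ?_
  -- The case n = 0 is separated because n − 1 is truncated subtraction; afterwards the count is
  -- linear algebra over ℤ.
  rcases n with _ | m
  · rw [zero_mul] at h1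
    rw [(Nat.add_eq_zero_iff.1 (h2.trans h1)).2]
    rfl
  · rw [Nat.add_sub_cancel] at h3 h6 ⊢
    zify at h1 h2 h3 h6 ⊢
    push_cast at h4 h5
    linear_combination (-4) * h2 - 4 * h1 - (m + 1) * h4 + 4 * h3 + h5 - 2 * h6

/-! ### Equivariance -/

theorem rhoH_mk {n : ℕ} (s : Equiv.Perm (Fin n)) (y : F n) :
    rhoH n s (H.mk y) = H.mk (permAut n s y) := by
  have h : (AddMonoidHom.toMultiplicativeRight (rhoH n s).toAddMonoidHom).comp Abelianization.of =
      Abelianization.of.comp (permAut n s).toMonoidHom := by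
    ext i
    exact (rhoH_x s i).trans (congrArg H.mk (permAut_of s i)).symm
  exact DFunLike.congr_fun h y

theorem tau_conj {n k : ℕ} (s : Equiv.Perm (Fin n)) (g : gr n k) :
    tau n k (rhoGr n k s g) = rhoHom n (k + 1) s (tau n k g) := by
  induction g using gr.ind with | _ σ
  refine H.hom_ext fun y => ?_
  change tau n k (gr.conj k s (gr.mk σ)) (H.mk y) =
    L.map (k + 1) (permAut n s) (tau n k (gr.mk σ) (rhoH n s⁻¹ (H.mk y)))
  rw [gr.conj_mk, tau_mk_apply, rhoH_mk, tau_mk_apply, L.map_mk]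
  refine congrArg L.mk (Subtype.ext ?_)
  simp

/-- The action of a permutation on the tensor algebra. -/
def permT {n : ℕ} (s : Equiv.Perm (Fin n)) : TensorAlgebra ℤ (H n) →ₐ[ℤ] TensorAlgebra ℤ (H n) :=
  TensorAlgebra.lift ℤ (TensorAlgebra.ι ℤ ∘ₗ rhoH n s)

theorem permT_X {n : ℕ} (s : Equiv.Perm (Fin n)) (i : Fin n) : permT s (X i) = X (s i) := by
  rw [permT, X, TensorAlgebra.lift_ι_apply, LinearMap.comp_apply, rhoH_x]

theorem permT_Wd {n : ℕ} (s : Equiv.Perm (Fin n)) (l : List (Fin n)) :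
    permT s (Wd l) = Wd (l.map s) := by
  induction l with
  | nil => rw [List.map_nil, Wd_nil, map_one]
  | cons i l ih => rw [List.map_cons, Wd_cons, Wd_cons, map_mul, permT_X, ih]

theorem permT_lp {n : ℕ} (s : Equiv.Perm (Fin n)) (a : Fin n) (l : List (Fin n)) :
    permT s (lp (X a) l) = lp (X (s a)) (l.map s) := by
  induction l using List.reverseRecOn with
  | nil => exact permT_X s a
  | append_singleton l b ih =>
    rw [List.map_append, List.map_singleton, lp_concat, lp_concat, map_sub, map_mul, map_mul, ih,
      permT_X]

theorem permT_dL {n : ℕ} (s : Equiv.Perm (Fin n)) (i : Fin n) (z : TensorAlgebra ℤ (H n)) :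
    permT s (dL i z) = dL (s i) (permT s z) := by
  have h : (permT s).toLinearMap ∘ₗ dL i = dL (s i) ∘ₗ (permT s).toLinearMap :=
    hom_ext_Wd fun l => by
      rw [LinearMap.comp_apply, LinearMap.comp_apply, AlgHom.toLinearMap_apply,
        AlgHom.toLinearMap_apply, permT_Wd]
      rcases l with _ | ⟨j, l⟩
      · rw [List.map_nil, Wd_nil, dL_Wd_nil, dL_Wd_nil, map_zero]
      · rw [List.map_cons, dL_Wd_cons, dL_Wd_cons, apply_ite (permT s), map_zero, permT_Wd]
        simp only [EmbeddingLike.apply_eq_iff_eq]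
  exact LinearMap.congr_fun h z

theorem tr_permT {n k : ℕ} (s : Equiv.Perm (Fin n)) (z : TensorAlgebra ℤ (H n)) :
    tr n k (permT s z) = rhoCBar n k s (tr n k z) := by
  have h : tr n k ∘ₗ (permT s).toLinearMap = rhoCBar n k s ∘ₗ tr n k := hom_ext_Wd fun l => by
    rw [LinearMap.comp_apply, LinearMap.comp_apply, AlgHom.toLinearMap_apply, permT_Wd]
    by_cases hl : l.length = k
    · obtain ⟨a, rfl⟩ : ∃ a : Fin k → Fin n, l = List.ofFn a := by
        subst hl; exact ⟨l.get, by simp⟩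
      rw [List.map_ofFn, tr_Wd_ofFn, tr_Wd_ofFn]
      change _ = qC n k (rhoT n k s (tw a))
      refine congrArg (qC n k) ((rhoT_tprod s _).trans ?_).symm
      simp only [rhoH_x]
      rfl
    · rw [tr_Wd_of_ne hl, tr_Wd_of_ne (by rwa [List.length_map]), map_zero]
  exact LinearMap.congr_fun h z

theorem permAut_lnc {n : ℕ} (s : Equiv.Perm (Fin n)) (a : Fin n) (l : List (Fin n)) :
    permAut n s (lnc (FreeGroup.of a) l) = lnc (FreeGroup.of (s a)) (l.map s) := by
  induction l using List.reverseRecOn with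
  | nil => exact permAut_of s a
  | append_singleton l b ih =>
    rw [List.map_append, List.map_singleton, lnc_concat, lnc_concat, map_commutatorElement, ih,
      permAut_of]

theorem rhoHom_D {n k : ℕ} (s : Equiv.Perm (Fin n)) (i a : Fin n) (l : List (Fin n))
    (hl : l.length + 1 = k) :
    rhoHom n (k + 1) s (D i (cl k a l)) = D (s i) (cl k (s a) (l.map s)) := by
  have h (j b : Fin n) (t : List (Fin n)) (ht : t.length + 1 = k) :
      D j (cl k b t) = star j (cl (k + 1) b (t ++ [j])) := by
    rw [D_apply, L.ad_cls _ (cl_mem b ht), cl, lnc_concat]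
  rw [h i a l hl, h _ _ _ (by rwa [List.length_map]), rhoHom_star]
  congr 1
  rw [cl, cl, cls_of_mem (cl_mem a (by simpa using hl)), cls_of_mem (cl_mem _ (by simpa using hl))]
  change L.map (k + 1) (permAut n s) (L.mk _) = _
  rw [L.map_mk]
  refine congrArg L.mk (Subtype.ext ?_)
  dsimp only
  rw [permAut_lnc, List.map_append, List.map_singleton]

/-- It is enough to test generators, where the trace is given by tensor algebra operations that
visibly commute with permuting letters; k ≥ 2 makes `qC_Phi_D` applicable. -/
theorem TrBar_conj {n k : ℕ} (hk : 2 ≤ k) (s : Equiv.Perm (Fin n)) (f : p n k) :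
    TrBar n k (rhoP n k s f) = rhoCBar n k s (TrBar n k f) := by
  obtain ⟨K, rfl⟩ : ∃ K, k = K + 1 := ⟨k - 1, by omega⟩
  have h : p n (K + 1) ≤ LinearMap.ker (qC n (K + 1) ∘ₗ Phi n (K + 1) ∘ₗ rhoHom n (K + 1 + 1) s -
      rhoCBar n (K + 1) s ∘ₗ qC n (K + 1) ∘ₗ Phi n (K + 1)) := by
    refine p_le_iff.2 fun i a l hl => ?_
    have hl0 : l ≠ [] := by rintro rfl; simp at hl; omega
    rw [LinearMap.mem_ker, LinearMap.sub_apply, sub_eq_zero]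
    change qC n (K + 1) (Phi n (K + 1) (rhoHom n (K + 1 + 1) s _)) =
      rhoCBar n (K + 1) s (qC n (K + 1) (Phi n (K + 1) _))
    rw [rhoHom_D s i a l (by omega), qC_Phi_D _ _ (by simpa using hl) (by simpa using hl0),
      qC_Phi_D _ _ (by omega) hl0, ← tr_permT, map_mul (permT s), permT_dL, permT_lp, permT_X]
  exact sub_eq_zero.1 (h f.2)

theorem pairs_conj {n : ℕ} {q : CBar n 4 →ₗ[ℤ] MonoidAlgebra ℤ (Set.powersetCard (Fin n) 2)}
    (hq : ∀ a b c d, q (tr n 4 (Wd [a, b, c, d])) = pairVal a b c d) (s : Equiv.Perm (Fin n))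
    (c : CBar n 4) : q (rhoCBar n 4 s c) = rhoPairs n s (q c) := by
  have h : q ∘ₗ rhoCBar n 4 s = rhoPairs n s ∘ₗ q := CBar_hom_ext fun l hl => by
    obtain ⟨a, b, c, d, rfl⟩ : ∃ a b c d, l = [a, b, c, d] := by
      rcases l with _ | ⟨a, l⟩
      · simp at hl
      · obtain ⟨b, c, d, rfl⟩ := List.length_eq_three.1 (Nat.succ_injective hl)
        exact ⟨a, b, c, d, rfl⟩
    rw [LinearMap.comp_apply, LinearMap.comp_apply, ← tr_permT, permT_Wd, hq, pairVal_perm]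
    exact hq _ _ _ _
  exact LinearMap.congr_fun h c

theorem exact_tau_TrBar {n k : ℕ} (hk : 2 ≤ k) (hk' : k ≤ 4) (hτ : ∀ g, tau n k g ∈ p n k) :
    Function.Exact ((tau n k).codRestrict (p n k) hτ) (TrBar n k) := by
  intro f
  rw [TrBar_apply, ← mem_range_tau_iff hk hk' f.2]
  exact ⟨fun ⟨g, hg⟩ => ⟨g, Subtype.ext hg⟩, fun ⟨g, hg⟩ => ⟨g, congrArg Subtype.val hg⟩⟩

theorem codRestrict_tau_injective {n k : ℕ} (hτ : ∀ g, tau n k g ∈ p n k) :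
    Function.Injective ((tau n k).codRestrict (p n k) hτ) := fun _ _ h =>
  tau_injective n k (congrArg Subtype.val h)

end

end BasisConj

/-! ### The exact sequences and the ranks. -/

theorem theorem1 (n : ℕ) (hn : 3 ≤ n) :
    (∀ k : ℕ, k = 2 ∨ k = 3 →
      ∃ hτ : ∀ g : BasisConj.gr n k, BasisConj.tau n k g ∈ BasisConj.p n k,
        Function.Injective ((BasisConj.tau n k).codRestrict (BasisConj.p n k) hτ) ∧
        Function.Exact ((BasisConj.tau n k).codRestrict (BasisConj.p n k) hτ)
          (BasisConj.TrBar n k) ∧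
        Function.Surjective (BasisConj.TrBar n k) ∧
        (BasisConj.rhoGr n k).IsIntertwiningMap (BasisConj.rhoP n k)
          ((BasisConj.tau n k).codRestrict (BasisConj.p n k) hτ) ∧
        (BasisConj.rhoP n k).IsIntertwiningMap (BasisConj.rhoCBar n k) (BasisConj.TrBar n k)) ∧
    (∃ hτ : ∀ g : BasisConj.gr n 4, BasisConj.tau n 4 g ∈ BasisConj.p n 4,
      ∃ q : BasisConj.CBar n 4 →ₗ[ℤ] MonoidAlgebra ℤ (Set.powersetCard (Fin n) 2),
        Function.Injective ((BasisConj.tau n 4).codRestrict (BasisConj.p n 4) hτ) ∧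
        Function.Exact ((BasisConj.tau n 4).codRestrict (BasisConj.p n 4) hτ)
          (BasisConj.TrBar n 4) ∧
        Function.Exact (BasisConj.TrBar n 4) q ∧
        Function.Surjective q ∧
        (BasisConj.rhoGr n 4).IsIntertwiningMap (BasisConj.rhoP n 4)
          ((BasisConj.tau n 4).codRestrict (BasisConj.p n 4) hτ) ∧
        (BasisConj.rhoP n 4).IsIntertwiningMap (BasisConj.rhoCBar n 4) (BasisConj.TrBar n 4) ∧
        (BasisConj.rhoCBar n 4).IsIntertwiningMap (BasisConj.rhoPairs n) q) ∧
    (Module.Free ℤ (BasisConj.CBar n 4 ⧸ LinearMap.range (BasisConj.TrBar n 4)) ∧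
      Module.finrank ℤ (BasisConj.CBar n 4 ⧸ LinearMap.range (BasisConj.TrBar n 4)) =
        n * (n - 1) / 2) ∧
    (Module.Free ℤ (LinearMap.range (BasisConj.tau n 4)) ∧
      Module.finrank ℤ (LinearMap.range (BasisConj.tau n 4)) =
        n ^ 2 * (n - 1) ^ 2 * (n + 1) / 4) := by
  refine ⟨fun k hk => ?_, ?_, ⟨BasisConj.coker_free n, BasisConj.finrank_coker n⟩,
    ⟨BasisConj.range_tau_free n, BasisConj.finrank_range_tau n⟩⟩
  · refine ⟨BasisConj.tau_mem_p (by omega) (by omega), BasisConj.codRestrict_tau_injective _,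
      BasisConj.exact_tau_TrBar (by omega) (by omega) _, BasisConj.TrBar_surjective hk, ⟨?_⟩, ⟨?_⟩⟩
    · exact fun s g => Subtype.ext (BasisConj.tau_conj s g)
    · exact fun s f => BasisConj.TrBar_conj (by omega) s f
  · obtain ⟨q, hq⟩ := BasisConj.exists_pairs_lift n
    refine ⟨BasisConj.tau_mem_p (by omega) le_rfl, q, BasisConj.codRestrict_tau_injective _,
      BasisConj.exact_tau_TrBar (by omega) le_rfl _, BasisConj.exact_TrBar_four hq,
      BasisConj.pairs_surjective hq, ⟨?_⟩, ⟨?_⟩, ⟨BasisConj.pairs_conj hq⟩⟩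
    · exact fun s g => Subtype.ext (BasisConj.tau_conj s g)
    · exact fun s f => BasisConj.TrBar_conj (by omega) s f
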